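/- Let $k$ be a positive integer. A $k$-graph is a countable small category $\Lambda$ with a degree functor $d:\Lambda\to\mathbb N^k$ with the unique factorization property: if $d(\lambda)=\mathbf n+\mathbf m$, there are unique $\alpha,\beta$ with $\lambda=\alpha\beta$, $d(\alpha)=\mathbf n$, $d(\beta)=\mathbf m$. Write $r,s$ for range and source, $\Lambda^0$ for the set of objects, $v\Lambda^{\mathbf n}=\{\lambda: r(\lambda)=v,\ d(\lambda)=\mathbf n\}$ and $u\Lambda^{\mathbf n}v=\{\lambda\in u\Lambda^{\mathbf n}: s(\lambda)=v\}$. Let $\mathbf e_1,\dots,\mathbf e_k$ be the canonical basis of $\mathbb N^k$. Let $\Lambda$ and $\Omega$ be $k$-graphs with finitely many objects that are row-finite without sources, i.e. $0<|v\Lambda^{\mathbf n}|<\infty$ for all $v\in\Lambda^0$, $\mathbf n\in\mathbb N^k$, and likewise for $\Omega$. Let $A_{\mathbf n}(u,v)=|u\Lambda^{\mathbf n}v|$ and $B_{\mathbf n}(x,y)=|x\Omega^{\mathbf n}y|$ be their vertex matrices. Notation (for $\Lambda$; likewise for $\Omega$): * The dimension group $H_\Lambda$ is the direct limit over $\mathbf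 n\in\mathbb Z^k$ of the groups $\mathbb Z\Lambda^0$ along the maps $x\mapsto xA_{\mathbf n-\mathbf m}$ for $\mathbf m\le\mathbf n$; $[x,\mathbf n]$ is the class of $x$ in position $\mathbf n$. Its positive cone is $H_\Lambda^+=\{[x,\mathbf n]: x\in\mathbb N\Lambda^0\}$, its order unit is $[(1,\dots,1),0]$, and $\delta_i^\Lambda[x,\mathbf n]=[xA_{\mathbf e_i},\mathbf n]=[x,\mathbf n-\mathbf e_i]$. * The talented monoid $T_\Lambda$ is the commutative monoid generated by the symbols $v(\mathbf n)$, $v\in\Lambda^0$, $\mathbf n\in\mathbb Z^k$, subject to $v(\mathbf n)=\sum_{\alpha\in v\Lambda^{\mathbf e_i}}s(\alpha)(\mathbf n+\mathbf e_i)$ for $i=1,\dots,k$, with the $\mathbb Z^k$-action ${}^{\mathbf q}v(\mathbf n)=v(\mathbf n+\mathbf q)$. * $\Lambda^\infty$ is the space of infinite paths of $\Lambda$, with the topology generated by the cylinder sets $Z(\lambda)=\lambda\Lambda^\infty$, and $\sigma^{\mathbf p}$ is the shift by $\mathbf p\in\mathbb N^k$. The path groupoid $\mathcal G_\Lambda$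 consists of the triples $(x,\mathbf n-\mathbf m,y)\in\Lambda^\infty\times\mathbb Z^k\times\Lambda^\infty$ with $\mathbf n,\mathbf m\in\mathbb N^k$ and $\sigma^{\mathbf n}(x)=\sigma^{\mathbf m}(y)$; it has range $x$, source $y$, and the topology with basis $Z(\lambda,\mu)=\{(\lambda z,d(\lambda)-d(\mu),\mu z): z\in s(\lambda)\Lambda^\infty\}$, $s(\lambda)=s(\mu)$. It is graded by $(x,\mathbf n,y)\mapsto\mathbf n$. * $H_0^{\rm gr}(\mathcal G_\Lambda)=C_c(\Lambda^\infty\times\mathbb Z^k,\mathbb Z)/\operatorname{Im}(s_*-r_*)$ is the zeroth integral homology of the skew product groupoid $\mathcal G_\Lambda\times\mathbb Z^k$, in which $(g,\mathbf m)$ with $g=(x,\mathbf n,y)$ has range $(x,\mathbf m)$ and source $(y,\mathbf m+\mathbf n)$. Here $(s_*f)(u)=\sum_{s(g)=u}f(g)$, and similarly for $r_*$. Its positive cone $H_0^{\rm gr}(\mathcal G_\Lambda)^+$ consists of the classes of functions $f\ge0$, and $\mathbf q\in\mathbb Z^k$ acts by $(\mathbf q\cdot f)(x,\mathbf m)=f(x,\mathbf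 m-\mathbf q)$. Theorem. The following are equivalent. (i) There are $R\in\mathbb M_{\Lambda^0\times\Omega^0}(\mathbb N)$, $S\in\mathbb M_{\Omega^0\times\Lambda^0}(\mathbb N)$ and $\mathbf p\in\mathbb N^k$ with $A_{\mathbf p}=RS$, $B_{\mathbf p}=SR$, and $A_{\mathbf e_i}R=RB_{\mathbf e_i}$, $B_{\mathbf e_i}S=SA_{\mathbf e_i}$ for all $i=1,\dots,k$. (ii) There is a group isomorphism $\phi:H_\Lambda\to H_\Omega$ with $\phi(H_\Lambda^+)=H_\Omega^+$ and $\phi\circ\delta_i^\Lambda=\delta_i^\Omega\circ\phi$ for all $i=1,\dots,k$. (iii) $T_\Lambda$ and $T_\Omega$ are isomorphic as $\mathbb Z^k$-monoids. (iv) There is a $\mathbb Z[\mathbb Z^k]$-module isomorphism $\varphi:H_0^{\rm gr}(\mathcal G_\Lambda)\to H_0^{\rm gr}(\mathcal G_\Omega)$ with $\varphi(H_0^{\rm gr}(\mathcal G_\Lambda)^+)=H_0^{\rm gr}(\mathcal G_\Omega)^+$. Furthermore, there are group isomorphisms $\kappa_\Lambda:H_\Lambda\to H_0^{\rm gr}(\mathcal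 G_\Lambda)$ and $\kappa_\Omega:H_\Omega\to H_0^{\rm gr}(\mathcal G_\Omega)$ with $\kappa_\Lambda[\epsilon_v,\mathbf n]=[1_{Z(v)\times\{\mathbf n\}}]$ and $\kappa_\Omega[\epsilon_w,\mathbf n]=[1_{Z(w)\times\{\mathbf n\}}]$ for all $v\in\Lambda^0$, $w\in\Omega^0$, $\mathbf n\in\mathbb Z^k$, where $\epsilon_v$, $\epsilon_w$ are the standard basis vectors. The relation $\varphi\circ\kappa_\Lambda=\kappa_\Omega\circ\phi$ is a one-to-one correspondence between the isomorphisms $\phi$ as in (ii) and the isomorphisms $\varphi$ as in (iv), and if $\phi$ and $\varphi$ correspond, then $\phi$ preserves the order units, i.e. $\phi([(1,\dots,1),0])=[(1,\dots,1),0]$, if and only if $\varphi([1_{\Lambda^\infty\times\{0\}}])=[1_{\Omega^\infty\times\{0\}}]$. -/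

import Mathlib

open scoped CompactlySupported

/-! ## Small categories, groupoids and higher-rank graphs -/

/-- A small category with set of objects `X` and set of morphisms `M`, given by its structure maps:
range `r`, source `s`, identities `one`, and the product `comp a b = ab`, defined for
`s a = r b`. -/
structure SmallCat (X M : Type*) where
  r : M → X
  s : M → X
  one : X → M
  comp : (a b : M) → s a = r b → M
  r_one : ∀ x, r (one x) = x
  s_one : ∀ x, s (one x) = x
  r_comp : ∀ a b h, r (comp a b h) = r a
  s_comp : ∀ a b h, s (comp a b h) = s b
  one_comp : ∀ a, comp (one (r a)) a (s_one _) = a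
  comp_one : ∀ a, comp a (one (s a)) (r_one _).symm = a
  assoc : ∀ a b c (h₁ : s a = r b) (h₂ : s b = r c),
    comp (comp a b h₁) c ((s_comp a b h₁).trans h₂)
      = comp a (comp b c h₂) (h₁.trans (r_comp b c h₂).symm)

/-- A groupoid with unit space `X` and set of arrows `G`. -/
structure ArrowGroupoid (X G : Type*) extends SmallCat X G where
  inv : G → G
  r_inv : ∀ g, r (inv g) = s g
  s_inv : ∀ g, s (inv g) = r g
  comp_inv : ∀ g, comp g (inv g) (r_inv g).symm = one (r g)
  inv_comp : ∀ g, comp (inv g) g (s_inv g) = one (s g)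

/-- A `k`-graph with set of vertices (objects) `V` and set of paths (morphisms) `P`: a countable
small category with a degree functor `d` to the monoid `ℕ^k` (a category with one object) that has
the unique factorization property. -/
structure KGraph (k : ℕ) (V P : Type*) extends SmallCat V P where
  countable_path : Countable P
  d : P → (Fin k → ℕ)
  d_one : ∀ v, d (one v) = 0
  d_comp : ∀ a b h, d (comp a b h) = d a + d b
  factorization : ∀ (l : P) (n m : Fin k → ℕ), d l = n + m →
    ∃! ab : P × P, d ab.1 = n ∧ d ab.2 = m ∧ ∃ h : s ab.1 = r ab.2, comp ab.1 ab.2 h = l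

namespace KGraph

variable {k : ℕ} {V P : Type*} (Λ : KGraph k V P)

/-- The set `vΛⁿ` of paths of degree `n` with range `v`. -/
def pathsFrom (v : V) (n : Fin k → ℕ) : Set P := {l | Λ.r l = v ∧ Λ.d l = n}

/-- `Λ` is row-finite without sources: `0 < |vΛⁿ| < ∞` for all `v` and `n`. -/
def RowFiniteNoSources : Prop :=
  ∀ (v : V) (n : Fin k → ℕ), (Λ.pathsFrom v n).Finite ∧ (Λ.pathsFrom v n).Nonempty

/-- The vertex matrices `Aₙ(u, v) = |uΛⁿv|`. -/
noncomputable def vertexMatrix (n : Fin k → ℕ) : Matrix V V ℕ :=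
  Matrix.of fun u v => Set.ncard {l : P | Λ.r l = u ∧ Λ.s l = v ∧ Λ.d l = n}

/-! ## The talented monoid -/

/-- The defining relations `v(n) = ∑_{α ∈ vΛ^{eᵢ}} s(α)(n + eᵢ)` of the talented monoid, on the free
commutative monoid with basis the symbols `v(n)`. -/
inductive TalentedRel : (V × (Fin k → ℤ) →₀ ℕ) → (V × (Fin k → ℤ) →₀ ℕ) → Prop
  | rel (v : V) (n : Fin k → ℤ) (i : Fin k) :
      TalentedRel (Finsupp.single (v, n) 1)
        (∑ᶠ α ∈ Λ.pathsFrom v (Pi.single i 1), Finsupp.single (Λ.s α, n + Pi.single i 1) 1)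

/-- The talented monoid `T_Λ`. -/
def TalentedMonoid : Type _ := (addConGen Λ.TalentedRel).Quotient

noncomputable instance : AddCommMonoid Λ.TalentedMonoid :=
  inferInstanceAs (AddCommMonoid (addConGen Λ.TalentedRel).Quotient)

/-- Translation by `q` on the free commutative monoid: `v(n) ↦ v(n + q)`. -/
noncomputable def freeShift (V : Type*) {k : ℕ} (q : Fin k → ℤ) :
    (V × (Fin k → ℤ) →₀ ℕ) →+ (V × (Fin k → ℤ) →₀ ℕ) :=
  Finsupp.mapDomain.addMonoidHom fun a => (a.1, a.2 + q)

theorem freeShift_single (v : V) (n q : Fin k → ℤ) :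
    freeShift V q (Finsupp.single (v, n) 1) = Finsupp.single (v, n + q) 1 :=
  Finsupp.mapDomain_single

theorem freeShift_injective (q : Fin k → ℤ) : Function.Injective (freeShift V q) := by
  refine Finsupp.mapDomain_injective fun a b h => ?_
  simp only [Prod.mk.injEq, add_left_inj] at h
  exact Prod.ext h.1 h.2

theorem freeShift_rel (q : Fin k → ℤ) {a b : V × (Fin k → ℤ) →₀ ℕ} (h : Λ.TalentedRel a b) :
    Λ.TalentedRel (freeShift V q a) (freeShift V q b) := by
  obtain ⟨v, n, i⟩ := h
  rw [freeShift_single, AddMonoidHom.map_finsum_of_injective _ (freeShift_injective q)]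
  simp_rw [AddMonoidHom.map_finsum_of_injective _ (freeShift_injective q), freeShift_single,
    add_right_comm n _ q]
  exact TalentedRel.rel v (n + q) i

/-- The action of `q ∈ ℤ^k` on `T_Λ`, determined by `v(n) ↦ v(n + q)`. -/
noncomputable def talentedShift (q : Fin k → ℤ) : Λ.TalentedMonoid →+ Λ.TalentedMonoid :=
  AddCon.lift (addConGen Λ.TalentedRel)
    ((AddCon.mk' (addConGen Λ.TalentedRel)).comp (freeShift V q))
    (AddCon.addConGen_le.2 fun _ _ h => (AddCon.eq _).2 (AddConGen.Rel.of _ _ (freeShift_rel Λ q h)))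

/-! ## The dimension group -/

section DimensionGroup

variable [Fintype V]

/-- The connecting maps `x ↦ x A_{n - m}` of the directed system of the groups `ℤΛ⁰` indexed by
`ℤ^k`, for `m ≤ n`. -/
noncomputable def connectingMap (m n : Fin k → ℤ) (_ : m ≤ n) : (V → ℤ) →+ (V → ℤ) :=
  ((Λ.vertexMatrix fun i => (n i - m i).toNat).map ((↑) : ℕ → ℤ)).vecMulLinear.toAddMonoidHom

/-- The dimension group `H_Λ`, the direct limit of the groups `ℤΛ⁰` along the maps
`x ↦ x A_{n - m}`. -/
def DimensionGroup : Type _ :=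
  AddCommGroup.DirectLimit (fun _ : Fin k → ℤ => V → ℤ) Λ.connectingMap

noncomputable instance : AddCommGroup Λ.DimensionGroup :=
  inferInstanceAs
    (AddCommGroup (AddCommGroup.DirectLimit (fun _ : Fin k → ℤ => V → ℤ) Λ.connectingMap))

/-- The class `[x, n]` in `H_Λ`. -/
noncomputable def dimClass (n : Fin k → ℤ) : (V → ℤ) →+ Λ.DimensionGroup :=
  AddCommGroup.DirectLimit.of (fun _ : Fin k → ℤ => V → ℤ) Λ.connectingMap n

/-- The positive cone `H_Λ⁺ = {[x, n] | x ∈ ℕΛ⁰}`. -/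
def dimPositive : Set Λ.DimensionGroup := {h | ∃ n x, 0 ≤ x ∧ h = Λ.dimClass n x}

/-- The order unit `[(1, …, 1), 0]`. -/
noncomputable def dimUnit : Λ.DimensionGroup := Λ.dimClass 0 fun _ => 1

/-- The maps `δᵢ [x, n] = [x, n - eᵢ]`. As `n - eᵢ ≤ n`, this is also `[x A_{eᵢ}, n]`. -/
noncomputable def dimShift (i : Fin k) : Λ.DimensionGroup →+ Λ.DimensionGroup :=
  AddCommGroup.DirectLimit.lift (fun _ : Fin k → ℤ => V → ℤ) Λ.connectingMap Λ.DimensionGroup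
    (fun n => Λ.dimClass (n - Pi.single i 1)) (fun m n hmn x => by
      have h : Λ.connectingMap m n hmn x = Λ.connectingMap (m - Pi.single i 1)
          (n - Pi.single i 1) (sub_le_sub_right hmn _) x := by
        simp [connectingMap]
      rw [h]
      exact AddCommGroup.DirectLimit.of_f _ _)

theorem dimShift_dimClass (i : Fin k) (n : Fin k → ℤ) (x : V → ℤ) :
    Λ.dimShift i (Λ.dimClass n x) = Λ.dimClass (n - Pi.single i 1) x :=
  AddCommGroup.DirectLimit.lift_of (f := Λ.connectingMap) _ _ _ _ _

theorem dimShift_dimClass' (i : Fin k) (n : Fin k → ℤ) (x : V → ℤ) :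
    Λ.dimShift i (Λ.dimClass n x) =
      Λ.dimClass n (Matrix.vecMul x ((Λ.vertexMatrix (Pi.single i 1)).map ((↑) : ℕ → ℤ))) := by
  rw [dimShift_dimClass]
  have hle : n - (Pi.single i 1 : Fin k → ℤ) ≤ n := by
    simp [Pi.single_nonneg]
  have hs : (fun j => (n j - (n - (Pi.single i 1 : Fin k → ℤ)) j).toNat) = Pi.single (M := fun _ => ℕ) i 1 := by
    funext j
    by_cases hj : j = i
    · subst hj; simp
    · simp [Pi.single_eq_of_ne hj]
  have h : Λ.connectingMap (n - Pi.single i 1) n hle x =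
      Matrix.vecMul x ((Λ.vertexMatrix (Pi.single i 1)).map ((↑) : ℕ → ℤ)) := by
    rw [← hs]; rfl
  rw [← h]
  exact (AddCommGroup.DirectLimit.of_f _ _).symm

end DimensionGroup

end KGraph

/-! ## Homology of groupoids -/

namespace ArrowGroupoid

section Homology

variable {X G : Type*} [TopologicalSpace X] [TopologicalSpace G] (𝒢 : ArrowGroupoid X G)

/-- The image of the boundary map `∂₁ = s_* - r_* : C_c(G, ℤ) → C_c(X, ℤ)`, where
`(s_* f)(x) = ∑_{s(g) = x} f(g)`, and `r_*` likewise. For an étale groupoid these sums are always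
finite; the finiteness conditions only say that they make sense. -/
noncomputable def boundaryRange : AddSubgroup C_c(X, ℤ) where
  carrier := {a | ∃ f : C_c(G, ℤ),
    (∀ x, {g | 𝒢.s g = x ∧ f g ≠ 0}.Finite) ∧ (∀ x, {g | 𝒢.r g = x ∧ f g ≠ 0}.Finite) ∧
    ∀ x, a x = (∑ᶠ g ∈ {g | 𝒢.s g = x}, f g) - ∑ᶠ g ∈ {g | 𝒢.r g = x}, f g}
  zero_mem' := ⟨0, by simp, by simp, by simp⟩
  add_mem' := by
    rintro a b ⟨f, hs, hr, hf⟩ ⟨f', hs', hr', hf'⟩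
    refine ⟨f + f', fun x => ((hs x).union (hs' x)).subset ?_,
      fun x => ((hr x).union (hr' x)).subset ?_, fun x => ?_⟩
    · rintro g ⟨h1, h2⟩
      by_cases h : f g = 0
      · exact Or.inr ⟨h1, fun h' => h2 (by simp [h, h'])⟩
      · exact Or.inl ⟨h1, h⟩
    · rintro g ⟨h1, h2⟩
      by_cases h : f g = 0
      · exact Or.inr ⟨h1, fun h' => h2 (by simp [h, h'])⟩
      · exact Or.inl ⟨h1, h⟩
    · simp only [CompactlySupportedContinuousMap.add_apply]
      have e₁ := finsum_mem_add_distrib' (s := {g | 𝒢.s g = x}) (hs x) (hs' x)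
      have e₂ := finsum_mem_add_distrib' (s := {g | 𝒢.r g = x}) (hr x) (hr' x)
      rw [e₁, e₂, hf, hf']
      ring
  neg_mem' := by
    rintro a ⟨f, hs, hr, hf⟩
    refine ⟨-f, by simpa using hs, by simpa using hr, fun x => ?_⟩
    simp only [CompactlySupportedContinuousMap.neg_apply, finsum_neg_distrib, hf]
    ring

/-- The zeroth homology group `H₀(𝒢) = C_c(𝒢⁽⁰⁾, ℤ) / Im ∂₁`. -/
def H0 : Type _ := C_c(X, ℤ) ⧸ 𝒢.boundaryRange

noncomputable instance : AddCommGroup 𝒢.H0 :=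
  inferInstanceAs (AddCommGroup (C_c(X, ℤ) ⧸ 𝒢.boundaryRange))

/-- The class `[f]` of `f` in `H₀(𝒢)`. -/
noncomputable def H0.mk : C_c(X, ℤ) →+ 𝒢.H0 := QuotientAddGroup.mk' 𝒢.boundaryRange

/-- The positive cone `H₀(𝒢)⁺ = {[f] | f ≥ 0}`. -/
def H0.positive : Set 𝒢.H0 := {h | ∃ f : C_c(X, ℤ), (∀ x, 0 ≤ f x) ∧ h = H0.mk 𝒢 f}

/-- `h` is the class `[1_U]` of the indicator function of the (compact open) set `U ⊆ 𝒢⁽⁰⁾`. -/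
def H0.IsIndicatorClass (U : Set X) (h : 𝒢.H0) : Prop :=
  ∃ f : C_c(X, ℤ), ⇑f = U.indicator 1 ∧ h = H0.mk 𝒢 f

end Homology

/-! ## Skew products and graded homology -/

section Graded

variable {X G : Type*} (𝒢 : ArrowGroupoid X G) {Γ : Type*} [AddCommGroup Γ]

/-- A cocycle `c` on a groupoid: a functor to the abelian group `Γ` (a category with one object). -/
def IsCocycle (c : G → Γ) : Prop := ∀ g h hgh, c (𝒢.comp g h hgh) = c g + c h

variable {𝒢} {c : G → Γ}

theorem IsCocycle.map_one (hc : 𝒢.IsCocycle c) (x : X) : c (𝒢.one x) = 0 := by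
  have h := hc (𝒢.one x) (𝒢.one x) (by rw [𝒢.s_one, 𝒢.r_one])
  have h2 : 𝒢.comp (𝒢.one x) (𝒢.one x) (by rw [𝒢.s_one, 𝒢.r_one]) = 𝒢.one x := by
    have := 𝒢.one_comp (𝒢.one x)
    simpa only [𝒢.r_one] using this
  rw [h2] at h
  simpa using h

theorem IsCocycle.map_inv (hc : 𝒢.IsCocycle c) (g : G) : c (𝒢.inv g) = - c g := by
  have h := hc g (𝒢.inv g) (𝒢.r_inv g).symm
  rw [𝒢.comp_inv, hc.map_one] at h
  exact (neg_eq_of_add_eq_zero_right h.symm).symm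

variable (𝒢)

/-- The skew product groupoid `𝒢 ×_c Γ`: its arrows are the pairs `(g, γ)`, with
`r(g, γ) = (r(g), γ)`, `s(g, γ) = (s(g), γ + c(g))` and `(g, γ)(h, γ + c(g)) = (gh, γ)`. -/
def skewProduct (hc : 𝒢.IsCocycle c) : ArrowGroupoid (X × Γ) (G × Γ) where
  r a := (𝒢.r a.1, a.2)
  s a := (𝒢.s a.1, a.2 + c a.1)
  one x := (𝒢.one x.1, x.2)
  comp a b h := (𝒢.comp a.1 b.1 (congrArg Prod.fst h), a.2)
  inv a := (𝒢.inv a.1, a.2 + c a.1)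
  r_one x := by simp [𝒢.r_one]
  s_one x := by simp [𝒢.s_one, hc.map_one]
  r_comp a b h := by simp [𝒢.r_comp]
  s_comp a b h := by
    have h2 : a.2 + c a.1 = b.2 := congrArg Prod.snd h
    simp [𝒢.s_comp, hc _ _ _, ← h2, add_assoc]
  one_comp a := by simp [𝒢.one_comp]
  comp_one a := by simp [𝒢.comp_one]
  assoc a b d h₁ h₂ :=
    Prod.ext (𝒢.assoc _ _ _ (congrArg Prod.fst h₁) (congrArg Prod.fst h₂)) rfl
  r_inv g := by simp [𝒢.r_inv]
  s_inv g := by simp [𝒢.s_inv, hc.map_inv]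
  comp_inv g := by simp [𝒢.comp_inv]
  inv_comp g := by simp [𝒢.inv_comp]

variable [TopologicalSpace X] [TopologicalSpace G] [TopologicalSpace Γ] [DiscreteTopology Γ]

/-- The translate `γ • f = f ∘ φ_{-γ}` of a function on the unit space of the skew product, where
`φ_γ (x, β) = (x, γ + β)`. -/
def translate {Y : Type*} [TopologicalSpace Y] (γ : Γ) (f : C_c(Y × Γ, ℤ)) : C_c(Y × Γ, ℤ) where
  toFun y := f (y.1, -γ + y.2)
  continuous_toFun := f.continuous.comp
    (continuous_fst.prodMk ((continuous_of_discreteTopology (f := fun β : Γ => -γ + β)).comp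
      continuous_snd))
  hasCompactSupport' :=
    f.hasCompactSupport.comp_homeomorph
      ((Homeomorph.refl Y).prodCongr
        { toEquiv := Equiv.addLeft (-γ)
          continuous_toFun := continuous_of_discreteTopology
          continuous_invFun := continuous_of_discreteTopology })

theorem translate_apply {Y : Type*} [TopologicalSpace Y] (γ : Γ) (f : C_c(Y × Γ, ℤ)) (y : Y × Γ) :
    translate γ f y = f (y.1, -γ + y.2) := rfl

/-- Translation as a group homomorphism. -/
def translateHom {Y : Type*} [TopologicalSpace Y] (γ : Γ) : C_c(Y × Γ, ℤ) →+ C_c(Y × Γ, ℤ) where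
  toFun := translate γ
  map_zero' := rfl
  map_add' _ _ := rfl

theorem translate_mem (hc : 𝒢.IsCocycle c) (γ : Γ) {f : C_c(X × Γ, ℤ)}
    (hf : f ∈ (𝒢.skewProduct hc).boundaryRange) :
    translate γ f ∈ (𝒢.skewProduct hc).boundaryRange := by
  obtain ⟨a, hs, hr, hf⟩ := hf
  have inj : Function.Injective fun g : G × Γ => (g.1, -γ + g.2) := fun g h hgh => by
    simp only [Prod.mk.injEq, add_right_inj] at hgh
    exact Prod.ext hgh.1 hgh.2
  have surj : Function.Surjective fun g : G × Γ => (g.1, -γ + g.2) :=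
    fun g => ⟨(g.1, γ + g.2), by simp⟩
  have key_s : ∀ (x : X × Γ) (g : G × Γ), (𝒢.skewProduct hc).s g = x ↔
      (𝒢.skewProduct hc).s (g.1, -γ + g.2) = (x.1, -γ + x.2) := fun x g => by
    simp [skewProduct, Prod.ext_iff, add_assoc]
  have key_r : ∀ (x : X × Γ) (g : G × Γ), (𝒢.skewProduct hc).r g = x ↔
      (𝒢.skewProduct hc).r (g.1, -γ + g.2) = (x.1, -γ + x.2) := fun x g => by
    simp [skewProduct, Prod.ext_iff]
  have bij : ∀ A B : Set (G × Γ), (∀ g : G × Γ, g ∈ A ↔ (g.1, -γ + g.2) ∈ B) →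
      Set.BijOn (fun g : G × Γ => (g.1, -γ + g.2)) A B := fun A B h =>
    ⟨fun g hg => (h g).1 hg, inj.injOn, fun b hb => by
      obtain ⟨g, rfl⟩ := surj b
      exact ⟨g, (h g).2 hb, rfl⟩⟩
  refine ⟨translate γ a, fun x => ?_, fun x => ?_, fun x => ?_⟩
  · refine ((hs (x.1, -γ + x.2)).preimage inj.injOn).subset ?_
    rintro g ⟨h1, h2⟩
    exact ⟨(key_s x g).1 h1, h2⟩
  · refine ((hr (x.1, -γ + x.2)).preimage inj.injOn).subset ?_
    rintro g ⟨h1, h2⟩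
    exact ⟨(key_r x g).1 h1, h2⟩
  · have e₁ := finsum_mem_eq_of_bijOn (f := translate γ a) (g := a) _
      (bij {g | (𝒢.skewProduct hc).s g = x}
        {g | (𝒢.skewProduct hc).s g = (x.1, -γ + x.2)} (key_s x)) fun g _ => rfl
    have e₂ := finsum_mem_eq_of_bijOn (f := translate γ a) (g := a) _
      (bij {g | (𝒢.skewProduct hc).r g = x}
        {g | (𝒢.skewProduct hc).r g = (x.1, -γ + x.2)} (key_r x)) fun g _ => rfl
    rw [translate_apply, hf, e₁, e₂]

/-- The zeroth graded homology group `H₀^gr(𝒢) = H₀(𝒢 ×_c Γ)` of a groupoid that is graded by the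
cocycle `c`. -/
abbrev GradedH0 (hc : 𝒢.IsCocycle c) : Type _ := (𝒢.skewProduct hc).H0

/-- The action of `γ ∈ Γ` on `H₀^gr(𝒢)`: `γ • [f] = [f ∘ φ_{-γ}]`. -/
noncomputable def GradedH0.shift (hc : 𝒢.IsCocycle c) (γ : Γ) : 𝒢.GradedH0 hc →+ 𝒢.GradedH0 hc :=
  QuotientAddGroup.map _ _ (translateHom γ) fun _ hf => translate_mem 𝒢 hc γ hf

theorem GradedH0.shift_mk (hc : 𝒢.IsCocycle c) (γ : Γ) (f : C_c(X × Γ, ℤ)) :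
    GradedH0.shift 𝒢 hc γ (H0.mk _ f) = H0.mk _ (translate γ f) := rfl

/-- The action of `Γ` on `H₀^gr(𝒢)` as a representation by `ℤ`-linear maps. -/
noncomputable def GradedH0.rep (hc : 𝒢.IsCocycle c) :
    Multiplicative Γ →* Module.End ℤ (𝒢.GradedH0 hc) where
  toFun γ := (GradedH0.shift 𝒢 hc γ.toAdd).toIntLinearMap
  map_one' := by
    ext h
    obtain ⟨f, rfl⟩ := QuotientAddGroup.mk_surjective h
    refine congrArg (H0.mk _) (CompactlySupportedContinuousMap.ext fun x => ?_)
    show f (x.1, -0 + x.2) = f x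
    simp
  map_mul' a b := by
    ext h
    obtain ⟨f, rfl⟩ := QuotientAddGroup.mk_surjective h
    refine congrArg (H0.mk _) (CompactlySupportedContinuousMap.ext fun x => ?_)
    show f (x.1, -(a.toAdd + b.toAdd) + x.2) = f (x.1, -b.toAdd + (-a.toAdd + x.2))
    rw [neg_add_rev, add_assoc]

/-- The `ℤ[Γ]`-module structure of `H₀^gr(𝒢)`. -/
noncomputable instance GradedH0.instModule (hc : 𝒢.IsCocycle c) :
    Module (AddMonoidAlgebra ℤ Γ) (𝒢.GradedH0 hc) :=
  Module.compHom _ (AddMonoidAlgebra.lift ℤ (Module.End ℤ (𝒢.GradedH0 hc)) Γ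
    (GradedH0.rep 𝒢 hc)).toRingHom

theorem GradedH0.single_smul (hc : 𝒢.IsCocycle c) (γ : Γ) (h : 𝒢.GradedH0 hc) :
    AddMonoidAlgebra.single γ (1 : ℤ) • h = GradedH0.shift 𝒢 hc γ h := by
  show (AddMonoidAlgebra.lift ℤ (Module.End ℤ (𝒢.GradedH0 hc)) Γ
    (GradedH0.rep 𝒢 hc)) (AddMonoidAlgebra.single γ (1 : ℤ)) h = _
  rw [AddMonoidAlgebra.lift_single, one_smul]
  rfl

end Graded

end ArrowGroupoid

/-! ## The infinite path groupoid -/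

namespace KGraph

variable {k : ℕ} {V P : Type*} (Λ : KGraph k V P)

/-- An infinite path of `Λ`: a degree preserving functor to `Λ` from the category `Ω_k` whose
objects are the `m ∈ ℕ^k` and whose morphisms are the pairs `(m, n)` with `m ≤ n`, where
`r(m, n) = m`, `s(m, n) = n`, `(m, n)(n, p) = (m, p)` and `d(m, n) = n - m`. -/
@[ext]
structure InfPath where
  vert : (Fin k → ℕ) → V
  seg : (m n : Fin k → ℕ) → m ≤ n → P
  r_seg : ∀ m n h, Λ.r (seg m n h) = vert m
  s_seg : ∀ m n h, Λ.s (seg m n h) = vert n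
  seg_self : ∀ m, seg m m le_rfl = Λ.one (vert m)
  seg_comp : ∀ m n p (h₁ : m ≤ n) (h₂ : n ≤ p),
    Λ.comp (seg m n h₁) (seg n p h₂) ((s_seg m n h₁).trans (r_seg n p h₂).symm)
      = seg m p (h₁.trans h₂)
  d_seg : ∀ m n h, Λ.d (seg m n h) = n - m

variable {Λ}

/-- The shifted infinite path `σ^p(x)(m, n) = x(m + p, n + p)`. -/
def InfPath.shift (p : Fin k → ℕ) (x : Λ.InfPath) : Λ.InfPath where
  vert m := x.vert (m + p)
  seg m n h := x.seg (m + p) (n + p) (add_le_add_left h p)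
  r_seg _ _ _ := x.r_seg _ _ _
  s_seg _ _ _ := x.s_seg _ _ _
  seg_self _ := x.seg_self _
  seg_comp _ _ _ _ _ := x.seg_comp _ _ _ _ _
  d_seg m n h := by rw [x.d_seg, add_tsub_add_eq_tsub_right]

theorem InfPath.shift_zero (x : Λ.InfPath) : x.shift 0 = x := rfl

theorem InfPath.shift_shift (p q : Fin k → ℕ) (x : Λ.InfPath) :
    (x.shift p).shift q = x.shift (q + p) := by
  ext <;> simp [InfPath.shift, add_assoc]

variable (Λ)

/-- The cylinder set `Z(l) = {lz | z ∈ s(l)Λ^∞}`, i.e. the set of `x` with `x(0, d(l)) = l`. -/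
def cylinder (l : P) : Set Λ.InfPath := {x | x.seg 0 (Λ.d l) zero_le = l}

/-- The topology of `Λ^∞` is generated by the cylinder sets. -/
instance : TopologicalSpace Λ.InfPath := TopologicalSpace.generateFrom (Set.range Λ.cylinder)

/-- The arrows `(x, p - q, y)` of the infinite path groupoid, where `σ^p(x) = σ^q(y)`. -/
@[ext]
structure PathArrow where
  fst : Λ.InfPath
  deg : Fin k → ℤ
  snd : Λ.InfPath
  exists_shift : ∃ p q : Fin k → ℕ, (deg = fun i => (p i : ℤ) - (q i : ℤ)) ∧
    fst.shift p = snd.shift q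

/-- The basic sets `Z(l, m) = {(lz, d(l) - d(m), mz) | z ∈ s(l)Λ^∞}`, for `s(l) = s(m)`. Here
`x = lz` means that `x(0, d(l)) = l` and `σ^{d(l)}(x) = z`. -/
def basicSet (l m : P) : Set Λ.PathArrow :=
  {g | g.fst ∈ Λ.cylinder l ∧ g.snd ∈ Λ.cylinder m ∧
    (g.deg = fun i => (Λ.d l i : ℤ) - (Λ.d m i : ℤ)) ∧
    g.fst.shift (Λ.d l) = g.snd.shift (Λ.d m)}

/-- The topology of the infinite path groupoid has the sets `Z(l, m)` as a basis. -/
instance : TopologicalSpace Λ.PathArrow :=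
  TopologicalSpace.generateFrom {U | ∃ l m, Λ.s l = Λ.s m ∧ U = Λ.basicSet l m}

/-- The infinite path groupoid `𝒢_Λ` with unit space `Λ^∞`, where `r(x, n, y) = x`,
`s(x, n, y) = y` and `(x, n, y)(y, m, z) = (x, n + m, z)`. -/
def pathGroupoid : ArrowGroupoid Λ.InfPath Λ.PathArrow where
  r g := g.fst
  s g := g.snd
  one x := ⟨x, 0, x, 0, 0, by ext; simp, rfl⟩
  comp g h hgh := ⟨g.fst, g.deg + h.deg, h.snd, by
    obtain ⟨x, n, y, p, q, rfl, h₁⟩ := g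
    obtain ⟨y', m, z, p', q', rfl, h₂⟩ := h
    obtain rfl : y = y' := hgh
    refine ⟨p' + p, q + q', ?_, ?_⟩
    · ext i
      simp only [Pi.add_apply, Nat.cast_add]
      ring
    · show x.shift (p' + p) = z.shift (q + q')
      rw [← InfPath.shift_shift, h₁, InfPath.shift_shift, add_comm p', ← InfPath.shift_shift]
      exact (congrArg (InfPath.shift q) h₂).trans (InfPath.shift_shift _ _ _)⟩
  inv g := ⟨g.snd, -g.deg, g.fst, by
    obtain ⟨x, n, y, p, q, rfl, h⟩ := g
    exact ⟨q, p, by ext i; simp, h.symm⟩⟩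
  r_one _ := rfl
  s_one _ := rfl
  r_comp _ _ _ := rfl
  s_comp _ _ _ := rfl
  one_comp g := by ext <;> simp
  comp_one g := by ext <;> simp
  assoc a b c _ _ := by ext <;> simp [add_assoc]
  r_inv _ := rfl
  s_inv _ := rfl
  comp_inv g := by ext <;> simp
  inv_comp g := by ext <;> simp

/-- The map `(x, n, y) ↦ n` is a cocycle. -/
theorem isCocycle_deg : Λ.pathGroupoid.IsCocycle PathArrow.deg := fun _ _ _ => rfl

/-- The graded homology group `H₀^gr(𝒢_Λ)`, a module over `ℤ[ℤ^k]`. Its elements are classes of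
functions on `Λ^∞ × ℤ^k`. -/
abbrev GrH0 : Type _ := Λ.pathGroupoid.GradedH0 Λ.isCocycle_deg

/-- The positive cone `H₀^gr(𝒢_Λ)⁺`. -/
def grPositive : Set Λ.GrH0 := ArrowGroupoid.H0.positive _

/-- `h` is the class `[1_{A × {n}}]` in `H₀^gr(𝒢_Λ)`. -/
def IsGrClass (A : Set Λ.InfPath) (n : Fin k → ℤ) (h : Λ.GrH0) : Prop :=
  ArrowGroupoid.H0.IsIndicatorClass _ (A ×ˢ {n}) h

end KGraph

/-! ## The equivalent conditions -/

section Conditions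

variable {k : ℕ} {V P W Q : Type*} (Λ : KGraph k V P) (Ω : KGraph k W Q)

/-- There are nonnegative integer matrices `R`, `S` and `p ∈ ℕ^k` with `A_p = RS`, `B_p = SR`,
`A_{eᵢ} R = R B_{eᵢ}` and `B_{eᵢ} S = S A_{eᵢ}` for all `i`. -/
def MatrixCondition [Fintype V] [Fintype W] : Prop :=
  ∃ (R : Matrix V W ℕ) (S : Matrix W V ℕ) (p : Fin k → ℕ),
    Λ.vertexMatrix p = R * S ∧ Ω.vertexMatrix p = S * R ∧
    ∀ i : Fin k, Λ.vertexMatrix (Pi.single i 1) * R = R * Ω.vertexMatrix (Pi.single i 1) ∧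
      Ω.vertexMatrix (Pi.single i 1) * S = S * Λ.vertexMatrix (Pi.single i 1)

variable {Λ Ω} in
/-- `φ : H_Λ → H_Ω` maps the positive cone onto the positive cone and intertwines the shifts. -/
def IsDimIso [Fintype V] [Fintype W] (φ : Λ.DimensionGroup ≃+ Ω.DimensionGroup) : Prop :=
  φ '' Λ.dimPositive = Ω.dimPositive ∧ ∀ i h, φ (Λ.dimShift i h) = Ω.dimShift i (φ h)

/-- The talented monoids are isomorphic as `ℤ^k`-monoids. -/
def TalentedIso : Prop :=
  ∃ e : Λ.TalentedMonoid ≃+ Ω.TalentedMonoid,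
    ∀ q t, e (Λ.talentedShift q t) = Ω.talentedShift q (e t)

variable {Λ Ω} in
/-- `ψ : H₀^gr(𝒢_Λ) → H₀^gr(𝒢_Ω)` maps the positive cone onto the positive cone. -/
def IsOrderedIso (ψ : Λ.GrH0 ≃ₗ[AddMonoidAlgebra ℤ (Fin k → ℤ)] Ω.GrH0) : Prop :=
  ψ '' Λ.grPositive = Ω.grPositive

variable {Λ Ω} in
/-- `ψ` maps the class `[1_{Λ^∞ × {0}}]` to the class `[1_{Ω^∞ × {0}}]`. -/
def MatchesUnitClass (ψ : Λ.GrH0 ≃ₗ[AddMonoidAlgebra ℤ (Fin k → ℤ)] Ω.GrH0) : Prop :=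
  ∃ a b, Λ.IsGrClass Set.univ 0 a ∧ Ω.IsGrClass Set.univ 0 b ∧ ψ a = b

end Conditions

namespace KGraph

variable {k : ℕ} {V P : Type*} (Λ : KGraph k V P)

/-! ## Factorizations and prefixes -/

/-! Everything is compared with condition (ii). Both dimension groups are direct limits of finitely
generated free groups along nonnegative matrices, so every statement about classes becomes a
statement about integer vectors after multiplying by some `A_q` with `q` large enough.

(i) and (ii): `R` induces `[x, n] ↦ [xR, n]`, and `S` induces the inverse `[y, n] ↦ [yS, n + p]`,
because `RS = A_p` and multiplication by `A_p` is undone by moving `p` positions. Conversely, an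
order isomorphism sends the finitely many basis classes to positive classes, which are nonnegative
vectors at one common position. These are the rows of `R`, and the inverse gives `S`
(`IsDimIso.exists_matrix`). The required matrix identities hold at first only in the limit. They
become exact once powers of the vertex matrices are absorbed into `R` and `S`
(`IsDimIso.exists_matrix_comm`, `matrixCondition_of_isDimIso`).

(ii) and (iii): `v(n) ↦ [ε_v, n]` identifies the talented monoid with the positive cone. It is
injective because equality of two classes is already witnessed by an identity `xA_p = yA_p` of
natural vectors, which the defining relations of the monoid reproduce (`talentedToDim_injective`,
`range_talentedToDim`). The cone generates the group, so monoid isomorphisms extend.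

(ii) and (iv): `κ` is well defined because `Z(v)` is the disjoint union of the `Z(l)` with `l ∈
vΛ^p`, and `1_{Z(l) × {n}}` is homologous to `1_{Z(s(l)) × {n + d(l)}}` (`mk_level_cylInd`). Its
inverse integrates locally constant functions, `1_{Z(l) × {n}} ↦ [ε_{s(l)}, n + d(l)]`. The main
point is that boundaries integrate to zero: a function on the groupoid is cut into pieces supported
on basic sets `Z(l, m) × {n}`, and the two terms of the boundary of such a piece have the same
integral (`dimIntegral_push`, `dimIntegralSkew_boundary`). As `κ` respects translations, cones and
units, conjugation by it gives the one-to-one correspondence. -/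

variable {Λ} in
theorem comp_inj {a b a' b' : P} {h : Λ.s a = Λ.r b} {h' : Λ.s a' = Λ.r b'}
    (e : Λ.comp a b h = Λ.comp a' b' h') (hd : Λ.d a = Λ.d a') : a = a' ∧ b = b' := by
  have hdd := congrArg Λ.d e
  rw [Λ.d_comp, Λ.d_comp, hd] at hdd
  have hb : Λ.d b = Λ.d b' := add_left_cancel hdd
  obtain ⟨c, -, hc⟩ := Λ.factorization (Λ.comp a b h) (Λ.d a) (Λ.d b) (Λ.d_comp _ _ _)
  have h1 := hc (a, b) ⟨rfl, rfl, h, rfl⟩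
  have h2 := hc (a', b') ⟨hd.symm, hb.symm, h', e.symm⟩
  exact Prod.ext_iff.1 (h1.trans h2.symm)

theorem exists_comp (l : P) {n m : Fin k → ℕ} (hd : Λ.d l = n + m) :
    ∃ a b h, Λ.comp a b h = l ∧ Λ.d a = n ∧ Λ.d b = m := by
  obtain ⟨⟨a, b⟩, ⟨h1, h2, h, e⟩, -⟩ := Λ.factorization l n m hd
  exact ⟨a, b, h, e, h1, h2⟩

/-- Padding `l` with an identity on the right or on the left gives two factorizations of the same
degrees `0 + 0`, so their first factors agree. -/
theorem eq_one_of_d {l : P} (h : Λ.d l = 0) : l = Λ.one (Λ.r l) := by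
  have e : Λ.comp l (Λ.one (Λ.s l)) (Λ.r_one _).symm
      = Λ.comp (Λ.one (Λ.r l)) l (Λ.s_one _) := by rw [Λ.comp_one, Λ.one_comp]
  exact (comp_inj e (by rw [h, Λ.d_one])).1

theorem s_eq_r_of_d {l : P} (h : Λ.d l = 0) : Λ.s l = Λ.r l := by
  conv_lhs => rw [Λ.eq_one_of_d h]
  exact Λ.s_one _

/-- `a` is an initial segment of `l`. -/
def IsPrefix (a l : P) : Prop := ∃ b h, Λ.comp a b h = l

variable {Λ}

theorem IsPrefix.refl (a : P) : Λ.IsPrefix a a := ⟨_, _, Λ.comp_one a⟩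

theorem IsPrefix.comp (a b : P) (h : Λ.s a = Λ.r b) : Λ.IsPrefix a (Λ.comp a b h) := ⟨b, h, rfl⟩

theorem IsPrefix.trans {a b c : P} (h : Λ.IsPrefix a b) (h' : Λ.IsPrefix b c) :
    Λ.IsPrefix a c := by
  obtain ⟨x, hx, rfl⟩ := h
  obtain ⟨y, hy, rfl⟩ := h'
  rw [Λ.assoc a x y hx ((Λ.s_comp _ _ _).symm.trans hy)]
  exact IsPrefix.comp _ _ _

theorem IsPrefix.unique {a b l : P} (ha : Λ.IsPrefix a l) (hb : Λ.IsPrefix b l)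
    (h : Λ.d a = Λ.d b) : a = b := by
  obtain ⟨x, hx, rfl⟩ := ha
  obtain ⟨y, hy, e⟩ := hb
  exact (comp_inj e.symm h).1

theorem IsPrefix.r_eq {a l : P} (ha : Λ.IsPrefix a l) : Λ.r a = Λ.r l := by
  obtain ⟨x, hx, rfl⟩ := ha
  exact (Λ.r_comp _ _ _).symm

theorem exists_prefix {l : P} {n : Fin k → ℕ} (h : n ≤ Λ.d l) :
    ∃ a, Λ.IsPrefix a l ∧ Λ.d a = n := by
  obtain ⟨a, b, hab, e, h1, h2⟩ := Λ.exists_comp l (add_tsub_cancel_of_le h).symm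
  exact ⟨a, ⟨b, hab, e⟩, h1⟩

/-- The initial segment of `b` of degree `d(a)` is also one of `l`, so it is `a` by unique
factorization. -/
theorem IsPrefix.of_le {a b l : P} (ha : Λ.IsPrefix a l) (hb : Λ.IsPrefix b l)
    (h : Λ.d a ≤ Λ.d b) : Λ.IsPrefix a b := by
  obtain ⟨c, hc, hcd⟩ := exists_prefix h
  rwa [(ha.unique (hc.trans hb) hcd.symm : a = c)]

theorem IsPrefix.comp_left {a b : P} (l : P) (h : Λ.IsPrefix a b) (hl : Λ.s l = Λ.r a)
    (hl' : Λ.s l = Λ.r b) : Λ.IsPrefix (Λ.comp l a hl) (Λ.comp l b hl') := by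
  obtain ⟨x, hx, rfl⟩ := h
  rw [← Λ.assoc l a x hl hx]
  exact IsPrefix.comp _ _ _

variable (Λ)

/-! ## Sums over paths -/

/-- The product of paths, extended by an arbitrary value to pairs that are not composable. -/
noncomputable def mul (a b : P) : P :=
  open Classical in if h : Λ.s a = Λ.r b then Λ.comp a b h else a

theorem mul_eq {a b : P} (h : Λ.s a = Λ.r b) : Λ.mul a b = Λ.comp a b h := dif_pos h

variable {Λ} (hΛ : Λ.RowFiniteNoSources)

/-- The finite set `vΛⁿ`. -/
noncomputable def RowFiniteNoSources.paths (v : V) (n : Fin k → ℕ) : Finset P :=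
  (hΛ v n).1.toFinset

include hΛ

theorem RowFiniteNoSources.mem_paths {v : V} {n : Fin k → ℕ} {l : P} :
    l ∈ hΛ.paths v n ↔ Λ.r l = v ∧ Λ.d l = n := Set.Finite.mem_toFinset _

/-- Unique factorization is a bijection from `vΛ^{n+m}` to composable pairs. The total product `mul`
lets the summand be written without a composability proof. -/
theorem sum_paths_add {M : Type*} [AddCommMonoid M] (v : V) (n m : Fin k → ℕ) (F : P → M) :
    ∑ l ∈ hΛ.paths v (n + m), F l
      = ∑ a ∈ hΛ.paths v n, ∑ b ∈ hΛ.paths (Λ.s a) m, F (Λ.mul a b) := by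
  rw [Finset.sum_sigma']
  symm
  refine Finset.sum_bij (fun x _ => Λ.mul x.1 x.2) ?_ ?_ ?_ fun _ _ => rfl
  · rintro ⟨a, b⟩ h
    simp only [Finset.mem_sigma, hΛ.mem_paths] at h ⊢
    obtain ⟨⟨h1, h2⟩, h3, h4⟩ := h
    rw [Λ.mul_eq h3.symm, Λ.r_comp, Λ.d_comp, h1, h2, h4]
    exact ⟨rfl, rfl⟩
  · rintro ⟨a, b⟩ h ⟨a', b'⟩ h' e
    simp only [Finset.mem_sigma, hΛ.mem_paths] at h h' e
    rw [Λ.mul_eq h.2.1.symm, Λ.mul_eq h'.2.1.symm] at e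
    obtain ⟨rfl, rfl⟩ := comp_inj e (h.1.2.trans h'.1.2.symm)
    rfl
  · intro l hl
    obtain ⟨h1, h2⟩ := (hΛ.mem_paths).1 hl
    obtain ⟨a, b, h, rfl, h3, h4⟩ := Λ.exists_comp l h2
    refine ⟨⟨a, b⟩, ?_, Λ.mul_eq h⟩
    simp only [Finset.mem_sigma, hΛ.mem_paths]
    exact ⟨⟨(Λ.r_comp _ _ _).symm.trans h1, h3⟩, h.symm, h4⟩

theorem vertexMatrix_apply [DecidableEq V] (n : Fin k → ℕ) (u v : V) :
    Λ.vertexMatrix n u v = ((hΛ.paths u n).filter fun l => Λ.s l = v).card := by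
  rw [← Set.ncard_coe_finset]
  refine congrArg Set.ncard (Set.ext fun l => ?_)
  simp only [Finset.coe_filter, hΛ.mem_paths, Set.mem_ofPred_eq]
  tauto

theorem sum_paths_source [Fintype V] {M : Type*} [AddCommMonoid M] (v : V) (n : Fin k → ℕ)
    (F : V → M) :
    ∑ l ∈ hΛ.paths v n, F (Λ.s l) = ∑ w, Λ.vertexMatrix n v w • F w := by
  classical
  rw [← Finset.sum_fiberwise_of_maps_to (t := Finset.univ) (g := Λ.s) fun _ _ => Finset.mem_univ _]
  refine Finset.sum_congr rfl fun w _ => ?_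
  rw [vertexMatrix_apply hΛ, ← Finset.sum_const]
  exact Finset.sum_congr rfl fun l hl => by rw [(Finset.mem_filter.1 hl).2]

theorem vertexMatrix_add [Fintype V] (n m : Fin k → ℕ) :
    Λ.vertexMatrix (n + m) = Λ.vertexMatrix n * Λ.vertexMatrix m := by
  classical
  ext u w
  have h : ∀ (v : V) (n : Fin k → ℕ), Λ.vertexMatrix n v w
      = ∑ l ∈ hΛ.paths v n, if Λ.s l = w then 1 else 0 := fun v n => by
    rw [vertexMatrix_apply hΛ, Finset.card_filter]
  rw [h, sum_paths_add hΛ, Matrix.mul_apply]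
  have e : ∀ a ∈ hΛ.paths u n, (∑ b ∈ hΛ.paths (Λ.s a) m, if Λ.s (Λ.mul a b) = w then 1 else 0)
      = Λ.vertexMatrix m (Λ.s a) w := fun a _ => by
    rw [h]
    refine Finset.sum_congr rfl fun b hb => ?_
    rw [Λ.mul_eq ((hΛ.mem_paths).1 hb).1.symm, Λ.s_comp]
  rw [Finset.sum_congr rfl e, sum_paths_source hΛ u n fun v => Λ.vertexMatrix m v w]
  simp

theorem paths_zero (v : V) : hΛ.paths v 0 = {Λ.one v} := by
  ext l
  rw [hΛ.mem_paths, Finset.mem_singleton]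
  constructor
  · rintro ⟨rfl, h⟩
    exact Λ.eq_one_of_d h
  · rintro rfl
    exact ⟨Λ.r_one _, Λ.d_one _⟩

theorem vertexMatrix_zero [DecidableEq V] : Λ.vertexMatrix 0 = 1 := by
  ext u v
  rw [vertexMatrix_apply hΛ, paths_zero, Matrix.one_apply, Finset.filter_singleton, Λ.s_one]
  split_ifs <;> rfl

end KGraph

/-! ## Induction on vectors of integers -/

/-- The inclusion of `ℕ^k` into `ℤ^k`. -/
def natVec {k : ℕ} : (Fin k → ℕ) →+ (Fin k → ℤ) where
  toFun p i := p i
  map_zero' := rfl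
  map_add' p q := by ext; simp

theorem natVec_apply {k : ℕ} (p : Fin k → ℕ) (i : Fin k) : natVec p i = p i := rfl

theorem natVec_le {k : ℕ} {p q : Fin k → ℕ} : natVec p ≤ natVec q ↔ p ≤ q := by
  simp [Pi.le_def, natVec_apply]

theorem natVec_single {k : ℕ} (i : Fin k) : natVec (Pi.single i 1) = Pi.single i 1 := by
  ext j
  by_cases h : j = i
  · subst h; simp [natVec_apply]
  · simp [natVec_apply, Pi.single_eq_of_ne h]

theorem natVec_toNat_of_le {k : ℕ} {m n : Fin k → ℤ} (h : m ≤ n) :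
    natVec (fun i => (n i - m i).toNat) = n - m := by
  ext i
  simp [natVec_apply, h i]

theorem exists_le_natVec {k : ℕ} (n : Fin k → ℤ) : ∃ p : Fin k → ℕ, n ≤ natVec p :=
  ⟨fun i => (n i).toNat, fun i => Int.self_le_toNat (n i)⟩

theorem natVec_induction {k : ℕ} {C : (Fin k → ℕ) → Prop} (h0 : C 0)
    (hadd : ∀ p q, C p → C q → C (p + q)) (hs : ∀ i, C (Pi.single i 1)) (p : Fin k → ℕ) : C p := by
  have h : p = ∑ i, p i • Pi.single i 1 := by
    ext j
    simp [Finset.sum_apply, Pi.single_apply]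
  rw [h]
  refine Finset.sum_induction _ _ hadd h0 fun i _ => ?_
  induction p i with
  | zero => rwa [zero_smul]
  | succ n ih => rw [succ_nsmul]; exact hadd _ _ ih (hs i)

theorem intVec_induction {k : ℕ} {C : (Fin k → ℤ) → Prop} (h0 : C 0)
    (hadd : ∀ p q, C p → C q → C (p + q)) (hneg : ∀ p, C p → C (-p))
    (hs : ∀ i, C (Pi.single i 1)) (q : Fin k → ℤ) : C q := by
  have hnat : ∀ p, C (natVec p) := natVec_induction (by rwa [map_zero])
    (fun p q hp hq => by rw [map_add]; exact hadd _ _ hp hq) fun i => by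
      rw [natVec_single]; exact hs i
  obtain ⟨p, hp⟩ := exists_le_natVec q
  -- With `p ≥ q` natural, `q = p - (p - q)` is a difference of two natural vectors.
  have h := hadd _ _ (hnat p) (hneg _ (hnat fun i => (natVec p i - q i).toNat))
  rwa [natVec_toNat_of_le hp, ← sub_eq_add_neg, sub_sub_cancel] at h

/-! ### Matrices of natural numbers over the integers -/

/-- A matrix of natural numbers as a matrix of integers. -/
def Matrix.toInt {m n : Type*} (M : Matrix m n ℕ) : Matrix m n ℤ := M.map (↑)

theorem Matrix.toInt_mul {l m n : Type*} [Fintype m] (M : Matrix l m ℕ) (N : Matrix m n ℕ) :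
    (M * N).toInt = M.toInt * N.toInt := by
  ext i j
  simp [Matrix.mul_apply, Matrix.toInt]

theorem Matrix.toInt_injective {m n : Type*} :
    Function.Injective fun M : Matrix m n ℕ => M.toInt :=
  Matrix.map_injective Nat.cast_injective

theorem Matrix.vecMul_toInt_nonneg {m n : Type*} [Fintype m] (M : Matrix m n ℕ) {x : m → ℤ}
    (hx : 0 ≤ x) : 0 ≤ Matrix.vecMul x M.toInt := fun _ =>
  Finset.sum_nonneg fun w _ => mul_nonneg (hx w) (Int.natCast_nonneg _)

namespace KGraph

/-! ## The dimension group as a direct limit -/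

section DimensionGroup

variable {k : ℕ} {V P : Type*} [Fintype V] (Λ : KGraph k V P)

/-- The vertex matrix with integer entries. -/
noncomputable def intMatrix (n : Fin k → ℕ) : Matrix V V ℤ := (Λ.vertexMatrix n).toInt

theorem connectingMap_apply (m n : Fin k → ℤ) (h : m ≤ n) (x : V → ℤ) :
    Λ.connectingMap m n h x = Matrix.vecMul x (Λ.intMatrix fun i => (n i - m i).toNat) := rfl

theorem connectingMap_add (m : Fin k → ℤ) (p : Fin k → ℕ) (h : m ≤ m + natVec p) (x : V → ℤ) :
    Λ.connectingMap m (m + natVec p) h x = Matrix.vecMul x (Λ.intMatrix p) := by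
  rw [connectingMap_apply]
  congr
  simp [natVec_apply]

theorem le_add_natVec (m : Fin k → ℤ) (p : Fin k → ℕ) : m ≤ m + natVec p := fun i => by
  simp [natVec_apply]

theorem dimClass_vecMul (n : Fin k → ℤ) (p : Fin k → ℕ) (x : V → ℤ) :
    Λ.dimClass (n + natVec p) (Matrix.vecMul x (Λ.intMatrix p)) = Λ.dimClass n x := by
  rw [← Λ.connectingMap_add n p (le_add_natVec n p)]
  exact AddCommGroup.DirectLimit.of_f _ _

theorem exists_dimClass (h : Λ.DimensionGroup) : ∃ n x, h = Λ.dimClass n x :=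
  AddCommGroup.DirectLimit.induction_on (C := fun h => ∃ n x, h = Λ.dimClass n x) h
    fun n x => ⟨n, x, rfl⟩

theorem dimHom_ext {M : Type*} [AddCommMonoid M] {f g : Λ.DimensionGroup →+ M}
    (h : ∀ n x, f (Λ.dimClass n x) = g (Λ.dimClass n x)) : f = g := by
  ext a
  obtain ⟨n, x, rfl⟩ := Λ.exists_dimClass a
  exact h n x

theorem intMatrix_nonneg (n : Fin k → ℕ) {x : V → ℤ} (hx : 0 ≤ x) :
    0 ≤ Matrix.vecMul x (Λ.intMatrix n) := Matrix.vecMul_toInt_nonneg _ hx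

variable {Λ} (hΛ : Λ.RowFiniteNoSources)
include hΛ

theorem intMatrix_add (n m : Fin k → ℕ) :
    Λ.intMatrix (n + m) = Λ.intMatrix n * Λ.intMatrix m := by
  rw [intMatrix, vertexMatrix_add hΛ, Matrix.toInt_mul]
  rfl

omit [Fintype V] in
theorem intMatrix_zero [DecidableEq V] : Λ.intMatrix 0 = 1 := by
  rw [intMatrix, vertexMatrix_zero hΛ]
  ext i j
  by_cases h : i = j <;> simp [h, Matrix.toInt, Matrix.one_apply]

/-- Functoriality of the connecting maps, which the exactness property of direct limits in
`dimClass_eq_iff` requires. -/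
theorem directedSystem_connectingMap :
    DirectedSystem (fun _ : Fin k → ℤ => V → ℤ) fun i j h => Λ.connectingMap i j h where
  map_self n x := by
    classical
    have h : (fun i => (n i - n i).toNat) = 0 := by ext; simp
    rw [connectingMap_apply, h, intMatrix_zero hΛ, Matrix.vecMul_one]
  map_map k j i hij hjk x := by
    rw [connectingMap_apply, connectingMap_apply, connectingMap_apply, Matrix.vecMul_vecMul,
      ← intMatrix_add hΛ]
    congr
    ext l
    have h1 : i l ≤ j l := hij l
    have h2 : j l ≤ k l := hjk l
    show (j l - i l).toNat + (k l - j l).toNat = (k l - i l).toNat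
    omega

theorem dimClass_eq_iff (n : Fin k → ℤ) (x y : V → ℤ) :
    Λ.dimClass n x = Λ.dimClass n y ↔
      ∃ p, Matrix.vecMul x (Λ.intMatrix p) = Matrix.vecMul y (Λ.intMatrix p) := by
  constructor
  · intro h
    have := directedSystem_connectingMap hΛ
    obtain ⟨m, hm, e⟩ := AddCommGroup.DirectLimit.of.zero_exact (f := Λ.connectingMap) n (x - y)
      (by rw [map_sub]; exact sub_eq_zero.2 h)
    rw [map_sub, sub_eq_zero] at e
    exact ⟨_, e⟩
  · rintro ⟨p, h⟩
    rw [← Λ.dimClass_vecMul n p x, h, dimClass_vecMul]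

theorem vecMul_intMatrix_eq_of_le {x y : V → ℤ} {p q : Fin k → ℕ} (hpq : p ≤ q)
    (h : Matrix.vecMul x (Λ.intMatrix p) = Matrix.vecMul y (Λ.intMatrix p)) :
    Matrix.vecMul x (Λ.intMatrix q) = Matrix.vecMul y (Λ.intMatrix q) := by
  rw [← add_tsub_cancel_of_le hpq, intMatrix_add hΛ, ← Matrix.vecMul_vecMul, h,
    Matrix.vecMul_vecMul]

/-- Each row needs its own exponent. There are finitely many rows, and an equality persists for
larger exponents, so the sum of the exponents serves all rows. -/
theorem exists_mul_intMatrix_eq {U : Type*} [Fintype U] {n : Fin k → ℤ} {M M' : Matrix U V ℤ}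
    (h : ∀ u, Λ.dimClass n (M u) = Λ.dimClass n (M' u)) :
    ∃ p, ∀ q, p ≤ q → M * Λ.intMatrix q = M' * Λ.intMatrix q := by
  choose p hp using fun u => (dimClass_eq_iff hΛ n _ _).1 (h u)
  refine ⟨∑ u, p u, fun q hq => Matrix.ext fun u => congrFun ?_⟩
  exact vecMul_intMatrix_eq_of_le hΛ
    ((Finset.single_le_sum (fun _ _ => zero_le) (Finset.mem_univ u)).trans hq) (hp u)

end DimensionGroup

/-! ### Homomorphisms and translations of dimension groups -/

section Maps

variable {k : ℕ} {V P W Q : Type*} [Fintype V] [Fintype W] {Λ : KGraph k V P} {Ω : KGraph k W Q}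

/-- The homomorphism `[x, n] ↦ [x R, n + q]` of dimension groups. -/
noncomputable def dimMap (R : Matrix V W ℤ) (q : Fin k → ℤ)
    (hR : ∀ p, Λ.intMatrix p * R = R * Ω.intMatrix p) : Λ.DimensionGroup →+ Ω.DimensionGroup :=
  AddCommGroup.DirectLimit.lift (fun _ : Fin k → ℤ => V → ℤ) Λ.connectingMap Ω.DimensionGroup
    (fun n => (Ω.dimClass (n + q)).comp R.vecMulLinear.toAddMonoidHom) (fun m n hmn x => by
      show Ω.dimClass (n + q) (Matrix.vecMul (Matrix.vecMul x _) R) =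
        Ω.dimClass (m + q) (Matrix.vecMul x R)
      have h := Ω.dimClass_vecMul (m + q) (fun i => (n i - m i).toNat) (Matrix.vecMul x R)
      rw [natVec_toNat_of_le hmn, show m + q + (n - m) = n + q by abel] at h
      rw [← h, Matrix.vecMul_vecMul, Matrix.vecMul_vecMul, ← hR]
      rfl)

theorem dimMap_dimClass (R : Matrix V W ℤ) (q : Fin k → ℤ)
    (hR : ∀ p, Λ.intMatrix p * R = R * Ω.intMatrix p) (n : Fin k → ℤ) (x : V → ℤ) :
    dimMap R q hR (Λ.dimClass n x) = Ω.dimClass (n + q) (Matrix.vecMul x R) :=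
  AddCommGroup.DirectLimit.lift_of (f := Λ.connectingMap) _ _ _ _ _

variable (Λ) in
/-- The translation `[x, n] ↦ [x, n + q]` of the dimension group. -/
noncomputable def dimTranslate (q : Fin k → ℤ) : Λ.DimensionGroup →+ Λ.DimensionGroup :=
  letI := Classical.decEq V
  dimMap 1 q fun p => by rw [Matrix.mul_one, Matrix.one_mul]

theorem dimTranslate_dimClass (q n : Fin k → ℤ) (x : V → ℤ) :
    Λ.dimTranslate q (Λ.dimClass n x) = Λ.dimClass (n + q) x := by
  let := Classical.decEq V
  exact (dimMap_dimClass _ _ _ _ _).trans (by rw [Matrix.vecMul_one])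

theorem dimTranslate_zero (h : Λ.DimensionGroup) : Λ.dimTranslate 0 h = h := by
  obtain ⟨n, x, rfl⟩ := Λ.exists_dimClass h
  rw [dimTranslate_dimClass, add_zero]

theorem dimTranslate_add (p q : Fin k → ℤ) (h : Λ.DimensionGroup) :
    Λ.dimTranslate (p + q) h = Λ.dimTranslate p (Λ.dimTranslate q h) := by
  obtain ⟨n, x, rfl⟩ := Λ.exists_dimClass h
  simp only [dimTranslate_dimClass]
  rw [add_assoc, add_comm p]

theorem dimShift_eq (i : Fin k) (h : Λ.DimensionGroup) :
    Λ.dimShift i h = Λ.dimTranslate (-Pi.single i 1) h := by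
  obtain ⟨n, x, rfl⟩ := Λ.exists_dimClass h
  rw [dimTranslate_dimClass, dimShift_dimClass, sub_eq_add_neg]

/-- `δᵢ` is translation by `-eᵢ`, and these vectors generate `ℤ^k`. Equivariance passes to sums
directly, and to negatives because `T (-q)` undoes `T q`. -/
theorem map_dimTranslate_of_map_dimShift {M : Type*} [AddCommGroup M]
    (T : (Fin k → ℤ) → M → M) (h0 : ∀ m, T 0 m = m) (hadd : ∀ p q m, T (p + q) m = T p (T q m))
    (f : Λ.DimensionGroup → M)
    (hf : ∀ i h, f (Λ.dimShift i h) = T (-Pi.single i 1) (f h)) (q : Fin k → ℤ)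
    (h : Λ.DimensionGroup) : f (Λ.dimTranslate q h) = T q (f h) := by
  have hneg : ∀ q, (∀ h, f (Λ.dimTranslate q h) = T q (f h)) →
      ∀ h, f (Λ.dimTranslate (-q) h) = T (-q) (f h) := fun q hq h => by
    have e := congrArg (T (-q)) (hq (Λ.dimTranslate (-q) h))
    rw [← hadd, neg_add_cancel, h0, ← dimTranslate_add, add_neg_cancel, dimTranslate_zero] at e
    exact e.symm
  revert h
  refine intVec_induction (C := fun q => ∀ h, f (Λ.dimTranslate q h) = T q (f h)) ?_ ?_ hneg ?_ q
  · intro h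
    rw [dimTranslate_zero, h0]
  · intro p q hp hq h
    rw [dimTranslate_add, hp, hq, hadd]
  · intro i
    have := hneg (-Pi.single i 1) fun h => by rw [← dimShift_eq, hf]
    rwa [neg_neg] at this

theorem _root_.IsDimIso.map_dimTranslate {φ : Λ.DimensionGroup ≃+ Ω.DimensionGroup} (hφ : IsDimIso φ)
    (q : Fin k → ℤ) (h : Λ.DimensionGroup) :
    φ (Λ.dimTranslate q h) = Ω.dimTranslate q (φ h) :=
  map_dimTranslate_of_map_dimShift (fun q => Ω.dimTranslate q) dimTranslate_zero dimTranslate_add φ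
    (fun i h => by rw [hφ.2, dimShift_eq]) q h

theorem _root_.IsDimIso.symm {φ : Λ.DimensionGroup ≃+ Ω.DimensionGroup} (hφ : IsDimIso φ) :
    IsDimIso φ.symm := by
  refine ⟨?_, fun i h => ?_⟩
  · rw [← hφ.1, ← Set.image_comp]
    simp
  · rw [AddEquiv.symm_apply_eq, hφ.2, AddEquiv.apply_symm_apply]

end Maps

/-! ## Order isomorphisms of dimension groups and shift equivalence -/

section ShiftEquivalence

variable {k : ℕ} {V P W Q : Type*} [Fintype V] [Fintype W] {Λ : KGraph k V P} {Ω : KGraph k W Q}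

theorem intMatrix_mul_comm_of_single (hΛ : Λ.RowFiniteNoSources) (hΩ : Ω.RowFiniteNoSources)
    {R : Matrix V W ℤ}
    (hR : ∀ i, Λ.intMatrix (Pi.single i 1) * R = R * Ω.intMatrix (Pi.single i 1))
    (p : Fin k → ℕ) : Λ.intMatrix p * R = R * Ω.intMatrix p := by
  classical
  refine natVec_induction (C := fun p => Λ.intMatrix p * R = R * Ω.intMatrix p) ?_ ?_ hR p
  · rw [intMatrix_zero hΛ, intMatrix_zero hΩ, Matrix.one_mul, Matrix.mul_one]
  · intro p q hp hq
    rw [intMatrix_add hΛ, intMatrix_add hΩ, Matrix.mul_assoc, hq, ← Matrix.mul_assoc, hp,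
      Matrix.mul_assoc]

theorem exists_dimIso_of_matrixCondition (hΛ : Λ.RowFiniteNoSources) (hΩ : Ω.RowFiniteNoSources)
    (h : MatrixCondition Λ Ω) : ∃ φ : Λ.DimensionGroup ≃+ Ω.DimensionGroup, IsDimIso φ := by
  obtain ⟨R, S, p, hA, hB, hRS⟩ := h
  have hR := intMatrix_mul_comm_of_single hΛ hΩ (R := R.toInt) fun i => by
    rw [intMatrix, intMatrix, ← Matrix.toInt_mul, (hRS i).1, Matrix.toInt_mul]
  have hS := intMatrix_mul_comm_of_single hΩ hΛ (R := S.toInt) fun i => by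
    rw [intMatrix, intMatrix, ← Matrix.toInt_mul, (hRS i).2, Matrix.toInt_mul]
  have hA' : R.toInt * S.toInt = Λ.intMatrix p := by
    rw [intMatrix, hA, Matrix.toInt_mul]
  have hB' : S.toInt * R.toInt = Ω.intMatrix p := by
    rw [intMatrix, hB, Matrix.toInt_mul]
  -- The shift by `p` in the inverse compensates for `RS = A_p` and `SR = B_p`, since `[xA_p, n + p]
  -- = [x, n]`.
  refine ⟨{ (dimMap (R.toInt) 0 hR) with
    invFun := dimMap (S.toInt) (natVec p) hS
    left_inv := fun h => ?_
    right_inv := fun h => ?_ }, ?_, ?_⟩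
  · obtain ⟨n, x, rfl⟩ := Λ.exists_dimClass h
    show dimMap _ _ hS (dimMap _ _ hR _) = _
    rw [dimMap_dimClass, dimMap_dimClass, Matrix.vecMul_vecMul, hA', add_zero, dimClass_vecMul]
  · obtain ⟨n, x, rfl⟩ := Ω.exists_dimClass h
    show dimMap _ _ hR (dimMap _ _ hS _) = _
    rw [dimMap_dimClass, dimMap_dimClass, Matrix.vecMul_vecMul, hB', add_zero, dimClass_vecMul]
  · ext h
    constructor
    · rintro ⟨_, ⟨n, x, hx, rfl⟩, rfl⟩
      exact ⟨_, _, R.vecMul_toInt_nonneg hx, dimMap_dimClass _ _ hR _ _⟩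
    · rintro ⟨n, x, hx, rfl⟩
      refine ⟨_, ⟨n + natVec p, _, S.vecMul_toInt_nonneg hx, rfl⟩, ?_⟩
      show dimMap _ _ hR _ = _
      rw [dimMap_dimClass, Matrix.vecMul_vecMul, hB', add_zero, dimClass_vecMul]
  · intro i h
    obtain ⟨n, x, rfl⟩ := Λ.exists_dimClass h
    show dimMap _ _ hR _ = Ω.dimShift i (dimMap _ _ hR _)
    rw [dimShift_dimClass, dimMap_dimClass, dimMap_dimClass, dimShift_dimClass, add_zero, add_zero]

/-- The connecting maps are nonnegative, so a positive class has a nonnegative representative at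
every later position. This allows finitely many positive classes to be put at one common position.
-/
theorem exists_natVec_dimClass_of_mem_dimPositive
    {h : Ω.DimensionGroup} (hh : h ∈ Ω.dimPositive) :
    ∃ N : Fin k → ℕ, ∀ M, N ≤ M → ∃ y : W → ℕ, h = Ω.dimClass (natVec M) fun w => y w := by
  obtain ⟨n, x, hx, rfl⟩ := hh
  obtain ⟨N, hN⟩ := exists_le_natVec n
  refine ⟨N, fun M hM => ?_⟩
  have hle := hN.trans (natVec_le.2 hM)
  have e := Ω.dimClass_vecMul n (fun i => (natVec M i - n i).toNat) x
  rw [natVec_toNat_of_le hle, add_sub_cancel] at e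
  refine ⟨fun w => (Matrix.vecMul x (Ω.intMatrix fun i => (natVec M i - n i).toNat) w).toNat, ?_⟩
  rw [← e]
  congr 1
  ext w
  exact (Int.toNat_of_nonneg (Ω.intMatrix_nonneg _ hx w)).symm

/-- Row `v` of `R` is a natural vector representing `φ[ε_v, 0]`, with all rows taken at the same
position `N`. Linearity gives position `0`, and equivariance gives the others. -/
theorem _root_.IsDimIso.exists_matrix {φ : Λ.DimensionGroup ≃+ Ω.DimensionGroup} (hφ : IsDimIso φ) :
    ∃ (N : Fin k → ℕ) (R : Matrix V W ℕ), ∀ n x, φ (Λ.dimClass n x) =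
      Ω.dimClass (n + natVec N) (Matrix.vecMul x (R.toInt)) := by
  classical
  have hpos : ∀ v, φ (Λ.dimClass 0 (Pi.single v 1)) ∈ Ω.dimPositive := fun v => by
    rw [← hφ.1]
    exact ⟨_, ⟨0, _, Pi.single_nonneg.2 zero_le_one, rfl⟩, rfl⟩
  choose N hN using fun v => exists_natVec_dimClass_of_mem_dimPositive (hpos v)
  choose R hR using fun v => hN v (∑ v, N v)
    (Finset.single_le_sum (fun _ _ => zero_le) (Finset.mem_univ v))
  refine ⟨∑ v, N v, R, fun n x => ?_⟩
  have h0 : φ (Λ.dimClass 0 x) =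
      Ω.dimClass (natVec (∑ v, N v)) (Matrix.vecMul x ((Matrix.toInt R))) := by
    have hx : x = ∑ v, x v • Pi.single v 1 := by
      ext w
      simp [Finset.sum_apply, Pi.single_apply]
    have hx' : Matrix.vecMul x ((Matrix.toInt R)) = ∑ v, x v • fun w => (R v w : ℤ) := by
      ext w
      simp [Matrix.vecMul, dotProduct, Finset.sum_apply, Matrix.toInt]
      rfl
    rw [hx']
    conv_lhs => rw [hx]
    simp only [map_sum, map_zsmul, hR]
  have h := hφ.map_dimTranslate n (Λ.dimClass 0 x)
  rw [dimTranslate_dimClass, zero_add, h0, dimTranslate_dimClass, add_comm] at h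
  exact h

/-- The matrix from `exists_matrix` commutes with the vertex matrices only after right
multiplication by some `B_q`. Replacing `R` by `RB_q` and `N` by `N + q` represents the same `φ` and
makes the relation exact, because the matrices `B` commute with each other. -/
theorem _root_.IsDimIso.exists_matrix_comm (hΩ : Ω.RowFiniteNoSources)
    {φ : Λ.DimensionGroup ≃+ Ω.DimensionGroup} (hφ : IsDimIso φ) :
    ∃ (N : Fin k → ℕ) (R : Matrix V W ℕ), (∀ n x, φ (Λ.dimClass n x) =
      Ω.dimClass (n + natVec N) (Matrix.vecMul x (R.toInt))) ∧
      ∀ i, Λ.vertexMatrix (Pi.single i 1) * R = R * Ω.vertexMatrix (Pi.single i 1) := by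
  classical
  obtain ⟨N, R, hR⟩ := hφ.exists_matrix
  have key : ∀ i, ∃ p, ∀ q, p ≤ q →
      Λ.intMatrix (Pi.single i 1) * R.toInt * Ω.intMatrix q =
        R.toInt * Ω.intMatrix (Pi.single i 1) * Ω.intMatrix q := fun i => by
    refine exists_mul_intMatrix_eq hΩ (n := natVec N) fun v => ?_
    have h := hφ.2 i (Λ.dimClass 0 (Pi.single v 1))
    rw [dimShift_dimClass', hR, hR, dimShift_dimClass', zero_add, Matrix.vecMul_vecMul,
      Matrix.vecMul_vecMul, Matrix.single_one_vecMul, Matrix.single_one_vecMul] at h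
    exact h
  choose p hp using key
  have hM : ∀ i, p i ≤ ∑ i, p i := fun i =>
    Finset.single_le_sum (fun _ _ => zero_le) (Finset.mem_univ i)
  refine ⟨N + ∑ i, p i, R * Ω.vertexMatrix (∑ i, p i), fun n x => ?_, fun i => ?_⟩
  · rw [hR, Matrix.toInt_mul, ← Matrix.vecMul_vecMul, map_add, ← add_assoc]
    exact (Ω.dimClass_vecMul _ _ _).symm
  · apply Matrix.toInt_injective
    have h := hp i _ (hM i)
    rw [intMatrix, intMatrix, intMatrix] at h
    simp only [← Matrix.toInt_mul] at h
    rw [Matrix.mul_assoc R, ← vertexMatrix_add hΩ, add_comm, vertexMatrix_add hΩ] at h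
    simpa only [Matrix.mul_assoc] using h

omit [Fintype W] in
-- `T` and `A_p` both represent the identity at position `p`, so their rows have equal classes and
-- agree at a later position.
theorem exists_vertexMatrix_mul_eq (hΛ : Λ.RowFiniteNoSources) (p : Fin k → ℕ) (T : Matrix V V ℕ)
    (h : ∀ x, Λ.dimClass 0 x = Λ.dimClass (natVec p) (Matrix.vecMul x T.toInt)) :
    ∃ r, ∀ q, r ≤ q → Λ.vertexMatrix p * Λ.vertexMatrix q = T * Λ.vertexMatrix q := by
  classical
  obtain ⟨r, hr⟩ := exists_mul_intMatrix_eq hΛ (n := natVec p) (M := Λ.intMatrix p)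
    (M' := T.toInt) fun u => by
      have h1 := h (Pi.single u 1)
      rw [← Λ.dimClass_vecMul 0 p, zero_add, Matrix.single_one_vecMul,
        Matrix.single_one_vecMul] at h1
      exact h1
  refine ⟨r, fun q hq => Matrix.toInt_injective ?_⟩
  have h2 := hr q hq
  simpa only [intMatrix, ← Matrix.toInt_mul] using h2

theorem matrixCondition_of_isDimIso (hΛ : Λ.RowFiniteNoSources) (hΩ : Ω.RowFiniteNoSources)
    {φ : Λ.DimensionGroup ≃+ Ω.DimensionGroup} (hφ : IsDimIso φ) : MatrixCondition Λ Ω := by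
  classical
  obtain ⟨N, R, hR, hRc⟩ := hφ.exists_matrix_comm hΩ
  obtain ⟨N', S, hS, hSc⟩ := hφ.symm.exists_matrix_comm hΛ
  obtain ⟨r, hr⟩ := exists_vertexMatrix_mul_eq hΛ (N + N') (R * S) fun x => by
    have h := hS (0 + natVec N) (Matrix.vecMul x (R.toInt))
    rw [← hR, AddEquiv.symm_apply_apply, Matrix.vecMul_vecMul, ← Matrix.toInt_mul, zero_add,
      ← map_add] at h
    exact h
  obtain ⟨r', hr'⟩ := exists_vertexMatrix_mul_eq hΩ (N + N') (S * R) fun x => by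
    have h := hR (0 + natVec N') (Matrix.vecMul x (S.toInt))
    rw [← hS, AddEquiv.apply_symm_apply, Matrix.vecMul_vecMul, ← Matrix.toInt_mul, zero_add,
      ← map_add, add_comm] at h
    exact h
  have hcomm : ∀ (p : Fin k → ℕ), Λ.vertexMatrix p * R = R * Ω.vertexMatrix p := fun p => by
    apply Matrix.toInt_injective
    have := intMatrix_mul_comm_of_single hΛ hΩ (R := R.toInt) (fun i => by
      rw [intMatrix, intMatrix, ← Matrix.toInt_mul, hRc, Matrix.toInt_mul]) p
    simpa only [intMatrix, ← Matrix.toInt_mul] using this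
  -- `RS` agrees with `A_{N+N'}`, and `SR` with `B_{N+N'}`, only after multiplication by a late
  -- vertex matrix. Absorbing `A_{r ⊔ r'}` into `S` makes both exact. For the second, `B_{r ⊔ r'}`
  -- is moved across `R` by `hcomm`.
  refine ⟨R, S * Λ.vertexMatrix (r ⊔ r'), N + N' + r ⊔ r', ?_, ?_, fun i => ⟨hRc i, ?_⟩⟩
  · rw [vertexMatrix_add hΛ, hr _ le_sup_left, Matrix.mul_assoc]
  · rw [vertexMatrix_add hΩ, hr' _ le_sup_right, Matrix.mul_assoc, Matrix.mul_assoc, hcomm]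
  · rw [← Matrix.mul_assoc, hSc, Matrix.mul_assoc, Matrix.mul_assoc, ← vertexMatrix_add hΛ,
      ← vertexMatrix_add hΛ, add_comm]

end ShiftEquivalence

end KGraph

namespace KGraph

/-! ## Homomorphisms out of the dimension group -/

section DimLift

variable {k : ℕ} {V P : Type*} [Fintype V] [DecidableEq V] {Λ : KGraph k V P}

theorem eq_sum_single (x : V → ℤ) : x = ∑ v, x v • Pi.single v 1 := by
  ext w
  simp [Finset.sum_apply, Pi.single_apply]

theorem dimClass_eq_sum (n : Fin k → ℤ) (x : V → ℤ) :
    Λ.dimClass n x = ∑ v, x v • Λ.dimClass n (Pi.single v 1) := by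
  conv_lhs => rw [eq_sum_single x]
  simp only [map_sum, map_zsmul]

theorem dimHom_ext_single {M : Type*} [AddCommGroup M] {f g : Λ.DimensionGroup →+ M}
    (h : ∀ v n, f (Λ.dimClass n (Pi.single v 1)) = g (Λ.dimClass n (Pi.single v 1))) : f = g := by
  refine Λ.dimHom_ext fun n x => ?_
  rw [dimClass_eq_sum]
  simp only [map_sum, map_zsmul, h]

/-- The homomorphism on the dimension group with given values on the classes `[ε_v, n]`. -/
noncomputable def dimLift {M : Type*} [AddCommGroup M] (F : V → (Fin k → ℤ) → M)
    (hF : ∀ v n p, F v n = ∑ w, Λ.vertexMatrix p v w • F w (n + natVec p)) :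
    Λ.DimensionGroup →+ M :=
  AddCommGroup.DirectLimit.lift (fun _ : Fin k → ℤ => V → ℤ) Λ.connectingMap M
    (fun n => (Fintype.linearCombination ℤ (F · n)).toAddMonoidHom) (fun m n hmn x => by
      show ∑ w, Matrix.vecMul x (Λ.intMatrix _) w • F w n = ∑ v, x v • F v m
      have e : ∀ v, F v m = ∑ w, Λ.vertexMatrix (fun i => (n i - m i).toNat) v w • F w n :=
        fun v => by rw [hF v m, natVec_toNat_of_le hmn, add_sub_cancel]
      simp only [e, Finset.smul_sum, Matrix.vecMul, dotProduct, Finset.sum_smul]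
      rw [Finset.sum_comm]
      refine Finset.sum_congr rfl fun v _ => Finset.sum_congr rfl fun w _ => ?_
      rw [mul_smul]
      congr 1
      exact natCast_zsmul _ _)

theorem dimLift_single {M : Type*} [AddCommGroup M] (F : V → (Fin k → ℤ) → M)
    (hF : ∀ v n p, F v n = ∑ w, Λ.vertexMatrix p v w • F w (n + natVec p))
    (v : V) (n : Fin k → ℤ) : dimLift F hF (Λ.dimClass n (Pi.single v 1)) = F v n := by
  refine (AddCommGroup.DirectLimit.lift_of (f := Λ.connectingMap) _ _ _ _ _).trans ?_
  show Fintype.linearCombination ℤ (F · n) (Pi.single v 1) = F v n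
  rw [Fintype.linearCombination_apply_single, one_smul]

theorem sum_vertexMatrix_smul_dimClass (v : V) (n : Fin k → ℤ) (p : Fin k → ℕ) :
    ∑ w, Λ.vertexMatrix p v w • Λ.dimClass (n + natVec p) (Pi.single w 1)
      = Λ.dimClass n (Pi.single v 1) := by
  rw [← Λ.dimClass_vecMul n p, dimClass_eq_sum, Matrix.single_one_vecMul]
  exact Finset.sum_congr rfl fun w _ => (natCast_zsmul _ _).symm

omit [DecidableEq V] in
theorem zero_mem_dimPositive : 0 ∈ Λ.dimPositive := ⟨0, 0, le_rfl, (map_zero _).symm⟩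

theorem single_mem_dimPositive (v : V) (n : Fin k → ℤ) :
    Λ.dimClass n (Pi.single v 1) ∈ Λ.dimPositive :=
  ⟨n, _, Pi.single_nonneg.2 zero_le_one, rfl⟩

omit [DecidableEq V] in
theorem add_mem_dimPositive {a b : Λ.DimensionGroup} (ha : a ∈ Λ.dimPositive)
    (hb : b ∈ Λ.dimPositive) : a + b ∈ Λ.dimPositive := by
  obtain ⟨N, hN⟩ := exists_natVec_dimClass_of_mem_dimPositive ha
  obtain ⟨N', hN'⟩ := exists_natVec_dimClass_of_mem_dimPositive hb
  obtain ⟨x, rfl⟩ := hN (N ⊔ N') le_sup_left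
  obtain ⟨y, rfl⟩ := hN' (N ⊔ N') le_sup_right
  exact ⟨_, _, fun v => add_nonneg (Int.natCast_nonneg (x v)) (Int.natCast_nonneg (y v)),
    (map_add _ _ _).symm⟩

variable (Λ) in
/-- The positive cone of the dimension group as a submonoid. -/
def dimCone : AddSubmonoid Λ.DimensionGroup where
  carrier := Λ.dimPositive
  zero_mem' := zero_mem_dimPositive
  add_mem' := add_mem_dimPositive

end DimLift

/-! ## The talented monoid and the positive cone of the dimension group -/

section Talented

variable {k : ℕ} {V P : Type*} (Λ : KGraph k V P)

/-- The generator `v(n)` of the talented monoid. -/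
noncomputable def talentedGen (v : V) (n : Fin k → ℤ) : Λ.TalentedMonoid :=
  AddCon.mk' (addConGen Λ.TalentedRel) (Finsupp.single (v, n) 1)

theorem talentedShift_gen (q : Fin k → ℤ) (v : V) (n : Fin k → ℤ) :
    Λ.talentedShift q (Λ.talentedGen v n) = Λ.talentedGen v (n + q) := by
  show AddCon.mk' (addConGen Λ.TalentedRel) (freeShift V q (Finsupp.single (v, n) 1)) = _
  rw [freeShift_single]
  rfl

variable {Λ}

theorem talented_induction {C : Λ.TalentedMonoid → Prop} (h0 : C 0)
    (hadd : ∀ a b, C a → C b → C (a + b)) (hgen : ∀ v n, C (Λ.talentedGen v n))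
    (t : Λ.TalentedMonoid) : C t := by
  obtain ⟨f, rfl⟩ := AddCon.mk'_surjective (c := addConGen Λ.TalentedRel) t
  induction f using Finsupp.induction_linear with
  | zero => exact h0
  | add f g hf hg => rw [map_add]; exact hadd _ _ hf hg
  | single a m =>
    induction m with
    | zero => rw [Finsupp.single_zero]; exact h0
    | succ m ih => rw [Finsupp.single_add, map_add]; exact hadd _ _ ih (hgen a.1 a.2)

theorem talentedHom_ext {M : Type*} [AddCommMonoid M] {f g : Λ.TalentedMonoid →+ M}
    (h : ∀ v n, f (Λ.talentedGen v n) = g (Λ.talentedGen v n)) : f = g := by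
  ext t
  refine talented_induction (C := fun t => f t = g t) (by rw [map_zero, map_zero]) ?_ h t
  intro a b ha hb
  rw [map_add, map_add, ha, hb]

theorem talentedGen_eq_sum_single (hΛ : Λ.RowFiniteNoSources) (v : V) (n : Fin k → ℤ) (i : Fin k) :
    Λ.talentedGen v n =
      ∑ a ∈ hΛ.paths v (Pi.single i 1), Λ.talentedGen (Λ.s a) (n + Pi.single i 1) := by
  refine ((AddCon.eq _).2 (AddConGen.Rel.of _ _ (TalentedRel.rel v n i))).trans ?_
  rw [finsum_mem_eq_finite_toFinset_sum _ (hΛ v (Pi.single i 1)).1]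
  exact map_sum (AddCon.mk' (addConGen Λ.TalentedRel)) _ _

theorem talentedGen_eq_sum_paths (hΛ : Λ.RowFiniteNoSources) (p : Fin k → ℕ) :
    ∀ (v : V) (n : Fin k → ℤ),
      Λ.talentedGen v n = ∑ a ∈ hΛ.paths v p, Λ.talentedGen (Λ.s a) (n + natVec p) := by
  refine natVec_induction (C := fun p => ∀ (v : V) (n : Fin k → ℤ),
      Λ.talentedGen v n = ∑ a ∈ hΛ.paths v p, Λ.talentedGen (Λ.s a) (n + natVec p)) ?_ ?_ ?_ p
  · intro v n
    rw [paths_zero, Finset.sum_singleton, Λ.s_one, map_zero, add_zero]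
  · intro p q hp hq v n
    rw [sum_paths_add, hp]
    refine Finset.sum_congr rfl fun a _ => ?_
    rw [hq]
    refine Finset.sum_congr rfl fun b hb => ?_
    rw [Λ.mul_eq ((hΛ.mem_paths).1 hb).1.symm, Λ.s_comp, map_add, add_assoc]
  · intro i v n
    rw [natVec_single]
    exact talentedGen_eq_sum_single hΛ v n i

variable [Fintype V]

theorem talentedGen_eq_sum (hΛ : Λ.RowFiniteNoSources) (v : V) (n : Fin k → ℤ) (p : Fin k → ℕ) :
    Λ.talentedGen v n = ∑ w, Λ.vertexMatrix p v w • Λ.talentedGen w (n + natVec p) := by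
  rw [talentedGen_eq_sum_paths hΛ p, sum_paths_source hΛ v p fun w => Λ.talentedGen w _]

/-- The relations push each generator forward to any later position, so a finite sum of generators
can be written at one common position. -/
theorem exists_talented_eq_sum (hΛ : Λ.RowFiniteNoSources) (t : Λ.TalentedMonoid) :
    ∃ N : Fin k → ℤ, ∀ n, N ≤ n → ∃ x : V → ℕ, t = ∑ v, x v • Λ.talentedGen v n := by
  refine talented_induction (C := fun t => ∃ N : Fin k → ℤ, ∀ n, N ≤ n →
    ∃ x : V → ℕ, t = ∑ v, x v • Λ.talentedGen v n) ?_ ?_ ?_ t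
  · exact ⟨0, fun n _ => ⟨0, by simp⟩⟩
  · rintro a b ⟨N, hN⟩ ⟨N', hN'⟩
    refine ⟨N ⊔ N', fun n hn => ?_⟩
    obtain ⟨x, hx⟩ := hN n (le_sup_left.trans hn)
    obtain ⟨y, hy⟩ := hN' n (le_sup_right.trans hn)
    exact ⟨x + y, by simp only [hx, hy, Pi.add_apply, add_smul, Finset.sum_add_distrib]⟩
  · refine fun v m => ⟨m, fun n hn => ⟨Λ.vertexMatrix (fun i => (n i - m i).toNat) v, ?_⟩⟩
    rw [talentedGen_eq_sum hΛ v m fun i => (n i - m i).toNat, natVec_toNat_of_le hn,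
      add_sub_cancel]

variable [DecidableEq V]

/-- The homomorphism `v(n) ↦ [ε_v, n]` from the talented monoid to the dimension group. -/
noncomputable def talentedToDim (hΛ : Λ.RowFiniteNoSources) :
    Λ.TalentedMonoid →+ Λ.DimensionGroup :=
  AddCon.lift (addConGen Λ.TalentedRel)
    (Finsupp.liftAddHom fun a => (multiplesHom _ (Λ.dimClass a.2 (Pi.single a.1 1))))
    (AddCon.addConGen_le.2 fun x y h => by
      obtain ⟨v, n, i⟩ := h
      rw [AddCon.ker_rel, finsum_mem_eq_finite_toFinset_sum _ (hΛ v (Pi.single i 1)).1]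
      simp only [map_sum, Finsupp.liftAddHom_apply_single, multiplesHom_apply, one_smul]
      rw [← sum_vertexMatrix_smul_dimClass v n (Pi.single i 1), natVec_single]
      exact (sum_paths_source hΛ v (Pi.single i 1) fun w =>
        Λ.dimClass (n + Pi.single i 1) (Pi.single w 1)).symm)

theorem talentedToDim_gen (hΛ : Λ.RowFiniteNoSources) (v : V) (n : Fin k → ℤ) :
    talentedToDim hΛ (Λ.talentedGen v n) = Λ.dimClass n (Pi.single v 1) := by
  show Finsupp.liftAddHom (fun a : V × (Fin k → ℤ) =>
    (multiplesHom _ (Λ.dimClass a.2 (Pi.single a.1 1)))) (Finsupp.single (v, n) 1) = _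
  rw [Finsupp.liftAddHom_apply_single, multiplesHom_apply, one_smul]

theorem talentedToDim_sum (hΛ : Λ.RowFiniteNoSources) (x : V → ℕ) (n : Fin k → ℤ) :
    talentedToDim hΛ (∑ v, x v • Λ.talentedGen v n) = Λ.dimClass n fun v => x v := by
  rw [map_sum, dimClass_eq_sum]
  refine Finset.sum_congr rfl fun v _ => ?_
  rw [map_nsmul, talentedToDim_gen, natCast_zsmul]

theorem talentedToDim_shift (hΛ : Λ.RowFiniteNoSources) (q : Fin k → ℤ) (t : Λ.TalentedMonoid) :
    talentedToDim hΛ (Λ.talentedShift q t) = Λ.dimTranslate q (talentedToDim hΛ t) := by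
  refine DFunLike.congr_fun (f := (talentedToDim hΛ).comp (Λ.talentedShift q))
    (g := (Λ.dimTranslate q).comp (talentedToDim hΛ)) (talentedHom_ext fun v n => ?_) t
  simp only [AddMonoidHom.comp_apply, talentedShift_gen, talentedToDim_gen, dimTranslate_dimClass]

/-- Written at one position, two elements with equal images are natural vectors `x`, `y` with `xA_p
= yA_p`. Pushing both forward by `p` inside the monoid gives the same sum of generators; in
particular the monoid is cancellative. -/
theorem talentedToDim_injective (hΛ : Λ.RowFiniteNoSources) :
    Function.Injective (talentedToDim hΛ) := by
  intro a b h
  obtain ⟨N, hN⟩ := exists_talented_eq_sum hΛ a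
  obtain ⟨N', hN'⟩ := exists_talented_eq_sum hΛ b
  obtain ⟨x, rfl⟩ := hN (N ⊔ N') le_sup_left
  obtain ⟨y, rfl⟩ := hN' (N ⊔ N') le_sup_right
  rw [talentedToDim_sum, talentedToDim_sum, dimClass_eq_iff hΛ] at h
  obtain ⟨p, hp⟩ := h
  have e : ∀ x : V → ℕ, ∑ v, x v • Λ.talentedGen v (N ⊔ N') =
      ∑ w, (Matrix.vecMul x (Λ.vertexMatrix p) w) • Λ.talentedGen w (N ⊔ N' + natVec p) := by
    intro x
    simp only [talentedGen_eq_sum hΛ _ (N ⊔ N') p, Finset.smul_sum, Matrix.vecMul, dotProduct,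
      Finset.sum_smul, mul_smul]
    exact Finset.sum_comm
  rw [e, e]
  refine Finset.sum_congr rfl fun w _ => ?_
  congr 1
  have h := congrFun hp w
  simp only [Matrix.vecMul, dotProduct, intMatrix, Matrix.toInt, Matrix.map_apply] at h ⊢
  exact_mod_cast h

theorem range_talentedToDim (hΛ : Λ.RowFiniteNoSources) :
    Set.range (talentedToDim hΛ) = Λ.dimPositive := by
  ext h
  constructor
  · rintro ⟨t, rfl⟩
    obtain ⟨N, hN⟩ := exists_talented_eq_sum hΛ t
    obtain ⟨x, rfl⟩ := hN N le_rfl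
    exact ⟨N, _, fun v => Int.natCast_nonneg (x v), talentedToDim_sum hΛ x N⟩
  · intro hh
    obtain ⟨N, hN⟩ := exists_natVec_dimClass_of_mem_dimPositive hh
    obtain ⟨x, rfl⟩ := hN N le_rfl
    exact ⟨_, talentedToDim_sum hΛ x _⟩

end Talented

/-! ### Extending isomorphisms between positive cones and groups -/

section TalentedIso

theorem exists_addEquiv_of_image_range {M N G H : Type*} [AddCommMonoid M] [AddCommMonoid N]
    [AddCommGroup G] [AddCommGroup H] {a : M →+ G} {b : N →+ H} (ha : Function.Injective a)
    (hb : Function.Injective b) (φ : G ≃+ H) (h : φ '' Set.range a = Set.range b) :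
    ∃ e : M ≃+ N, ∀ m, b (e m) = φ (a m) := by
  have h1 : ∀ m, ∃ n, b n = φ (a m) := fun m => by
    have : φ (a m) ∈ Set.range b := h ▸ ⟨_, ⟨m, rfl⟩, rfl⟩
    exact this
  choose f hf using h1
  let F : M →+ N :=
    { toFun := f
      map_zero' := hb (by rw [hf, map_zero, map_zero, map_zero])
      map_add' := fun x y => hb (by rw [map_add, hf, hf, hf, map_add, map_add]) }
  refine ⟨AddEquiv.ofBijective F ⟨?_, ?_⟩, hf⟩
  · intro x y hxy
    have h2 : f x = f y := hxy
    exact ha (φ.injective (by rw [← hf, ← hf, h2]))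
  · intro n
    obtain ⟨_, ⟨m, rfl⟩, hm⟩ : b n ∈ φ '' Set.range a := h ▸ ⟨n, rfl⟩
    exact ⟨m, hb ((hf m).trans hm)⟩

variable {k : ℕ} {V P W Q : Type*} [Fintype V] [Fintype W] {Λ : KGraph k V P} {Ω : KGraph k W Q}

theorem talentedIso_of_isDimIso [DecidableEq V] [DecidableEq W] (hΛ : Λ.RowFiniteNoSources)
    (hΩ : Ω.RowFiniteNoSources) {φ : Λ.DimensionGroup ≃+ Ω.DimensionGroup} (hφ : IsDimIso φ) :
    TalentedIso Λ Ω := by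
  obtain ⟨e, he⟩ := exists_addEquiv_of_image_range (talentedToDim_injective hΛ)
    (talentedToDim_injective hΩ) φ (by rw [range_talentedToDim, range_talentedToDim, hφ.1])
  refine ⟨e, fun q t => talentedToDim_injective hΩ ?_⟩
  rw [he, talentedToDim_shift, talentedToDim_shift, he, hφ.map_dimTranslate]

/-- The images of the generators `v(n)` satisfy the relations of the direct limit because those
relations already hold in the talented monoid. -/
theorem exists_dimHom_of_talentedHom [DecidableEq V] [DecidableEq W] (hΛ : Λ.RowFiniteNoSources)
    (hΩ : Ω.RowFiniteNoSources) (e : Λ.TalentedMonoid →+ Ω.TalentedMonoid) :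
    ∃ f : Λ.DimensionGroup →+ Ω.DimensionGroup,
      ∀ t, f (talentedToDim hΛ t) = talentedToDim hΩ (e t) := by
  let F : V → (Fin k → ℤ) → Ω.DimensionGroup := fun v n => talentedToDim hΩ (e (Λ.talentedGen v n))
  have hF : ∀ v n p, F v n = ∑ w, Λ.vertexMatrix p v w • F w (n + natVec p) := fun v n p => by
    simp only [F]
    conv_lhs => rw [talentedGen_eq_sum hΛ v n p]
    simp only [map_sum, map_nsmul]
  refine ⟨dimLift F hF, fun t => ?_⟩
  refine DFunLike.congr_fun (f := (dimLift F hF).comp (talentedToDim hΛ))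
    (g := (talentedToDim hΩ).comp e) (talentedHom_ext fun v n => ?_) t
  rw [AddMonoidHom.comp_apply, talentedToDim_gen, dimLift_single]
  rfl

theorem exists_isDimIso_of_talentedIso [DecidableEq V] [DecidableEq W]
    (hΛ : Λ.RowFiniteNoSources) (hΩ : Ω.RowFiniteNoSources) (h : TalentedIso Λ Ω) :
    ∃ φ : Λ.DimensionGroup ≃+ Ω.DimensionGroup, IsDimIso φ := by
  obtain ⟨e, he⟩ := h
  obtain ⟨f, hf⟩ := exists_dimHom_of_talentedHom hΛ hΩ e.toAddMonoidHom
  obtain ⟨g, hg⟩ := exists_dimHom_of_talentedHom hΩ hΛ e.symm.toAddMonoidHom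
  have hf : ∀ t, f (talentedToDim hΛ t) = talentedToDim hΩ (e t) := hf
  have hg : ∀ t, g (talentedToDim hΩ t) = talentedToDim hΛ (e.symm t) := hg
  have hgf : g.comp f = AddMonoidHom.id _ := dimHom_ext_single fun v n => by
    rw [← talentedToDim_gen hΛ, AddMonoidHom.comp_apply, hf, hg, e.symm_apply_apply]
    rfl
  have hfg : f.comp g = AddMonoidHom.id _ := dimHom_ext_single fun v n => by
    rw [← talentedToDim_gen hΩ, AddMonoidHom.comp_apply, hg, hf, e.apply_symm_apply]
    rfl
  refine ⟨f.toAddEquiv g hgf hfg, ?_, fun i h => ?_⟩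
  · show f '' _ = _
    rw [← range_talentedToDim hΛ, ← range_talentedToDim hΩ, ← Set.range_comp]
    have : f ∘ talentedToDim hΛ = talentedToDim hΩ ∘ e := funext hf
    rw [this, e.surjective.range_comp]
  · show f _ = Ω.dimShift i (f h)
    refine DFunLike.congr_fun (f := f.comp (Λ.dimShift i)) (g := (Ω.dimShift i).comp f)
      (dimHom_ext_single fun v n => ?_) h
    rw [AddMonoidHom.comp_apply, AddMonoidHom.comp_apply, ← talentedToDim_gen hΛ, hf, dimShift_eq,
      dimShift_eq, ← talentedToDim_shift, ← talentedToDim_shift, hf, he]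

end TalentedIso

end KGraph

namespace KGraph

/-! ## Infinite paths and their initial segments -/

section InfPath

variable {k : ℕ} {V P : Type*} {Λ : KGraph k V P}

namespace InfPath

/-- The initial segment of degree `n` of an infinite path. -/
def pre (x : Λ.InfPath) (n : Fin k → ℕ) : P := x.seg 0 n zero_le

variable (x y : Λ.InfPath)

theorem d_pre (n : Fin k → ℕ) : Λ.d (x.pre n) = n := (x.d_seg _ _ _).trans (tsub_zero n)

theorem r_pre (n : Fin k → ℕ) : Λ.r (x.pre n) = x.vert 0 := x.r_seg _ _ _

theorem s_pre (n : Fin k → ℕ) : Λ.s (x.pre n) = x.vert n := x.s_seg _ _ _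

theorem pre_comp_seg {m n : Fin k → ℕ} (h : m ≤ n) :
    Λ.comp (x.pre m) (x.seg m n h) ((x.s_pre m).trans (x.r_seg m n h).symm) = x.pre n :=
  x.seg_comp 0 m n zero_le h

theorem isPrefix_pre {m n : Fin k → ℕ} (h : m ≤ n) : Λ.IsPrefix (x.pre m) (x.pre n) :=
  ⟨_, _, x.pre_comp_seg h⟩

variable {x y}

theorem pre_eq_of_isPrefix {a : P} {n : Fin k → ℕ} (h : Λ.IsPrefix a (x.pre n))
    (hn : Λ.d a ≤ n) : x.pre (Λ.d a) = a :=
  (x.isPrefix_pre hn).unique h (x.d_pre _)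

theorem pre_eq_of_le {m n : Fin k → ℕ} (h : m ≤ n) (e : x.pre n = y.pre n) :
    x.pre m = y.pre m :=
  (x.isPrefix_pre h).unique (e ▸ y.isPrefix_pre h) ((x.d_pre m).trans (y.d_pre m).symm)

/-- The segment from `m` to `n` is the second factor of the initial segment of degree `n`, so unique
factorization recovers it from initial segments. -/
theorem ext_pre (h : ∀ n, x.pre n = y.pre n) : x = y := by
  have hv : ∀ n, x.vert n = y.vert n := fun n => by rw [← s_pre, h, s_pre]
  have hs : ∀ m n hmn, x.seg m n hmn = y.seg m n hmn := fun m n hmn =>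
    (comp_inj (((x.pre_comp_seg hmn).trans (h n)).trans (y.pre_comp_seg hmn).symm)
      (congrArg Λ.d (h m))).2
  exact InfPath.ext (funext hv) (funext fun m => funext fun n => funext fun hmn => hs m n hmn)

theorem seg_congr {m n m' n' : Fin k → ℕ} (h : m ≤ n) (hm : m = m') (hn : n = n') :
    x.seg m n h = x.seg m' n' (hm ▸ hn ▸ h) := by
  subst hm hn
  rfl

theorem comp_congr_left {a a' b : P} (e : a = a') (h : Λ.s a = Λ.r b) :
    Λ.comp a b h = Λ.comp a' b (e ▸ h) := by
  subst e
  rfl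

theorem s_pre_eq_r_pre_shift (p n : Fin k → ℕ) :
    Λ.s (x.pre p) = Λ.r ((x.shift p).pre n) := by
  rw [s_pre, r_pre]
  exact congrArg x.vert (zero_add p).symm

theorem pre_comp_shift (p n : Fin k → ℕ) :
    Λ.comp (x.pre p) ((x.shift p).pre n) (s_pre_eq_r_pre_shift p n) = x.pre (p + n) := by
  rw [← x.pre_comp_seg (le_self_add : p ≤ p + n)]
  congr 1
  exact seg_congr _ (zero_add p) (add_comm n p)

theorem vert_shift_zero (p : Fin k → ℕ) : (x.shift p).vert 0 = x.vert p :=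
  congrArg x.vert (zero_add p)

theorem pre_shift_eq (p n : Fin k → ℕ) (h : x.pre (p + n) = y.pre (p + n)) :
    (x.shift p).pre n = (y.shift p).pre n := by
  rw [← pre_comp_shift, ← pre_comp_shift] at h
  exact (comp_inj h ((x.d_pre p).trans (y.d_pre p).symm)).2

/-- An infinite path is given by a compatible family of initial segments. -/
noncomputable def ofPrefixes (p : (Fin k → ℕ) → P) (hd : ∀ n, Λ.d (p n) = n)
    (hp : ∀ m n, m ≤ n → Λ.IsPrefix (p m) (p n)) : Λ.InfPath where
  vert n := Λ.s (p n)
  seg m n h := (hp m n h).choose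
  r_seg m n h := (hp m n h).choose_spec.choose.symm
  s_seg m n h := by
    obtain ⟨h1, h2⟩ := (hp m n h).choose_spec
    conv_rhs => rw [← h2]
    exact (Λ.s_comp _ _ _).symm
  seg_self m := by
    obtain ⟨h1, h2⟩ := (hp m m le_rfl).choose_spec
    exact (comp_inj (h2.trans (Λ.comp_one (p m)).symm) rfl).2
  seg_comp m n q h₁ h₂ := by
    obtain ⟨a1, a2⟩ := (hp m n h₁).choose_spec
    obtain ⟨b1, b2⟩ := (hp n q h₂).choose_spec
    obtain ⟨c1, c2⟩ := (hp m q (h₁.trans h₂)).choose_spec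
    -- Both sides complete `p m` to `p q`, so cancelling `p m` identifies them.
    refine (comp_inj (a := p m) (a' := p m) (h := ?_) (h' := c1) ?_ rfl).2
    · rw [Λ.r_comp]
      exact a1
    · exact ((Λ.assoc (p m) _ _ a1 _).symm.trans ((comp_congr_left a2 _).trans b2)).trans c2.symm
  d_seg m n h := by
    obtain ⟨h1, h2⟩ := (hp m n h).choose_spec
    have := congrArg Λ.d h2
    rw [Λ.d_comp, hd, hd] at this
    exact eq_tsub_of_add_eq (by rw [add_comm]; exact this)

theorem pre_ofPrefixes (p : (Fin k → ℕ) → P) (hd : ∀ n, Λ.d (p n) = n)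
    (hp : ∀ m n, m ≤ n → Λ.IsPrefix (p m) (p n)) (n : Fin k → ℕ) :
    (ofPrefixes p hd hp).pre n = p n := by
  have e := (ofPrefixes p hd hp).pre_comp_seg (m := 0) (n := n) zero_le
  obtain ⟨h1, h2⟩ := (hp 0 n zero_le).choose_spec
  have h0 : (ofPrefixes p hd hp).pre 0 = p 0 := by
    rw [Λ.eq_one_of_d (d_pre _ _), r_pre, Λ.eq_one_of_d (hd 0)]
    exact congrArg Λ.one (Λ.s_eq_r_of_d (hd 0))
  refine e.symm.trans ?_
  conv_rhs => rw [← h2]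
  congr 1

theorem exists_concat (l : P) (z : Λ.InfPath) (h : Λ.s l = z.vert 0) :
    ∃ x : Λ.InfPath, ∀ N, x.pre (Λ.d l + N) =
      Λ.comp l (z.pre N) (h.trans (z.r_pre N).symm) := by
  -- The path `l z(0, N)` has degree `d(l) + N ≥ N`, so it is long enough to supply the initial
  -- segment of degree `N` of `l z`.
  have hN : ∀ N, N ≤ Λ.d (Λ.comp l (z.pre N) (h.trans (z.r_pre N).symm)) := fun N => by
    rw [Λ.d_comp, d_pre]
    exact le_add_self
  choose p hp1 hp2 using fun N => exists_prefix (hN N)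
  refine ⟨ofPrefixes p hp2 fun M N hMN => ?_, fun N => ?_⟩
  · refine ((hp1 M).trans ((z.isPrefix_pre hMN).comp_left l _ _)).of_le (hp1 N) ?_
    rw [hp2, hp2]
    exact hMN
  · rw [pre_ofPrefixes]
    refine (hp1 _).unique ((z.isPrefix_pre le_add_self).comp_left l _ _) ?_
    rw [hp2, Λ.d_comp, d_pre]

/-- The infinite path `l z`. -/
noncomputable def concat (l : P) (z : Λ.InfPath) (h : Λ.s l = z.vert 0) : Λ.InfPath :=
  (exists_concat l z h).choose

variable {l : P} {z : Λ.InfPath} (h : Λ.s l = z.vert 0)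

theorem pre_concat (N : Fin k → ℕ) : (concat l z h).pre (Λ.d l + N) =
    Λ.comp l (z.pre N) (h.trans (z.r_pre N).symm) :=
  (exists_concat l z h).choose_spec N

theorem pre_concat_self : (concat l z h).pre (Λ.d l) = l := by
  refine pre_eq_of_isPrefix (n := Λ.d l + 0) ?_ le_self_add
  rw [pre_concat]
  exact IsPrefix.comp _ _ _

theorem shift_concat : (concat l z h).shift (Λ.d l) = z := by
  refine ext_pre fun n => ?_
  have e := (pre_comp_shift (x := concat l z h) (Λ.d l) n).trans (pre_concat h n)
  exact (comp_inj e (d_pre _ _)).2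

theorem eq_of_shift_eq {p : Fin k → ℕ} (h1 : x.pre p = y.pre p) (h2 : x.shift p = y.shift p) :
    x = y := by
  refine ext_pre fun n => pre_eq_of_le (le_add_self : n ≤ p + n) ?_
  rw [← pre_comp_shift, ← pre_comp_shift]
  congr 1
  rw [h2]

theorem s_eq_of_pre (hx : x.pre (Λ.d l) = l) : Λ.s l = (x.shift (Λ.d l)).vert 0 := by
  rw [vert_shift_zero, ← s_pre, hx]

theorem concat_shift (hx : x.pre (Λ.d l) = l) :
    concat l (x.shift (Λ.d l)) (s_eq_of_pre hx) = x :=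
  eq_of_shift_eq (p := Λ.d l) (by rw [pre_concat_self, hx]) (shift_concat _)

end InfPath

theorem mem_cylinder {l : P} {x : Λ.InfPath} : x ∈ Λ.cylinder l ↔ x.pre (Λ.d l) = l := Iff.rfl

theorem pre_mem_cylinder (x : Λ.InfPath) (n : Fin k → ℕ) : x ∈ Λ.cylinder (x.pre n) := by
  rw [mem_cylinder, x.d_pre]

theorem mem_cylinder_of_d {l : P} {n : Fin k → ℕ} (h : Λ.d l = n) {x : Λ.InfPath} :
    x ∈ Λ.cylinder l ↔ x.pre n = l := by
  rw [mem_cylinder, h]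

theorem cylinder_one (v : V) : Λ.cylinder (Λ.one v) = {x | x.vert 0 = v} := by
  ext x
  rw [mem_cylinder_of_d (Λ.d_one v), Λ.eq_one_of_d (x.d_pre 0), x.r_pre]
  refine ⟨fun h => ?_, fun h => congrArg Λ.one h⟩
  exact (Λ.r_one (x.vert 0)).symm.trans ((congrArg Λ.r h).trans (Λ.r_one v))

/-- Paths of degree `(1, …, 1)` are composed indefinitely. The degrees `(j, …, j)` are cofinal in
`ℕ^k`, so the partial products contain initial segments of every degree. -/
theorem exists_infPath (hΛ : Λ.RowFiniteNoSources) (v : V) : ∃ x : Λ.InfPath, x.vert 0 = v := by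
  choose a ha using fun v => (hΛ v 1).2
  let q : ℕ → P := fun j => Nat.rec (Λ.one v) (fun _ l => Λ.mul l (a (Λ.s l))) j
  have hq : ∀ j, q (j + 1) = Λ.comp (q j) (a (Λ.s (q j))) (ha _).1.symm := fun j =>
    Λ.mul_eq (ha _).1.symm
  have hd : ∀ j, Λ.d (q j) = fun _ => j := fun j => by
    induction j with
    | zero => exact Λ.d_one v
    | succ j ih =>
      rw [hq, Λ.d_comp, ih, (ha _).2]
      rfl
  have hp : ∀ i j, i ≤ j → Λ.IsPrefix (q i) (q j) := fun i j hij => by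
    induction hij with
    | refl => exact IsPrefix.refl _
    | step _ ih => rw [hq]; exact ih.trans (IsPrefix.comp _ _ _)
  have hle : ∀ N : Fin k → ℕ, N ≤ Λ.d (q (∑ i, N i)) := fun N i => by
    rw [hd]
    exact Finset.single_le_sum (f := N) (fun _ _ => zero_le) (Finset.mem_univ i)
  choose p hp1 hp2 using fun N => exists_prefix (hle N)
  refine ⟨InfPath.ofPrefixes p hp2 fun M N hMN => ?_, ?_⟩
  · refine ((hp1 M).trans (hp _ _ (Finset.sum_le_sum fun i _ => hMN i))).of_le (hp1 N) ?_
    rw [hp2, hp2]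
    exact hMN
  · rw [← InfPath.r_pre _ 0, InfPath.pre_ofPrefixes, (hp1 0).r_eq]
    simp only [Pi.zero_apply, Finset.sum_const_zero]
    exact Λ.r_one v

theorem cylinder_nonempty (hΛ : Λ.RowFiniteNoSources) (l : P) : (Λ.cylinder l).Nonempty := by
  obtain ⟨z, hz⟩ := exists_infPath hΛ (Λ.s l)
  exact ⟨InfPath.concat l z hz.symm, InfPath.pre_concat_self _⟩

/-! ## The topology of the infinite path space -/

theorem isOpen_cylinder (l : P) : IsOpen (Λ.cylinder l) :=
  TopologicalSpace.isOpen_generateFrom_of_mem ⟨l, rfl⟩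

/-- Cylinders form a neighbourhood basis because two initial segments of `x` extend to one whose
degree is their supremum. All topological arguments on `Λ^∞` go through this criterion. -/
theorem isOpen_infPath_iff {U : Set Λ.InfPath} :
    IsOpen U ↔ ∀ x ∈ U, ∃ N, ∀ y : Λ.InfPath, y.pre N = x.pre N → y ∈ U := by
  constructor
  · intro h
    change TopologicalSpace.GenerateOpen _ U at h
    induction h with
    | basic U hU =>
      obtain ⟨l, rfl⟩ := hU
      exact fun x hx => ⟨Λ.d l, fun y hy => hy.trans hx⟩
    | univ => exact fun x _ => ⟨0, fun y _ => trivial⟩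
    | inter U U' _ _ h h' =>
      rintro x ⟨hx, hx'⟩
      obtain ⟨N, hN⟩ := h x hx
      obtain ⟨N', hN'⟩ := h' x hx'
      exact ⟨N ⊔ N', fun y hy => ⟨hN y (InfPath.pre_eq_of_le le_sup_left hy),
        hN' y (InfPath.pre_eq_of_le le_sup_right hy)⟩⟩
    | sUnion S _ h =>
      rintro x ⟨U, hU, hx⟩
      obtain ⟨N, hN⟩ := h U hU x hx
      exact ⟨N, fun y hy => ⟨U, hU, hN y hy⟩⟩
  · intro h
    refine isOpen_iff_forall_mem_open.2 fun x hx => ?_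
    obtain ⟨N, hN⟩ := h x hx
    exact ⟨Λ.cylinder (x.pre N), fun y hy => hN y ((mem_cylinder_of_d (x.d_pre N)).1 hy),
      isOpen_cylinder _, pre_mem_cylinder x N⟩

theorem isOpen_setOf_pre (n : Fin k → ℕ) (C : P → Prop) :
    IsOpen {x : Λ.InfPath | C (x.pre n)} :=
  isOpen_infPath_iff.2 fun x hx => ⟨n, fun y hy => by
    show C (y.pre n)
    rw [hy]
    exact hx⟩

theorem isClopen_setOf_pre (n : Fin k → ℕ) (C : P → Prop) :
    IsClopen {x : Λ.InfPath | C (x.pre n)} :=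
  ⟨⟨isOpen_setOf_pre n fun l => ¬ C l⟩, isOpen_setOf_pre n C⟩

theorem isClopen_cylinder (l : P) : IsClopen (Λ.cylinder l) :=
  isClopen_setOf_pre (Λ.d l) fun a => a = l

instance : T2Space Λ.InfPath := by
  refine ⟨fun x y hxy => ?_⟩
  obtain ⟨n, hn⟩ : ∃ n, x.pre n ≠ y.pre n := by
    by_contra! h
    exact hxy (InfPath.ext_pre h)
  refine ⟨{z | z.pre n = x.pre n}, {z | z.pre n = y.pre n}, isOpen_setOf_pre n (· = x.pre n),
    isOpen_setOf_pre n (· = y.pre n), rfl, rfl, ?_⟩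
  rw [Set.disjoint_left]
  intro z hz hz'
  exact hn (hz.symm.trans hz')

theorem finite_setOf_d [Finite V] (hΛ : Λ.RowFiniteNoSources) (n : Fin k → ℕ) :
    {l | Λ.d l = n}.Finite := by
  have h : {l | Λ.d l = n} = ⋃ v, Λ.pathsFrom v n := by
    ext l
    simp [pathsFrom]
  rw [h]
  exact Set.finite_iUnion fun v => (hΛ v n).1

theorem compactSpace_infPath [Finite V] (hΛ : Λ.RowFiniteNoSources) :
    CompactSpace Λ.InfPath := by
  refine ⟨isCompact_iff_ultrafilter_le_nhds.2 fun F _ => ?_⟩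
  -- There are finitely many paths of degree `n`, so the ultrafilter selects one of them. The
  -- selected paths are compatible, since the corresponding sets meet, and define the limit.
  have h : ∀ n, ∃ l, {x : Λ.InfPath | x.pre n = l} ∈ F := fun n => by
    have h1 : (⋃ l ∈ {l | Λ.d l = n}, {x : Λ.InfPath | x.pre n = l}) ∈ F := by
      refine Filter.mem_of_superset Filter.univ_mem fun x _ => ?_
      exact Set.mem_biUnion (x.d_pre n) rfl
    obtain ⟨l, -, hl⟩ := (Ultrafilter.finite_biUnion_mem_iff (finite_setOf_d hΛ n)).1 h1
    exact ⟨l, hl⟩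
  choose p hp using h
  have hd : ∀ n, Λ.d (p n) = n := fun n => by
    obtain ⟨x, hx⟩ := Ultrafilter.nonempty_of_mem (hp n)
    rw [← show x.pre n = p n from hx, x.d_pre]
  have hc : ∀ m n, m ≤ n → Λ.IsPrefix (p m) (p n) := fun m n hmn => by
    obtain ⟨x, hx, hx'⟩ := Ultrafilter.nonempty_of_mem (Filter.inter_mem (hp m) (hp n))
    rw [← show x.pre m = p m from hx, ← show x.pre n = p n from hx']
    exact x.isPrefix_pre hmn
  refine ⟨InfPath.ofPrefixes p hd hc, trivial, fun U hU => ?_⟩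
  obtain ⟨U', hU', ho, hm⟩ := mem_nhds_iff.1 hU
  obtain ⟨N, hN⟩ := isOpen_infPath_iff.1 ho _ hm
  refine Filter.mem_of_superset (hp N) fun y hy => hU' (hN y ?_)
  rw [InfPath.pre_ofPrefixes]
  exact hy

theorem continuous_shift (p : Fin k → ℕ) : Continuous (InfPath.shift p : Λ.InfPath → Λ.InfPath) := by
  refine ⟨fun U hU => isOpen_infPath_iff.2 fun x hx => ?_⟩
  obtain ⟨N, hN⟩ := isOpen_infPath_iff.1 hU _ hx
  exact ⟨p + N, fun y hy => hN _ (InfPath.pre_shift_eq p N hy)⟩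

/-- A continuous map to a discrete space is locally determined by an initial segment. Compactness
makes the degree uniform, by taking suprema over a finite cover. -/
theorem exists_pre_const [Finite V] (hΛ : Λ.RowFiniteNoSources) {Y : Type*} [TopologicalSpace Y]
    [DiscreteTopology Y] (g : C(Λ.InfPath, Y)) :
    ∃ N, ∀ x y : Λ.InfPath, x.pre N = y.pre N → g x = g y := by
  have := compactSpace_infPath hΛ
  have h := isCompact_univ (X := Λ.InfPath)
  suffices ∃ N, ∀ x ∈ (Set.univ : Set Λ.InfPath), ∀ y : Λ.InfPath, x.pre N = y.pre N → g x = g y by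
    obtain ⟨N, hN⟩ := this
    exact ⟨N, fun x y => hN x trivial y⟩
  refine h.induction_on (p := fun S => ∃ N, ∀ x ∈ S, ∀ y : Λ.InfPath, x.pre N = y.pre N →
    g x = g y) ⟨0, fun x hx => hx.elim⟩ ?_ ?_ ?_
  · rintro S T hST ⟨N, hN⟩
    exact ⟨N, fun x hx => hN x (hST hx)⟩
  · rintro S T ⟨N, hN⟩ ⟨N', hN'⟩
    refine ⟨N ⊔ N', fun x hx y hy => ?_⟩
    rcases hx with hx | hx
    · exact hN x hx y (InfPath.pre_eq_of_le le_sup_left hy)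
    · exact hN' x hx y (InfPath.pre_eq_of_le le_sup_right hy)
  · intro x _
    have ho : IsOpen (g ⁻¹' {g x}) := (isOpen_discrete _).preimage g.continuous
    obtain ⟨N, hN⟩ := isOpen_infPath_iff.1 ho x rfl
    refine ⟨Λ.cylinder (x.pre N), mem_nhdsWithin_of_mem_nhds
      ((isOpen_cylinder _).mem_nhds (pre_mem_cylinder x N)), N, fun z hz y hy => ?_⟩
    have hz' : z.pre N = x.pre N := (mem_cylinder_of_d (x.d_pre N)).1 hz
    exact (show g z = g x from hN z hz').trans (show g y = g x from hN y (hy.symm.trans hz')).symm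

end InfPath

end KGraph

namespace KGraph

/-! ## The topology of the infinite path groupoid -/

section PathArrow

variable {k : ℕ} {V P : Type*} {Λ : KGraph k V P}

namespace PathArrow

/-- The arrow `h` lies in the basic set around `g` that is cut out by initial segments of degrees
`p` and `q`. -/
def Near (p q : Fin k → ℕ) (g h : Λ.PathArrow) : Prop :=
  h.fst.pre p = g.fst.pre p ∧ h.snd.pre q = g.snd.pre q ∧ h.deg = g.deg ∧
    h.fst.shift p = h.snd.shift q

/-- After `p` and `q` respectively, the ends of `h` agree with those of `g` for another `N`, where
the two ends of `g` coincide. Beyond that they agree by assumption, so the tails of `h` coincide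
from `p` and `q` on. -/
theorem Near.of_add {p q N : Fin k → ℕ} {g h : Λ.PathArrow} (hg : g.fst.shift p = g.snd.shift q)
    (hn : Near (p + N) (q + N) g h) : Near p q g h := by
  obtain ⟨h1, h2, h3, h4⟩ := hn
  refine ⟨InfPath.pre_eq_of_le le_self_add h1, InfPath.pre_eq_of_le le_self_add h2, h3, ?_⟩
  refine InfPath.eq_of_shift_eq (p := N) ?_ ?_
  · rw [InfPath.pre_shift_eq p N h1, InfPath.pre_shift_eq q N h2, hg]
  · rw [InfPath.shift_shift, InfPath.shift_shift, add_comm N, add_comm N, h4]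

theorem shift_add_eq {p q : Fin k → ℕ} {g : Λ.PathArrow} (hg : g.fst.shift p = g.snd.shift q)
    (N : Fin k → ℕ) : g.fst.shift (p + N) = g.snd.shift (q + N) := by
  rw [add_comm p, add_comm q, ← InfPath.shift_shift, ← InfPath.shift_shift, hg]

theorem Near.of_le {p q N N' : Fin k → ℕ} {g h : Λ.PathArrow}
    (hg : g.fst.shift p = g.snd.shift q) (hN : N ≤ N')
    (hn : Near (p + N') (q + N') g h) : Near (p + N) (q + N) g h := by
  rw [← add_tsub_cancel_of_le hN, ← add_assoc, ← add_assoc] at hn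
  exact hn.of_add (shift_add_eq hg N)

theorem setOf_near {p q : Fin k → ℕ} {g : Λ.PathArrow}
    (hd : g.deg = fun i => (p i : ℤ) - (q i : ℤ)) :
    {h | Near p q g h} = Λ.basicSet (g.fst.pre p) (g.snd.pre q) := by
  ext h
  simp only [Near, basicSet, Set.mem_ofPred_eq, mem_cylinder, InfPath.d_pre, hd]

theorem near_self {p q : Fin k → ℕ} {g : Λ.PathArrow} (hg : g.fst.shift p = g.snd.shift q) :
    Near p q g g := ⟨rfl, rfl, rfl, hg⟩

theorem isOpen_setOf_near {p q : Fin k → ℕ} {g : Λ.PathArrow}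
    (hd : g.deg = fun i => (p i : ℤ) - (q i : ℤ)) (hg : g.fst.shift p = g.snd.shift q) :
    IsOpen {h | Near p q g h} := by
  rw [setOf_near hd]
  refine TopologicalSpace.isOpen_generateFrom_of_mem ⟨_, _, ?_, rfl⟩
  rw [InfPath.s_pre, InfPath.s_pre, ← InfPath.vert_shift_zero, hg, InfPath.vert_shift_zero]

end PathArrow

open PathArrow

theorem mem_basicSet_iff_near {l m : P} {g h : Λ.PathArrow} (hg : g ∈ Λ.basicSet l m) :
    h ∈ Λ.basicSet l m ↔ Near (Λ.d l) (Λ.d m) g h := by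
  obtain ⟨h1, h2, h3, h4⟩ := hg
  have e1 : g.fst.pre (Λ.d l) = l := h1
  have e2 : g.snd.pre (Λ.d m) = m := h2
  simp only [Near, basicSet, Set.mem_ofPred_eq, mem_cylinder, e1, e2, h3]

/-- Openness may be tested with any presentation `(p, q)` of an arrow, since any two presentations
of the same degree have a common extension. -/
theorem isOpen_pathArrow_iff {U : Set Λ.PathArrow} :
    IsOpen U ↔ ∀ g ∈ U, ∀ p q : Fin k → ℕ, (g.deg = fun i => (p i : ℤ) - (q i : ℤ)) →
      g.fst.shift p = g.snd.shift q → ∃ N, ∀ h, Near (p + N) (q + N) g h → h ∈ U := by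
  constructor
  · intro h
    change TopologicalSpace.GenerateOpen _ U at h
    induction h with
    | basic U hU =>
      obtain ⟨l, m, hlm, rfl⟩ := hU
      intro g hg p q hd _
      have h1 : p + (Λ.d l ⊔ p - p) = Λ.d l + (Λ.d l ⊔ p - Λ.d l) := by
        rw [add_tsub_cancel_of_le le_sup_right, add_tsub_cancel_of_le le_sup_left]
      -- The extension chosen for the range side also works on the source side, because `p - q =
      -- d(l) - d(m)`.
      have h2 : q + (Λ.d l ⊔ p - p) = Λ.d m + (Λ.d l ⊔ p - Λ.d l) := by
        funext i
        have e1 := congrFun h1 i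
        have e2 := congrFun (hd.symm.trans hg.2.2.1) i
        simp only [Pi.add_apply, Pi.sub_apply] at e1 e2 ⊢
        omega
      refine ⟨Λ.d l ⊔ p - p, fun h hh => (mem_basicSet_iff_near hg).2 ?_⟩
      rw [h1, h2] at hh
      exact hh.of_add hg.2.2.2
    | univ => exact fun g _ p q _ _ => ⟨0, fun h _ => trivial⟩
    | inter U U' _ _ h h' =>
      rintro g ⟨hg, hg'⟩ p q hd hs
      obtain ⟨N, hN⟩ := h g hg p q hd hs
      obtain ⟨N', hN'⟩ := h' g hg' p q hd hs
      exact ⟨N ⊔ N', fun y hy => ⟨hN y (hy.of_le hs le_sup_left),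
        hN' y (hy.of_le hs le_sup_right)⟩⟩
    | sUnion S _ h =>
      rintro g ⟨U, hU, hg⟩ p q hd hs
      obtain ⟨N, hN⟩ := h U hU g hg p q hd hs
      exact ⟨N, fun y hy => ⟨U, hU, hN y hy⟩⟩
  · intro h
    refine isOpen_iff_forall_mem_open.2 fun g hg => ?_
    obtain ⟨p, q, hd, hs⟩ := g.exists_shift
    obtain ⟨N, hN⟩ := h g hg p q hd hs
    have hs' := shift_add_eq hs N
    refine ⟨_, fun x hx => hN x hx, isOpen_setOf_near ?_ hs', near_self hs'⟩
    rw [hd]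
    funext i
    simp

theorem continuous_fst_pathArrow : Continuous (PathArrow.fst : Λ.PathArrow → Λ.InfPath) := by
  refine ⟨fun U hU => isOpen_pathArrow_iff.2 fun g hg p q _ _ => ?_⟩
  obtain ⟨N, hN⟩ := isOpen_infPath_iff.1 hU _ hg
  exact ⟨N, fun h hh => hN _ (InfPath.pre_eq_of_le le_add_self hh.1)⟩

theorem continuous_snd_pathArrow : Continuous (PathArrow.snd : Λ.PathArrow → Λ.InfPath) := by
  refine ⟨fun U hU => isOpen_pathArrow_iff.2 fun g hg p q _ _ => ?_⟩
  obtain ⟨N, hN⟩ := isOpen_infPath_iff.1 hU _ hg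
  exact ⟨N, fun h hh => hN _ (InfPath.pre_eq_of_le le_add_self hh.2.1)⟩

theorem continuous_deg_pathArrow : Continuous (PathArrow.deg : Λ.PathArrow → Fin k → ℤ) := by
  refine ⟨fun U _ => isOpen_pathArrow_iff.2 fun g hg p q _ _ => ⟨0, fun h hh => ?_⟩⟩
  show h.deg ∈ U
  rw [hh.2.2.1]
  exact hg

instance : T2Space Λ.PathArrow :=
  T2Space.of_injective_continuous (f := fun g : Λ.PathArrow => (g.fst, g.deg, g.snd))
    (fun g h e => by
      simp only [Prod.mk.injEq] at e
      exact PathArrow.ext e.1 e.2.1 e.2.2)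
    (continuous_fst_pathArrow.prodMk (continuous_deg_pathArrow.prodMk continuous_snd_pathArrow))

/-- The arrow `(l z, d(l) - d(m), m z)`. -/
noncomputable def arrow (l m : P) (z : Λ.InfPath) (hl : Λ.s l = z.vert 0) (hm : Λ.s m = z.vert 0) :
    Λ.PathArrow where
  fst := InfPath.concat l z hl
  deg := natVec (Λ.d l) - natVec (Λ.d m)
  snd := InfPath.concat m z hm
  exists_shift := ⟨Λ.d l, Λ.d m, rfl, by rw [InfPath.shift_concat, InfPath.shift_concat]⟩

theorem arrow_mem_basicSet (l m : P) (z : Λ.InfPath) (hl : Λ.s l = z.vert 0)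
    (hm : Λ.s m = z.vert 0) : arrow l m z hl hm ∈ Λ.basicSet l m :=
  ⟨InfPath.pre_concat_self hl, InfPath.pre_concat_self hm, rfl, by
    show (InfPath.concat l z hl).shift _ = (InfPath.concat m z hm).shift _
    rw [InfPath.shift_concat, InfPath.shift_concat]⟩

theorem eq_arrow_of_shift_fst {l m : P} {g : Λ.PathArrow} (hg : g ∈ Λ.basicSet l m)
    {z : Λ.InfPath} (hz : g.fst.shift (Λ.d l) = z) (hl : Λ.s l = z.vert 0)
    (hm : Λ.s m = z.vert 0) : g = arrow l m z hl hm := by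
  obtain ⟨h1, h2, h3, h4⟩ := hg
  have hz' : g.snd.shift (Λ.d m) = z := h4.symm.trans hz
  refine PathArrow.ext ?_ h3 ?_
  · exact InfPath.eq_of_shift_eq (p := Λ.d l) (h1.trans (InfPath.pre_concat_self hl).symm)
      (hz.trans (InfPath.shift_concat hl).symm)
  · exact InfPath.eq_of_shift_eq (p := Λ.d m) (h2.trans (InfPath.pre_concat_self hm).symm)
      (hz'.trans (InfPath.shift_concat hm).symm)

theorem exists_arrow_near {l m : P} {z : Λ.InfPath} (hl : Λ.s l = z.vert 0)
    (hm : Λ.s m = z.vert 0) {U : Set Λ.PathArrow} (hU : IsOpen U) (hz : arrow l m z hl hm ∈ U) :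
    ∃ N, ∀ (y : Λ.InfPath) (hl' : Λ.s l = y.vert 0) (hm' : Λ.s m = y.vert 0),
      y.pre N = z.pre N → arrow l m y hl' hm' ∈ U := by
  obtain ⟨N, hN⟩ := isOpen_pathArrow_iff.1 hU _ hz (Λ.d l) (Λ.d m) rfl
    (arrow_mem_basicSet l m z hl hm).2.2.2
  refine ⟨N, fun y hl' hm' hy => hN _ ⟨?_, ?_, rfl,
    shift_add_eq (arrow_mem_basicSet l m y hl' hm').2.2.2 N⟩⟩
  · refine (InfPath.pre_concat hl' N).trans (Eq.trans ?_ (InfPath.pre_concat hl N).symm)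
    congr 1
  · refine (InfPath.pre_concat hm' N).trans (Eq.trans ?_ (InfPath.pre_concat hm N).symm)
    congr 1

theorem isOpen_basicSet {l m : P} (h : Λ.s l = Λ.s m) : IsOpen (Λ.basicSet l m) :=
  TopologicalSpace.isOpen_generateFrom_of_mem ⟨l, m, h, rfl⟩

/-- The map `z ↦ (lz, d(l) - d(m), mz)` is continuous from the compact cylinder of the vertex `s(l)`
onto the basic set. -/
theorem isCompact_basicSet [CompactSpace Λ.InfPath] {l m : P} (h : Λ.s l = Λ.s m) :
    IsCompact (Λ.basicSet l m) := by
  let S : Set Λ.InfPath := Λ.cylinder (Λ.one (Λ.s l))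
  have hS : ∀ z : S, Λ.s l = z.1.vert 0 := fun z => by
    have := z.2
    simp only [S, cylinder_one] at this
    exact this.symm
  have : CompactSpace S := isCompact_iff_compactSpace.1 (isClopen_cylinder _).isClosed.isCompact
  let F : S → Λ.PathArrow := fun z => arrow l m z.1 (hS z) (h ▸ hS z)
  have hF : Continuous F := by
    refine ⟨fun U hU => isOpen_iff_forall_mem_open.2 fun z hz => ?_⟩
    obtain ⟨N, hN⟩ := exists_arrow_near (hS z) (h ▸ hS z) hU hz
    exact ⟨Subtype.val ⁻¹' {y : Λ.InfPath | y.pre N = z.1.pre N}, fun y hy => hN _ _ _ hy,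
      (isOpen_setOf_pre N (· = z.1.pre N)).preimage continuous_subtype_val, rfl⟩
  convert isCompact_range hF
  ext g
  constructor
  · intro hg
    have hz : Λ.s l = (g.fst.shift (Λ.d l)).vert 0 := InfPath.s_eq_of_pre hg.1
    refine ⟨⟨g.fst.shift (Λ.d l), ?_⟩, (eq_arrow_of_shift_fst hg rfl hz (h ▸ hz)).symm⟩
    simp only [S, cylinder_one]
    exact hz.symm
  · rintro ⟨z, rfl⟩
    exact arrow_mem_basicSet _ _ _ _ _

theorem isClopen_basicSet [CompactSpace Λ.InfPath] {l m : P} (h : Λ.s l = Λ.s m) :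
    IsClopen (Λ.basicSet l m) := ⟨(isCompact_basicSet h).isClosed, isOpen_basicSet h⟩

theorem exists_mem_basicSet (g : Λ.PathArrow) :
    ∃ l m, Λ.s l = Λ.s m ∧ g ∈ Λ.basicSet l m := by
  obtain ⟨p, q, hd, hs⟩ := g.exists_shift
  refine ⟨g.fst.pre p, g.snd.pre q, ?_, ?_⟩
  · rw [InfPath.s_pre, InfPath.s_pre, ← InfPath.vert_shift_zero, hs, InfPath.vert_shift_zero]
  · rw [← setOf_near hd]
    exact near_self hs

end PathArrow

end KGraph

/-! ## Compactly supported functions on a product with a discrete space -/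

section Level

variable {X Γ : Type*} [TopologicalSpace X]

theorem continuous_ite_of_isClopen {Y Z : Type*} [TopologicalSpace Y] [TopologicalSpace Z]
    {p : Y → Prop} [DecidablePred p] (hp : IsClopen {y | p y}) {f g : Y → Z}
    (hf : Continuous f) (hg : Continuous g) : Continuous fun y => if p y then f y else g y :=
  hf.if (fun a ha => by rw [hp.frontier_eq] at ha; exact ha.elim) hg

variable [TopologicalSpace Γ] [DiscreteTopology Γ]

/-- The restriction of a compactly supported function to the level `n`. -/
def slice (n : Γ) : C_c(X × Γ, ℤ) →+ C(X, ℤ) where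
  toFun f := ⟨fun x => f (x, n), by fun_prop⟩
  map_zero' := rfl
  map_add' _ _ := rfl

omit [DiscreteTopology Γ] in
theorem slice_apply (n : Γ) (f : C_c(X × Γ, ℤ)) (x : X) : slice n f x = f (x, n) := rfl

theorem finite_setOf_slice_ne_zero (f : C_c(X × Γ, ℤ)) : {n | slice n f ≠ 0}.Finite := by
  refine ((f.hasCompactSupport.isCompact.image continuous_snd).finite_of_discrete).subset ?_
  intro n hn
  obtain ⟨x, hx⟩ : ∃ x, f (x, n) ≠ 0 := by
    by_contra! h
    exact hn (ContinuousMap.ext h)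
  exact ⟨(x, n), subset_tsupport _ hx, rfl⟩

/-- The homomorphism on compactly supported functions that is given by `Ψ n` on the level `n`. -/
noncomputable def levelLift {M : Type*} [AddCommGroup M] (Ψ : Γ → C(X, ℤ) →+ M) :
    C_c(X × Γ, ℤ) →+ M :=
  AddMonoidHom.mk' (fun f => ∑ᶠ n, Ψ n (slice n f)) fun f g => by
    have hfin : ∀ f : C_c(X × Γ, ℤ), (Function.support fun n => Ψ n (slice n f)).Finite := fun f =>
      (finite_setOf_slice_ne_zero f).subset fun n hn h => hn (by
        show Ψ n (slice n f) = 0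
        rw [h, map_zero])
    rw [← finsum_add_distrib (hfin f) (hfin g)]
    simp only [map_add]

variable [CompactSpace X] [DecidableEq Γ]

/-- A continuous function as a function that is supported on the level `n`. -/
def level (n : Γ) : C(X, ℤ) →+ C_c(X × Γ, ℤ) where
  toFun g :=
    { toFun := fun y => if y.2 = n then g y.1 else 0
      continuous_toFun := continuous_ite_of_isClopen
        ((isClopen_discrete {n}).preimage continuous_snd) (g.continuous.comp continuous_fst)
        continuous_const
      hasCompactSupport' := HasCompactSupport.intro'
        (isCompact_univ.prod (isCompact_singleton (x := n)))
        (isClosed_univ.prod (isClosed_discrete {n})) fun y hy =>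
          if_neg fun h => hy ⟨trivial, h⟩ }
  map_zero' := CompactlySupportedContinuousMap.ext fun y => by
    show (if y.2 = n then (0 : ℤ) else 0) = 0
    exact ite_self _
  map_add' f g := CompactlySupportedContinuousMap.ext fun y => by
    show (if y.2 = n then f y.1 + g y.1 else 0) =
      (if y.2 = n then f y.1 else 0) + (if y.2 = n then g y.1 else 0)
    split_ifs <;> simp

theorem level_apply (n : Γ) (g : C(X, ℤ)) (y : X × Γ) :
    level n g y = if y.2 = n then g y.1 else 0 := rfl

theorem slice_level (m n : Γ) (g : C(X, ℤ)) : slice m (level n g) = if m = n then g else 0 := by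
  ext x
  rw [slice_apply, level_apply]
  split_ifs <;> rfl

theorem levelLift_level {M : Type*} [AddCommGroup M] (Ψ : Γ → C(X, ℤ) →+ M) (n : Γ) (g : C(X, ℤ)) :
    levelLift Ψ (level n g) = Ψ n g := by
  show ∑ᶠ m, Ψ m (slice m (level n g)) = _
  rw [finsum_eq_single _ n fun m hm => by rw [slice_level, if_neg hm, map_zero], slice_level,
    if_pos rfl]

theorem eq_sum_level (f : C_c(X × Γ, ℤ)) :
    f = ∑ n ∈ (finite_setOf_slice_ne_zero f).toFinset, level n (slice n f) := by
  ext ⟨x, m⟩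
  rw [show (∑ n ∈ (finite_setOf_slice_ne_zero f).toFinset, level n (slice n f)) (x, m) =
    ∑ n ∈ (finite_setOf_slice_ne_zero f).toFinset, level n (slice n f) (x, m) by
      rw [CompactlySupportedContinuousMap.coe_sum, Finset.sum_apply]]
  simp only [level_apply, Finset.sum_ite_eq]
  split_ifs with h
  · rfl
  · have h' : slice m f = 0 := by
      by_contra h'
      exact h ((Set.Finite.mem_toFinset _).2 h')
    exact DFunLike.congr_fun h' x

theorem compactlySupportedHom_ext {M : Type*} [AddCommGroup M] {F F' : C_c(X × Γ, ℤ) →+ M}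
    (h : ∀ n g, F (level n g) = F' (level n g)) : F = F' := by
  ext f
  rw [eq_sum_level f, map_sum, map_sum]
  exact Finset.sum_congr rfl fun n _ => h n _

end Level

namespace KGraph

/-! ## Integer valued functions on the infinite path space -/

section Functions

variable {k : ℕ} {V P : Type*} {Λ : KGraph k V P}

open Classical in
/-- The push-forward of a function along `z ↦ l z`, extended by zero. -/
noncomputable def push (l : P) : C(Λ.InfPath, ℤ) →+ C(Λ.InfPath, ℤ) where
  toFun g := ⟨fun x => if x ∈ Λ.cylinder l then g (x.shift (Λ.d l)) else 0,
    continuous_ite_of_isClopen (isClopen_cylinder l) (g.continuous.comp (continuous_shift _))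
      continuous_const⟩
  map_zero' := ContinuousMap.ext fun x => ite_self _
  map_add' f g := ContinuousMap.ext fun x => by
    show (if x ∈ Λ.cylinder l then f (x.shift (Λ.d l)) + g (x.shift (Λ.d l)) else 0) =
      (if x ∈ Λ.cylinder l then f (x.shift (Λ.d l)) else 0) +
        (if x ∈ Λ.cylinder l then g (x.shift (Λ.d l)) else 0)
    split_ifs <;> simp

theorem push_apply (l : P) (g : C(Λ.InfPath, ℤ)) (x : Λ.InfPath) [Decidable (x ∈ Λ.cylinder l)] :
    push l g x = if x ∈ Λ.cylinder l then g (x.shift (Λ.d l)) else 0 := by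
  refine (show push l g x = @ite _ _ (Classical.propDecidable _) _ _ from rfl).trans ?_
  congr

/-- The indicator function of the cylinder set `Z(l)`. -/
noncomputable def cylInd (l : P) : C(Λ.InfPath, ℤ) := push l 1

theorem cylInd_apply (l : P) (x : Λ.InfPath) [Decidable (x ∈ Λ.cylinder l)] :
    cylInd l x = if x ∈ Λ.cylinder l then 1 else 0 := push_apply l 1 x

theorem cylInd_apply_of_d {l : P} {n : Fin k → ℕ} (h : Λ.d l = n) (x : Λ.InfPath) [DecidableEq P] :
    cylInd l x = if x.pre n = l then 1 else 0 := by
  classical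
  rw [cylInd_apply, if_congr (mem_cylinder_of_d h) rfl rfl]

theorem mem_cylinder_comp {l m : P} (h : Λ.s l = Λ.r m) {x : Λ.InfPath} :
    x ∈ Λ.cylinder (Λ.comp l m h) ↔ x ∈ Λ.cylinder l ∧ x.shift (Λ.d l) ∈ Λ.cylinder m := by
  rw [mem_cylinder_of_d (Λ.d_comp _ _ _), ← InfPath.pre_comp_shift]
  constructor
  · intro e
    exact comp_inj e (InfPath.d_pre _ _)
  · rintro ⟨h1, h2⟩
    rw [mem_cylinder] at h1 h2
    congr 1

theorem push_cylInd {l m : P} (h : Λ.s l = Λ.r m) : push l (cylInd m) = cylInd (Λ := Λ) (Λ.comp l m h) := by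
  classical
  ext x
  rw [push_apply, cylInd_apply, cylInd_apply, if_congr (mem_cylinder_comp h) rfl rfl, ite_and]

theorem push_cylInd_of_ne {l m : P} (h : Λ.s l ≠ Λ.r m) : push (Λ := Λ) l (cylInd m) = 0 := by
  classical
  ext x
  rw [push_apply]
  split_ifs with hx
  · rw [cylInd_apply, if_neg]
    · rfl
    · intro hm
      refine h ((InfPath.s_eq_of_pre hx).trans ?_)
      rw [← InfPath.r_pre _ (Λ.d m), mem_cylinder.1 hm]
  · rfl

variable [Fintype V] (hΛ : Λ.RowFiniteNoSources)
include hΛ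

/-- A path in the cylinder set `Z(l)`. -/
noncomputable def RowFiniteNoSources.point (l : P) : Λ.InfPath := (cylinder_nonempty hΛ l).some

omit [Fintype V] in
theorem RowFiniteNoSources.pre_point {l : P} {n : Fin k → ℕ} (h : Λ.d l = n) :
    (hΛ.point l).pre n = l :=
  (mem_cylinder_of_d h).1 (cylinder_nonempty hΛ l).some_mem

/-- At `x` only the summand of the initial segment of `x` of degree `N` survives, and `g` takes the
same value at the chosen point of that cylinder as at `x`. -/
theorem eq_sum_cylInd {g : C(Λ.InfPath, ℤ)} {N : Fin k → ℕ}
    (hN : ∀ x y : Λ.InfPath, x.pre N = y.pre N → g x = g y) :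
    g = ∑ v, ∑ l ∈ hΛ.paths v N, g (hΛ.point l) • cylInd l := by
  classical
  ext x
  simp only [ContinuousMap.coe_sum, Finset.sum_apply, ContinuousMap.coe_smul, Pi.smul_apply]
  have hx : x.pre N ∈ hΛ.paths (x.vert 0) N := (hΛ.mem_paths).2 ⟨x.r_pre N, x.d_pre N⟩
  have h0 : ∀ v, ∀ l ∈ hΛ.paths v N, l ≠ x.pre N → g (hΛ.point l) • cylInd l x = 0 :=
    fun v l hl hne => by
      rw [cylInd_apply_of_d ((hΛ.mem_paths).1 hl).2, if_neg hne.symm, smul_zero]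
  rw [Finset.sum_eq_single (x.vert 0) (fun v _ hv => Finset.sum_eq_zero fun l hl =>
      h0 v l hl fun e => hv ?_) (fun h => (h (Finset.mem_univ _)).elim),
    Finset.sum_eq_single (x.pre N) (h0 _) (fun h => (h hx).elim),
    cylInd_apply_of_d (x.d_pre N), if_pos rfl, smul_eq_mul, mul_one]
  · exact hN _ _ (hΛ.pre_point (x.d_pre N)).symm
  · rw [← ((hΛ.mem_paths).1 hl).1, e, x.r_pre]

theorem continuousHom_ext {M : Type*} [AddCommGroup M] {F F' : C(Λ.InfPath, ℤ) →+ M}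
    (h : ∀ l, F (cylInd l) = F' (cylInd l)) : F = F' := by
  ext g
  obtain ⟨N, hN⟩ := exists_pre_const hΛ g
  rw [eq_sum_cylInd hΛ hN]
  simp only [map_sum, map_zsmul, h]

/-! ## The class of a function in the dimension group -/

variable [DecidableEq V]

/-- The sum `∑ g(l) [ε_{s(l)}, n + N]` over all paths `l` of degree `N`. -/
noncomputable def dimSum (N : Fin k → ℕ) (n : Fin k → ℤ) (g : C(Λ.InfPath, ℤ)) : Λ.DimensionGroup :=
  ∑ v, ∑ l ∈ hΛ.paths v N, g (hΛ.point l) • Λ.dimClass (n + natVec N) (Pi.single (Λ.s l) 1)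

theorem sum_dimClass_source (v : V) (n : Fin k → ℤ) (p : Fin k → ℕ) :
    ∑ l ∈ hΛ.paths v p, Λ.dimClass (n + natVec p) (Pi.single (Λ.s l) 1) =
      Λ.dimClass n (Pi.single v 1) := by
  rw [sum_paths_source hΛ v p fun w => Λ.dimClass (n + natVec p) (Pi.single w 1),
    sum_vertexMatrix_smul_dimClass]

/-- Each `[ε_{s(a)}, n + N]` splits over the paths `b` of degree `M` from `s(a)`, and `g` has the
same value on `Z(ab)` as on `Z(a)`. Hence the sum does not depend on the degree at which `g` is
sampled. -/
theorem dimSum_add_degree {g : C(Λ.InfPath, ℤ)} {N : Fin k → ℕ}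
    (hN : ∀ x y : Λ.InfPath, x.pre N = y.pre N → g x = g y) (M : Fin k → ℕ) (n : Fin k → ℤ) :
    dimSum hΛ (N + M) n g = dimSum hΛ N n g := by
  refine Finset.sum_congr rfl fun v _ => ?_
  rw [sum_paths_add]
  refine Finset.sum_congr rfl fun a ha => ?_
  rw [← sum_dimClass_source hΛ (Λ.s a) _ M, Finset.smul_sum]
  refine Finset.sum_congr rfl fun b hb => ?_
  have had := ((hΛ.mem_paths).1 ha).2
  have hbd := ((hΛ.mem_paths).1 hb).2
  have h := ((hΛ.mem_paths).1 hb).1.symm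
  rw [Λ.mul_eq h, Λ.s_comp, map_add, add_assoc]
  congr 1
  refine hN _ _ ?_
  rw [hΛ.pre_point had]
  have hd : Λ.d (Λ.comp a b h) = N + M := by rw [Λ.d_comp, had, hbd]
  have hp : Λ.IsPrefix a ((hΛ.point (Λ.comp a b h)).pre (N + M)) := by
    rw [hΛ.pre_point hd]
    exact IsPrefix.comp _ _ _
  have := InfPath.pre_eq_of_isPrefix hp (had.trans_le le_self_add)
  rwa [had] at this

theorem dimSum_eq {g : C(Λ.InfPath, ℤ)} {N N' : Fin k → ℕ}
    (hN : ∀ x y : Λ.InfPath, x.pre N = y.pre N → g x = g y)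
    (hN' : ∀ x y : Λ.InfPath, x.pre N' = y.pre N' → g x = g y) (n : Fin k → ℤ) :
    dimSum hΛ N n g = dimSum hΛ N' n g := by
  rw [← dimSum_add_degree hΛ hN N', ← dimSum_add_degree hΛ hN' N, add_comm]

/-- The homomorphism from functions on `Λ^∞` to the dimension group that maps the indicator
function of `Z(l)` to `[ε_{s(l)}, n + d(l)]`. -/
noncomputable def dimIntegral (n : Fin k → ℤ) : C(Λ.InfPath, ℤ) →+ Λ.DimensionGroup :=
  AddMonoidHom.mk' (fun g => dimSum hΛ (exists_pre_const hΛ g).choose n g) fun f g => by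
    have hf := (exists_pre_const hΛ f).choose_spec
    have hg := (exists_pre_const hΛ g).choose_spec
    have hfg := (exists_pre_const hΛ (f + g)).choose_spec
    set N := (exists_pre_const hΛ f).choose
    set N' := (exists_pre_const hΛ g).choose
    have hf' : ∀ x y : Λ.InfPath, x.pre (N ⊔ N') = y.pre (N ⊔ N') → f x = f y := fun x y h =>
      hf x y (InfPath.pre_eq_of_le le_sup_left h)
    have hg' : ∀ x y : Λ.InfPath, x.pre (N ⊔ N') = y.pre (N ⊔ N') → g x = g y := fun x y h =>
      hg x y (InfPath.pre_eq_of_le le_sup_right h)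
    have hfg' : ∀ x y : Λ.InfPath, x.pre (N ⊔ N') = y.pre (N ⊔ N') → (f + g) x = (f + g) y :=
      fun x y h => by rw [ContinuousMap.add_apply, ContinuousMap.add_apply, hf' x y h, hg' x y h]
    rw [dimSum_eq hΛ hf hf', dimSum_eq hΛ hg hg', dimSum_eq hΛ hfg hfg']
    simp only [dimSum, ContinuousMap.add_apply, add_smul, Finset.sum_add_distrib]

theorem dimIntegral_eq {g : C(Λ.InfPath, ℤ)} {N : Fin k → ℕ}
    (hN : ∀ x y : Λ.InfPath, x.pre N = y.pre N → g x = g y) (n : Fin k → ℤ) :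
    dimIntegral hΛ n g = dimSum hΛ N n g :=
  dimSum_eq hΛ (exists_pre_const hΛ g).choose_spec hN n

theorem dimIntegral_cylInd (n : Fin k → ℤ) (l : P) :
    dimIntegral hΛ n (cylInd l) = Λ.dimClass (n + natVec (Λ.d l)) (Pi.single (Λ.s l) 1) := by
  classical
  rw [dimIntegral_eq hΛ (N := Λ.d l) fun x y h => by
    rw [cylInd_apply_of_d rfl, cylInd_apply_of_d rfl, h]]
  have h0 : ∀ v, ∀ a ∈ hΛ.paths v (Λ.d l), a ≠ l → cylInd l (hΛ.point a) •
      Λ.dimClass (n + natVec (Λ.d l)) (Pi.single (Λ.s a) 1) = 0 := fun v a ha hne => by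
    rw [cylInd_apply_of_d rfl, hΛ.pre_point ((hΛ.mem_paths).1 ha).2, if_neg hne, zero_smul]
  rw [dimSum, Finset.sum_eq_single (Λ.r l) (fun v _ hv => Finset.sum_eq_zero fun a ha =>
      h0 v a ha fun e => hv ?_) (fun h => (h (Finset.mem_univ _)).elim),
    Finset.sum_eq_single l (h0 _) (fun h => (h ((hΛ.mem_paths).2 ⟨rfl, rfl⟩)).elim),
    cylInd_apply_of_d rfl, hΛ.pre_point rfl, if_pos rfl, one_smul]
  rw [← ((hΛ.mem_paths).1 ha).1, e]

/-- On indicators of cylinders both sides are `[ε_{s(m)}, n + d(l) + d(m)]` or zero. The right side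
depends on `l` only through `s(l)` and `n + d(l)`, which is why boundaries integrate to zero. -/
theorem dimIntegral_push (n : Fin k → ℤ) (l : P) (g : C(Λ.InfPath, ℤ)) :
    dimIntegral hΛ n (push l g) =
      dimIntegral hΛ (n + natVec (Λ.d l)) (push (Λ.one (Λ.s l)) g) := by
  refine DFunLike.congr_fun (f := (dimIntegral hΛ n).comp (push l))
    (g := (dimIntegral hΛ (n + natVec (Λ.d l))).comp (push (Λ.one (Λ.s l))))
    (continuousHom_ext hΛ fun m => ?_) g
  rw [AddMonoidHom.comp_apply, AddMonoidHom.comp_apply]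
  by_cases h : Λ.s l = Λ.r m
  · have h' : Λ.s (Λ.one (Λ.s l)) = Λ.r m := (Λ.s_one _).trans h
    rw [push_cylInd h, push_cylInd h', dimIntegral_cylInd, dimIntegral_cylInd, Λ.s_comp, Λ.s_comp,
      Λ.d_comp, Λ.d_comp, Λ.d_one, zero_add, map_add, add_assoc]
  · rw [push_cylInd_of_ne h, push_cylInd_of_ne (by rwa [Λ.s_one]), map_zero, map_zero]

theorem dimIntegral_mem (n : Fin k → ℤ) {g : C(Λ.InfPath, ℤ)} (hg : ∀ x, 0 ≤ g x) :
    dimIntegral hΛ n g ∈ Λ.dimPositive := by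
  refine Λ.dimCone.sum_mem fun v _ => Λ.dimCone.sum_mem fun l _ => ?_
  obtain ⟨c, hc⟩ := Int.eq_ofNat_of_zero_le (hg (hΛ.point l))
  rw [hc, natCast_zsmul]
  exact Λ.dimCone.nsmul_mem (single_mem_dimPositive _ _) c

end Functions

end KGraph

theorem finsum_mem_eq_of_forall_ne {α M : Type*} [AddCommMonoid M] {S : Set α} {f : α → M} {a : α}
    (ha : a ∈ S) (h : ∀ b ∈ S, f b ≠ 0 → b = a) : ∑ᶠ b ∈ S, f b = f a := by
  rw [finsum_mem_def, finsum_eq_single _ a, Set.indicator_of_mem ha]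
  intro b hb
  by_contra hne
  have hS := Set.mem_of_indicator_ne_zero hne
  rw [Set.indicator_of_mem hS] at hne
  exact hb (h b hS hne)

namespace KGraph

/-! ## Boundaries in the skew product of the infinite path groupoid -/

section Boundary

variable {k : ℕ} {V P : Type*} {Λ : KGraph k V P}

variable (Λ) in
/-- The skew product of the infinite path groupoid by its degree cocycle. -/
abbrev skewGroupoid : ArrowGroupoid (Λ.InfPath × (Fin k → ℤ)) (Λ.PathArrow × (Fin k → ℤ)) :=
  Λ.pathGroupoid.skewProduct Λ.isCocycle_deg

theorem skewGroupoid_s (g : Λ.PathArrow × (Fin k → ℤ)) :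
    Λ.skewGroupoid.s g = (g.1.snd, g.2 + g.1.deg) := rfl

theorem skewGroupoid_r (g : Λ.PathArrow × (Fin k → ℤ)) :
    Λ.skewGroupoid.r g = (g.1.fst, g.2) := rfl

variable {l m : P} (hlm : Λ.s l = Λ.s m)

open Classical in
/-- The function `z ↦ f(l z, d(l) - d(m), m z)` at level `n`, extended by zero. -/
noncomputable def arrowPullback (f : C(Λ.PathArrow × (Fin k → ℤ), ℤ)) (n : Fin k → ℤ) :
    C(Λ.InfPath, ℤ) where
  toFun z := if h : Λ.s l = z.vert 0 then f (arrow l m z h (hlm ▸ h), n) else 0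
  continuous_toFun := by
    refine ⟨fun U hU => isOpen_infPath_iff.2 fun z hz => ?_⟩
    have hv : ∀ (y : Λ.InfPath) N, y.pre N = z.pre N → y.vert 0 = z.vert 0 := fun y N e => by
      rw [← y.r_pre N, e, z.r_pre]
    by_cases h : Λ.s l = z.vert 0
    · rw [Set.mem_preimage, dif_pos h] at hz
      have hU' : IsOpen {g : Λ.PathArrow | f (g, n) ∈ U} :=
        hU.preimage (f.continuous.comp (continuous_id.prodMk continuous_const))
      obtain ⟨N, hN⟩ := exists_arrow_near h (hlm ▸ h) hU' hz
      refine ⟨N, fun y hy => ?_⟩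
      have h' : Λ.s l = y.vert 0 := h.trans (hv y N hy).symm
      rw [Set.mem_preimage, dif_pos h']
      exact hN y h' _ hy
    · rw [Set.mem_preimage, dif_neg h] at hz
      refine ⟨0, fun y hy => ?_⟩
      rw [Set.mem_preimage, dif_neg fun h' => h (h'.trans (hv y 0 hy))]
      exact hz

theorem arrowPullback_apply (f : C(Λ.PathArrow × (Fin k → ℤ), ℤ)) (n : Fin k → ℤ) {z : Λ.InfPath}
    (h : Λ.s l = z.vert 0) :
    arrowPullback hlm f n z = f (arrow l m z h (hlm ▸ h), n) := dif_pos h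

variable [CompactSpace Λ.InfPath] {f : C(Λ.PathArrow × (Fin k → ℤ), ℤ)} {n : Fin k → ℤ}

omit [CompactSpace Λ.InfPath] in
include hlm in
-- An arrow of `Z(l, m)` is determined by its source `mz`, since `z` is recovered by shifting by
-- `d(m)`.
theorem eq_of_mem_support_of_s_eq (hf : ∀ g, f g ≠ 0 → g.1 ∈ Λ.basicSet l m ∧ g.2 = n)
    {g g' : Λ.PathArrow × (Fin k → ℤ)} (hg : f g ≠ 0) (hg' : f g' ≠ 0)
    (e : Λ.skewGroupoid.s g = Λ.skewGroupoid.s g') : g = g' := by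
  have e1 : g.1.snd = g'.1.snd := congrArg Prod.fst e
  have hb := (hf g hg).1
  have hb' := (hf g' hg').1
  have hz : Λ.s l = (g.1.fst.shift (Λ.d l)).vert 0 := InfPath.s_eq_of_pre hb.1
  refine Prod.ext ?_ ((hf g hg).2.trans (hf g' hg').2.symm)
  refine (eq_arrow_of_shift_fst hb rfl hz (hlm ▸ hz)).trans
    (eq_arrow_of_shift_fst hb' ?_ hz (hlm ▸ hz)).symm
  rw [hb.2.2.2, hb'.2.2.2, e1]

omit [CompactSpace Λ.InfPath] in
include hlm in
theorem eq_of_mem_support_of_r_eq (hf : ∀ g, f g ≠ 0 → g.1 ∈ Λ.basicSet l m ∧ g.2 = n)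
    {g g' : Λ.PathArrow × (Fin k → ℤ)} (hg : f g ≠ 0) (hg' : f g' ≠ 0)
    (e : Λ.skewGroupoid.r g = Λ.skewGroupoid.r g') : g = g' := by
  have e1 : g.1.fst = g'.1.fst := congrArg Prod.fst e
  have hb := (hf g hg).1
  have hb' := (hf g' hg').1
  have hz : Λ.s l = (g.1.fst.shift (Λ.d l)).vert 0 := InfPath.s_eq_of_pre hb.1
  refine Prod.ext ?_ ((hf g hg).2.trans (hf g' hg').2.symm)
  refine (eq_arrow_of_shift_fst hb rfl hz (hlm ▸ hz)).trans
    (eq_arrow_of_shift_fst hb' ?_ hz (hlm ▸ hz)).symm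
  rw [e1]

/-- The sum over a fibre of `s` has at most one nonzero term: the source `mz` determines the arrow,
and at level `n` that source lies at level `n + d(l) - d(m)`. -/
theorem sum_s_eq (hf : ∀ g, f g ≠ 0 → g.1 ∈ Λ.basicSet l m ∧ g.2 = n)
    (x : Λ.InfPath × (Fin k → ℤ)) : ∑ᶠ g ∈ {g | Λ.skewGroupoid.s g = x}, f g =
      level (n + (natVec (Λ.d l) - natVec (Λ.d m))) (push m (arrowPullback hlm f n)) x := by
  classical
  rw [level_apply, push_apply, ← ite_and]
  split_ifs with h
  · have hz := InfPath.s_eq_of_pre h.2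
    have hl := hlm.trans hz
    have hg : Λ.skewGroupoid.s (arrow l m _ hl hz, n) = x := Prod.ext (InfPath.concat_shift h.2) h.1.symm
    rw [arrowPullback_apply hlm f n hl, finsum_mem_eq_of_forall_ne (a := (arrow l m _ hl hz, n)) hg]
    intro g hgx hg0
    refine Prod.ext (eq_arrow_of_shift_fst (hf g hg0).1 ?_ _ _) (hf g hg0).2
    rw [(hf g hg0).1.2.2.2, ← show g.1.snd = x.1 from congrArg Prod.fst hgx]
  · refine finsum_mem_eq_zero_of_forall_eq_zero fun g hg => ?_
    by_contra hg0
    obtain ⟨hb, hn⟩ := hf g hg0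
    refine h ⟨?_, ?_⟩
    · rw [← show Λ.skewGroupoid.s g = x from hg, skewGroupoid_s, hn]
      exact congrArg (n + ·) hb.2.2.1
    · rw [← show Λ.skewGroupoid.s g = x from hg]
      exact hb.2.1

theorem sum_r_eq (hf : ∀ g, f g ≠ 0 → g.1 ∈ Λ.basicSet l m ∧ g.2 = n)
    (x : Λ.InfPath × (Fin k → ℤ)) : ∑ᶠ g ∈ {g | Λ.skewGroupoid.r g = x}, f g =
      level n (push l (arrowPullback hlm f n)) x := by
  classical
  rw [level_apply, push_apply, ← ite_and]
  split_ifs with h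
  · have hl := InfPath.s_eq_of_pre h.2
    have hz := hlm.symm.trans hl
    have hg : Λ.skewGroupoid.r (arrow l m _ hl hz, n) = x := Prod.ext (InfPath.concat_shift h.2) h.1.symm
    rw [arrowPullback_apply hlm f n hl, finsum_mem_eq_of_forall_ne (a := (arrow l m _ hl hz, n)) hg]
    intro g hgx hg0
    refine Prod.ext (eq_arrow_of_shift_fst (hf g hg0).1 ?_ _ _) (hf g hg0).2
    rw [← show g.1.fst = x.1 from congrArg Prod.fst hgx]
  · refine finsum_mem_eq_zero_of_forall_eq_zero fun g hg => ?_
    by_contra hg0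
    obtain ⟨hb, hn⟩ := hf g hg0
    refine h ⟨?_, ?_⟩
    · rw [← show Λ.skewGroupoid.r g = x from hg, skewGroupoid_r, hn]
    · rw [← show Λ.skewGroupoid.r g = x from hg]
      exact hb.1

/-- The indicator function of a basic set at level `n`. -/
theorem exists_indicator_basicSet (hlm : Λ.s l = Λ.s m) (n : Fin k → ℤ) :
    ∃ f : C_c(Λ.PathArrow × (Fin k → ℤ), ℤ), ⇑f = (Λ.basicSet l m ×ˢ {n}).indicator 1 := by
  have hc := isClopen_basicSet hlm
  have hc' : IsClopen (Λ.basicSet l m ×ˢ {n}) := hc.prod (isClopen_discrete {n})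
  refine ⟨⟨⟨(Λ.basicSet l m ×ˢ {n}).indicator 1, ?_⟩, ?_⟩, rfl⟩
  · exact continuous_one.indicator fun a ha => by rw [hc'.frontier_eq] at ha; exact ha.elim
  · exact HasCompactSupport.intro' ((isCompact_basicSet hlm).prod isCompact_singleton)
      hc'.isClosed fun g hg => Set.indicator_of_notMem hg _

/-- The indicator of `Z(l, s(l)) × {n}` has the difference of the two functions as its boundary:
ranges fill `Z(l)` at level `n`, sources fill `Z(s(l))` at level `n + d(l)`. -/
theorem mk_level_cylInd (l : P) (n : Fin k → ℤ) :
    ArrowGroupoid.H0.mk Λ.skewGroupoid (level n (cylInd l)) =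
      ArrowGroupoid.H0.mk _ (level (n + natVec (Λ.d l)) (cylInd (Λ.one (Λ.s l)))) := by
  have hlm : Λ.s l = Λ.s (Λ.one (Λ.s l)) := (Λ.s_one _).symm
  obtain ⟨f, hf⟩ := exists_indicator_basicSet hlm n
  have hf' : ∀ g, f.toContinuousMap g ≠ 0 →
      g.1 ∈ Λ.basicSet l (Λ.one (Λ.s l)) ∧ g.2 = n := fun g hg => by
    have hg : f g ≠ 0 := hg
    rw [hf] at hg
    have hm := Set.mem_of_indicator_ne_zero hg
    exact ⟨hm.1, hm.2⟩
  have hp : ∀ a, Λ.s a = Λ.s l → push a (arrowPullback hlm f.toContinuousMap n) =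
      cylInd (Λ := Λ) a := fun a ha => by
    classical
    ext x
    rw [push_apply, cylInd_apply]
    refine if_ctx_congr Iff.rfl (fun hx => ?_) fun _ => rfl
    have hz : Λ.s l = _ := ha.symm.trans (InfPath.s_eq_of_pre hx)
    rw [arrowPullback_apply hlm _ n hz]
    show f _ = 1
    rw [hf]
    exact Set.indicator_of_mem (Set.mk_mem_prod (arrow_mem_basicSet _ _ _ _ _)
      (Set.mem_singleton n)) _
  refine QuotientAddGroup.eq.2 ⟨f, fun x => ?_, fun x => ?_, fun x => ?_⟩
  · refine Set.Subsingleton.finite fun g hg g' hg' => ?_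
    exact eq_of_mem_support_of_s_eq hlm hf' hg.2 hg'.2 (hg.1.trans hg'.1.symm)
  · refine Set.Subsingleton.finite fun g hg g' hg' => ?_
    exact eq_of_mem_support_of_r_eq hlm hf' hg.2 hg'.2 (hg.1.trans hg'.1.symm)
  · have h1 := sum_s_eq hlm hf' x
    have h2 := sum_r_eq hlm hf' x
    rw [hp _ hlm.symm, Λ.d_one, map_zero, sub_zero] at h1
    rw [hp _ rfl] at h2
    refine Eq.trans ?_ (congrArg₂ (· - ·) h1 h2).symm
    show -(level n (cylInd l) x) + level (n + natVec (Λ.d l)) (cylInd (Λ.one (Λ.s l))) x = _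
    ring

variable [Fintype V] [DecidableEq V] (hΛ : Λ.RowFiniteNoSources)

/-- The homomorphism from functions on `Λ^∞ × ℤ^k` to the dimension group that maps the indicator
function of `Z(l) × {n}` to `[ε_{s(l)}, n + d(l)]`. -/
noncomputable def dimIntegralSkew : C_c(Λ.InfPath × (Fin k → ℤ), ℤ) →+ Λ.DimensionGroup :=
  levelLift (dimIntegral hΛ)

theorem dimIntegralSkew_level (n : Fin k → ℤ) (g : C(Λ.InfPath, ℤ)) :
    dimIntegralSkew hΛ (level n g) = dimIntegral hΛ n g := levelLift_level _ _ _

/-- Induction on the number of basic sets covering the support. Clopenness of a basic set allows the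
part of `f` on it to be split off as a continuous function. Fibrewise finiteness replaces compact
support, as it passes to both parts. -/
theorem dimIntegralSkew_boundary_of_support_subset (t : Finset (P × P × (Fin k → ℤ)))
    (ht : ∀ b ∈ t, Λ.s b.1 = Λ.s b.2.1) :
    ∀ f : C(Λ.PathArrow × (Fin k → ℤ), ℤ),
      (∀ g, f g ≠ 0 → ∃ b ∈ t, g.1 ∈ Λ.basicSet b.1 b.2.1 ∧ g.2 = b.2.2) →
      (∀ x, {g | Λ.skewGroupoid.s g = x ∧ f g ≠ 0}.Finite) →
      (∀ x, {g | Λ.skewGroupoid.r g = x ∧ f g ≠ 0}.Finite) →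
      ∀ a : C_c(Λ.InfPath × (Fin k → ℤ), ℤ),
        (∀ x, a x = (∑ᶠ g ∈ {g | Λ.skewGroupoid.s g = x}, f g) -
          ∑ᶠ g ∈ {g | Λ.skewGroupoid.r g = x}, f g) → dimIntegralSkew hΛ a = 0 := by
  classical
  induction t using Finset.induction_on with
  | empty =>
    intro f hf _ _ a ha
    have h0 : ∀ g, f g = 0 := fun g => by
      by_contra h
      obtain ⟨b, hb, -⟩ := hf g h
      exact absurd hb (Finset.notMem_empty b)
    have : a = 0 := CompactlySupportedContinuousMap.ext fun x => by
      rw [ha]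
      simp [h0]
    rw [this, map_zero]
  | insert b t _ ih =>
    intro f hf hs hr a ha
    obtain ⟨l, m, n⟩ := b
    have hlm : Λ.s l = Λ.s m := ht _ (Finset.mem_insert_self _ _)
    have hB : IsClopen (Λ.basicSet l m ×ˢ {n}) :=
      (isClopen_basicSet hlm).prod (isClopen_discrete {n})
    let f₁ : C(Λ.PathArrow × (Fin k → ℤ), ℤ) := ⟨(Λ.basicSet l m ×ˢ {n}).indicator f,
      f.continuous.indicator fun a ha => by rw [hB.frontier_eq] at ha; exact ha.elim⟩
    let f₂ : C(Λ.PathArrow × (Fin k → ℤ), ℤ) := ⟨(Λ.basicSet l m ×ˢ {n})ᶜ.indicator f,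
      f.continuous.indicator fun a ha => by rw [hB.compl.frontier_eq] at ha; exact ha.elim⟩
    have hadd : ∀ g, f g = f₁ g + f₂ g := fun g =>
      (congrFun (Set.indicator_self_add_compl (Λ.basicSet l m ×ˢ {n}) f) g).symm
    have h1 : ∀ g, f₁ g ≠ 0 → g.1 ∈ Λ.basicSet l m ∧ g.2 = n := fun g hg => by
      have hm : g ∈ Λ.basicSet l m ×ˢ {n} := Set.mem_of_indicator_ne_zero hg
      exact ⟨hm.1, hm.2⟩
    have h1' : ∀ g, f₁ g ≠ 0 → f g ≠ 0 := fun g hg h0 => hg (by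
      show (Λ.basicSet l m ×ˢ {n}).indicator f g = 0
      rw [Set.indicator_apply, h0, ite_self])
    have h2' : ∀ g, f₂ g ≠ 0 → f g ≠ 0 := fun g hg h0 => hg (by
      show (Λ.basicSet l m ×ˢ {n})ᶜ.indicator f g = 0
      rw [Set.indicator_apply, h0, ite_self])
    have hs1 : ∀ x, {g | Λ.skewGroupoid.s g = x ∧ f₁ g ≠ 0}.Finite := fun x =>
      (hs x).subset fun g hg => ⟨hg.1, h1' g hg.2⟩
    have hr1 : ∀ x, {g | Λ.skewGroupoid.r g = x ∧ f₁ g ≠ 0}.Finite := fun x =>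
      (hr x).subset fun g hg => ⟨hg.1, h1' g hg.2⟩
    have hs2 : ∀ x, {g | Λ.skewGroupoid.s g = x ∧ f₂ g ≠ 0}.Finite := fun x =>
      (hs x).subset fun g hg => ⟨hg.1, h2' g hg.2⟩
    have hr2 : ∀ x, {g | Λ.skewGroupoid.r g = x ∧ f₂ g ≠ 0}.Finite := fun x =>
      (hr x).subset fun g hg => ⟨hg.1, h2' g hg.2⟩
    -- This is the boundary of `f₁` in closed form. By `dimIntegral_push` both terms have the
    -- integral of the pullback restricted to `Z(s(l)) = Z(s(m))`, at position `n + d(l)`.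
    set a₁ := level (n + (natVec (Λ.d l) - natVec (Λ.d m))) (push m (arrowPullback hlm f₁ n)) -
      level n (push l (arrowPullback hlm f₁ n)) with ha₁
    have hz1 : dimIntegralSkew hΛ a₁ = 0 := by
      rw [ha₁, map_sub, dimIntegralSkew_level, dimIntegralSkew_level, dimIntegral_push,
        dimIntegral_push hΛ n l, hlm, add_assoc, sub_add_cancel, sub_self]
    have hz2 : dimIntegralSkew hΛ (a - a₁) = 0 := by
      refine ih (fun b hb => ht b (Finset.mem_insert_of_mem hb)) f₂ ?_ hs2 hr2 _ fun x => ?_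
      · intro g hg
        obtain ⟨b, hb, hgb⟩ := hf g (h2' g hg)
        rcases Finset.mem_insert.1 hb with rfl | hb
        · exact (Set.mem_of_indicator_ne_zero hg hgb).elim
        · exact ⟨b, hb, hgb⟩
      · have e1 : a₁ x = (∑ᶠ g ∈ {g | Λ.skewGroupoid.s g = x}, f₁ g) -
            ∑ᶠ g ∈ {g | Λ.skewGroupoid.r g = x}, f₁ g := by
          rw [sum_s_eq hlm h1, sum_r_eq hlm h1]
          rfl
        have e2 := finsum_mem_add_distrib' (s := {g | Λ.skewGroupoid.s g = x}) (hs1 x) (hs2 x)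
        have e3 := finsum_mem_add_distrib' (s := {g | Λ.skewGroupoid.r g = x}) (hr1 x) (hr2 x)
        simp only [← hadd] at e2 e3
        rw [CompactlySupportedContinuousMap.sub_apply, ha, e1, e2, e3]
        ring
    rw [← sub_add_cancel a a₁, map_add, hz2, hz1, add_zero]

theorem dimIntegralSkew_boundary {a : C_c(Λ.InfPath × (Fin k → ℤ), ℤ)}
    (ha : a ∈ Λ.skewGroupoid.boundaryRange) : dimIntegralSkew hΛ a = 0 := by
  obtain ⟨f, hs, hr, hf⟩ := ha
  let U : {b : P × P × (Fin k → ℤ) // Λ.s b.1 = Λ.s b.2.1} → Set (Λ.PathArrow × (Fin k → ℤ)) :=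
    fun b => Λ.basicSet b.1.1 b.1.2.1 ×ˢ {b.1.2.2}
  obtain ⟨t, ht⟩ := f.hasCompactSupport.isCompact.elim_finite_subcover U
    (fun b => (isOpen_basicSet b.2).prod (isOpen_discrete _)) fun g _ => by
      obtain ⟨l, m, h, hg⟩ := exists_mem_basicSet g.1
      exact Set.mem_iUnion.2 ⟨⟨(l, m, g.2), h⟩, hg, rfl⟩
  classical
  refine dimIntegralSkew_boundary_of_support_subset hΛ (t.image Subtype.val) ?_
    f.toContinuousMap ?_ hs hr a hf
  · intro b hb
    obtain ⟨b, -, rfl⟩ := Finset.mem_image.1 hb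
    exact b.2
  · intro g hg
    obtain ⟨b, hb, h⟩ := Set.mem_iUnion₂.1 (ht (subset_tsupport _ hg))
    exact ⟨b.1, Finset.mem_image_of_mem _ hb, h⟩

end Boundary

end KGraph

namespace KGraph

/-! ## The dimension group as graded homology -/

section Kappa

variable {k : ℕ} {V P : Type*} {Λ : KGraph k V P} [CompactSpace Λ.InfPath]

variable (Λ) in
/-- The class `[1_{Z(v) × {n}}]`. -/
noncomputable def vertexClass (v : V) (n : Fin k → ℤ) : Λ.GrH0 :=
  ArrowGroupoid.H0.mk Λ.skewGroupoid (level n (cylInd (Λ.one v)))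

omit [CompactSpace Λ.InfPath] in
theorem cylInd_one_eq_sum (hΛ : Λ.RowFiniteNoSources) (v : V) (p : Fin k → ℕ) :
    cylInd (Λ := Λ) (Λ.one v) = ∑ l ∈ hΛ.paths v p, cylInd l := by
  classical
  ext x
  rw [ContinuousMap.coe_sum, Finset.sum_apply, Finset.sum_congr rfl fun l hl =>
    cylInd_apply_of_d ((hΛ.mem_paths).1 hl).2 x, Finset.sum_ite_eq, cylInd_apply]
  refine if_congr ?_ rfl rfl
  rw [cylinder_one, hΛ.mem_paths, x.r_pre, x.d_pre]
  exact (and_iff_left rfl).symm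

theorem isGrClass_level {A : Set Λ.InfPath} {n : Fin k → ℤ} {g : C(Λ.InfPath, ℤ)}
    (hg : ⇑g = A.indicator 1) (h : Λ.GrH0) :
    Λ.IsGrClass A n h ↔ h = ArrowGroupoid.H0.mk Λ.skewGroupoid (level n g) := by
  classical
  have e : ⇑(level n g) = (A ×ˢ {n}).indicator 1 := by
    ext ⟨x, m⟩
    simp only [level_apply, hg, Set.indicator_apply, Set.mem_prod, Set.mem_singleton_iff,
      Pi.one_apply, ← ite_and]
    exact if_congr and_comm rfl rfl
  constructor
  · rintro ⟨f, hf, rfl⟩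
    rw [DFunLike.coe_injective (hf.trans e.symm)]
  · rintro rfl
    exact ⟨_, e, rfl⟩

theorem isGrClass_vertexClass (v : V) (n : Fin k → ℤ) :
    Λ.IsGrClass {x | x.vert 0 = v} n (Λ.vertexClass v n) := by
  classical
  refine (isGrClass_level (g := cylInd (Λ.one v)) ?_ _).2 rfl
  ext x
  rw [cylInd_apply, Set.indicator_apply, cylinder_one]
  rfl

theorem translate_level (q n : Fin k → ℤ) (g : C(Λ.InfPath, ℤ)) :
    ArrowGroupoid.translate q (level n g) = level (n + q) g := by
  ext x
  rw [ArrowGroupoid.translate_apply, level_apply, level_apply]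
  refine if_congr ?_ rfl rfl
  show -q + x.2 = n ↔ x.2 = n + q
  rw [neg_add_eq_iff_eq_add, add_comm]

variable [Fintype V]

/-- `Z(v)` is the disjoint union of the `Z(l)` with `l ∈ vΛ^p`, and each of these is homologous to
the cylinder of `s(l)` moved by `p`. This is the relation that `dimLift` requires. -/
theorem vertexClass_eq_sum (hΛ : Λ.RowFiniteNoSources) (v : V) (n : Fin k → ℤ) (p : Fin k → ℕ) :
    Λ.vertexClass v n = ∑ w, Λ.vertexMatrix p v w • Λ.vertexClass w (n + natVec p) := by
  rw [← sum_paths_source hΛ v p fun w => Λ.vertexClass w (n + natVec p), vertexClass,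
    cylInd_one_eq_sum hΛ v p, map_sum, map_sum]
  refine Finset.sum_congr rfl fun l hl => ?_
  rw [mk_level_cylInd, ((hΛ.mem_paths).1 hl).2]
  rfl

variable [DecidableEq V] (hΛ : Λ.RowFiniteNoSources)

/-- The homomorphism from graded homology to the dimension group with
`[1_{Z(l) × {n}}] ↦ [ε_{s(l)}, n + d(l)]`. -/
noncomputable def grToDim : Λ.GrH0 →+ Λ.DimensionGroup :=
  QuotientAddGroup.lift Λ.skewGroupoid.boundaryRange (dimIntegralSkew hΛ)
    fun _ ha => dimIntegralSkew_boundary hΛ ha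

theorem grToDim_mk (f : C_c(Λ.InfPath × (Fin k → ℤ), ℤ)) :
    grToDim hΛ (ArrowGroupoid.H0.mk Λ.skewGroupoid f) = dimIntegralSkew hΛ f := rfl

/-- The homomorphism from the dimension group to graded homology with
`[ε_v, n] ↦ [1_{Z(v) × {n}}]`. -/
noncomputable def dimToGr : Λ.DimensionGroup →+ Λ.GrH0 :=
  dimLift Λ.vertexClass (vertexClass_eq_sum hΛ)

theorem dimToGr_single (v : V) (n : Fin k → ℤ) :
    dimToGr hΛ (Λ.dimClass n (Pi.single v 1)) = Λ.vertexClass v n := dimLift_single _ _ _ _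

theorem grToDim_comp_dimToGr : (grToDim hΛ).comp (dimToGr hΛ) = AddMonoidHom.id _ :=
  dimHom_ext_single fun v n => by
    rw [AddMonoidHom.comp_apply, dimToGr_single, vertexClass, grToDim_mk, dimIntegralSkew_level,
      dimIntegral_cylInd, Λ.d_one, Λ.s_one, map_zero, add_zero]
    rfl

theorem dimToGr_comp_grToDim : (dimToGr hΛ).comp (grToDim hΛ) = AddMonoidHom.id _ := by
  have h : ((dimToGr hΛ).comp (grToDim hΛ)).comp (ArrowGroupoid.H0.mk Λ.skewGroupoid) =
      ArrowGroupoid.H0.mk Λ.skewGroupoid :=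
    compactlySupportedHom_ext fun n g => by
      refine DFunLike.congr_fun
        (f := (((dimToGr hΛ).comp (grToDim hΛ)).comp (ArrowGroupoid.H0.mk Λ.skewGroupoid)).comp
          (level n)) (g := (ArrowGroupoid.H0.mk Λ.skewGroupoid).comp (level n))
        (continuousHom_ext hΛ fun l => ?_) g
      simp only [AddMonoidHom.comp_apply]
      rw [grToDim_mk, dimIntegralSkew_level, dimIntegral_cylInd, dimToGr_single, mk_level_cylInd]
      rfl
  ext a
  obtain ⟨f, rfl⟩ := QuotientAddGroup.mk_surjective a
  exact DFunLike.congr_fun h f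

/-- The isomorphism `[ε_v, n] ↦ [1_{Z(v) × {n}}]`. -/
noncomputable def kappa : Λ.DimensionGroup ≃+ Λ.GrH0 :=
  (dimToGr hΛ).toAddEquiv (grToDim hΛ) (grToDim_comp_dimToGr hΛ) (dimToGr_comp_grToDim hΛ)

theorem kappa_single (v : V) (n : Fin k → ℤ) :
    kappa hΛ (Λ.dimClass n (Pi.single v 1)) = Λ.vertexClass v n := dimToGr_single hΛ v n

theorem kappa_symm_mk (f : C_c(Λ.InfPath × (Fin k → ℤ), ℤ)) :
    (kappa hΛ).symm (ArrowGroupoid.H0.mk Λ.skewGroupoid f) = dimIntegralSkew hΛ f := rfl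

theorem kappa_dimTranslate (q : Fin k → ℤ) (h : Λ.DimensionGroup) :
    kappa hΛ (Λ.dimTranslate q h) =
      ArrowGroupoid.GradedH0.shift _ Λ.isCocycle_deg q (kappa hΛ h) := by
  refine DFunLike.congr_fun (f := (kappa hΛ).toAddMonoidHom.comp (Λ.dimTranslate q))
    (g := (ArrowGroupoid.GradedH0.shift _ Λ.isCocycle_deg q).comp (kappa hΛ).toAddMonoidHom)
    (dimHom_ext_single fun v n => ?_) h
  show kappa hΛ _ = ArrowGroupoid.GradedH0.shift _ Λ.isCocycle_deg q (kappa hΛ _)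
  rw [dimTranslate_dimClass, kappa_single, kappa_single, vertexClass, vertexClass,
    ArrowGroupoid.GradedH0.shift_mk, translate_level]

/-- Nonnegative vectors give nonnegative combinations of indicators. Conversely, the integral of a
nonnegative function is a sum of nonnegative multiples of classes `[ε_w, m]`. -/
theorem kappa_image_dimPositive : kappa hΛ '' Λ.dimPositive = Λ.grPositive := by
  classical
  ext a
  constructor
  · rintro ⟨_, ⟨n, x, hx, rfl⟩, rfl⟩
    refine ⟨∑ v, x v • level n (cylInd (Λ.one v)), fun y => ?_, ?_⟩
    · rw [CompactlySupportedContinuousMap.coe_sum, Finset.sum_apply]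
      refine Finset.sum_nonneg fun v _ => ?_
      refine mul_nonneg (hx v) ?_
      rw [level_apply, cylInd_apply]
      split_ifs <;> norm_num
    · rw [dimClass_eq_sum]
      simp only [map_sum, map_zsmul, kappa_single]
      rfl
  · rintro ⟨f, hf, rfl⟩
    refine ⟨dimIntegralSkew hΛ f, ?_, ?_⟩
    · rw [eq_sum_level f, map_sum]
      refine Λ.dimCone.sum_mem fun n _ => ?_
      rw [dimIntegralSkew_level]
      exact dimIntegral_mem hΛ n fun x => hf (x, n)
    · rw [← kappa_symm_mk, AddEquiv.apply_symm_apply]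

/-- `Λ^∞` is the disjoint union of the finitely many `Z(v)`, so its indicator at level `0` is the
image of the all-ones vector. -/
theorem isGrClass_univ_iff (h : Λ.GrH0) :
    Λ.IsGrClass Set.univ 0 h ↔ h = kappa hΛ Λ.dimUnit := by
  classical
  rw [isGrClass_level (g := 1) (by ext; simp)]
  have e : kappa hΛ Λ.dimUnit = ArrowGroupoid.H0.mk Λ.skewGroupoid (level 0 1) := by
    have h1 : (1 : C(Λ.InfPath, ℤ)) = ∑ v, cylInd (Λ.one v) := by
      ext x
      rw [ContinuousMap.coe_sum, Finset.sum_apply]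
      simp only [cylInd_apply, cylinder_one, Set.mem_ofPred_eq]
      rw [Finset.sum_ite_eq, if_pos (Finset.mem_univ _)]
      rfl
    rw [dimUnit, dimClass_eq_sum, h1]
    simp only [map_sum, one_smul, kappa_single]
    rfl
  rw [e]

end Kappa

/-! ## Isomorphisms of dimension groups and of graded homology -/

section Correspondence

variable {k : ℕ} {V P W Q : Type*} {Λ : KGraph k V P} {Ω : KGraph k W Q}

theorem map_smul_of_map_shift (f : Λ.GrH0 →+ Ω.GrH0)
    (hf : ∀ q h, f (ArrowGroupoid.GradedH0.shift _ Λ.isCocycle_deg q h) =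
      ArrowGroupoid.GradedH0.shift _ Ω.isCocycle_deg q (f h))
    (c : AddMonoidAlgebra ℤ (Fin k → ℤ)) (h : Λ.GrH0) : f (c • h) = c • f h := by
  induction c using AddMonoidAlgebra.induction_linear with
  | zero => rw [zero_smul, zero_smul, map_zero]
  | add a b ha hb => rw [add_smul, add_smul, map_add, ha, hb]
  | single q n =>
    have e : AddMonoidAlgebra.single q n = n • AddMonoidAlgebra.single q (1 : ℤ) := by
      simp
    rw [e, smul_assoc, smul_assoc, map_zsmul, ArrowGroupoid.GradedH0.single_smul,
      ArrowGroupoid.GradedH0.single_smul, hf]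

variable [Fintype V] [Fintype W] [DecidableEq V] [DecidableEq W] [CompactSpace Λ.InfPath]
  [CompactSpace Ω.InfPath] (hΛ : Λ.RowFiniteNoSources) (hΩ : Ω.RowFiniteNoSources)

theorem exists_isOrderedIso_of_isDimIso {φ : Λ.DimensionGroup ≃+ Ω.DimensionGroup}
    (hφ : IsDimIso φ) : ∃ ψ : Λ.GrH0 ≃ₗ[AddMonoidAlgebra ℤ (Fin k → ℤ)] Ω.GrH0,
      IsOrderedIso ψ ∧ ∀ h, ψ (kappa hΛ h) = kappa hΩ (φ h) := by
  let F := (kappa hΛ).symm.trans (φ.trans (kappa hΩ))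
  have hF : ∀ h, F (kappa hΛ h) = kappa hΩ (φ h) := fun h => by
    show kappa hΩ (φ ((kappa hΛ).symm (kappa hΛ h))) = _
    rw [AddEquiv.symm_apply_apply]
  have hs : ∀ q h, F (ArrowGroupoid.GradedH0.shift _ Λ.isCocycle_deg q h) =
      ArrowGroupoid.GradedH0.shift _ Ω.isCocycle_deg q (F h) := fun q h => by
    obtain ⟨h, rfl⟩ := (kappa hΛ).surjective h
    rw [← kappa_dimTranslate, hF, hF, hφ.map_dimTranslate, kappa_dimTranslate]
  refine ⟨{ F with map_smul' := map_smul_of_map_shift F.toAddMonoidHom hs }, ?_, hF⟩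
  show F '' _ = _
  rw [← kappa_image_dimPositive hΛ, ← kappa_image_dimPositive hΩ, ← hφ.1, ← Set.image_comp,
    ← Set.image_comp]
  exact Set.image_congr fun h _ => hF h

theorem exists_isDimIso_of_isOrderedIso {ψ : Λ.GrH0 ≃ₗ[AddMonoidAlgebra ℤ (Fin k → ℤ)] Ω.GrH0}
    (hψ : IsOrderedIso ψ) : ∃ φ : Λ.DimensionGroup ≃+ Ω.DimensionGroup,
      IsDimIso φ ∧ ∀ h, ψ (kappa hΛ h) = kappa hΩ (φ h) := by
  let F := (kappa hΛ).trans (ψ.toAddEquiv.trans (kappa hΩ).symm)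
  have hF : ∀ h, ψ (kappa hΛ h) = kappa hΩ (F h) := fun h =>
    ((kappa hΩ).apply_symm_apply _).symm
  refine ⟨F, ⟨?_, fun i h => (kappa hΩ).injective ?_⟩, hF⟩
  · refine (kappa hΩ).injective.image_injective ?_
    rw [kappa_image_dimPositive, ← hψ, ← kappa_image_dimPositive hΛ, ← Set.image_comp,
      ← Set.image_comp]
    exact Set.image_congr fun h _ => (hF h).symm
  -- Under `κ`, `δᵢ` becomes scalar multiplication by the group element `-eᵢ`, which `ψ` respects as
  -- a module map.
  · rw [← hF, dimShift_eq, dimShift_eq, kappa_dimTranslate, kappa_dimTranslate, ← hF,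
      ← ArrowGroupoid.GradedH0.single_smul, ← ArrowGroupoid.GradedH0.single_smul, map_smul]

theorem map_dimUnit_iff_matchesUnitClass {φ : Λ.DimensionGroup ≃+ Ω.DimensionGroup}
    {ψ : Λ.GrH0 ≃ₗ[AddMonoidAlgebra ℤ (Fin k → ℤ)] Ω.GrH0}
    (h : ∀ h, ψ (kappa hΛ h) = kappa hΩ (φ h)) :
    φ Λ.dimUnit = Ω.dimUnit ↔ MatchesUnitClass ψ := by
  rw [← (kappa hΩ).injective.eq_iff, ← h]
  constructor
  · exact fun e => ⟨_, _, (isGrClass_univ_iff hΛ _).2 rfl, (isGrClass_univ_iff hΩ _).2 rfl, e⟩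
  · rintro ⟨a, b, ha, hb, e⟩
    rwa [(isGrClass_univ_iff hΛ _).1 ha, (isGrClass_univ_iff hΩ _).1 hb] at e

end Correspondence

end KGraph

/-! ### The main theorem -/

theorem mainTheorem8 {k : ℕ} (hk : 0 < k) {V P W Q : Type*} [Fintype V] [Fintype W] [DecidableEq V]
    [DecidableEq W] (Λ : KGraph k V P) (Ω : KGraph k W Q) (hΛ : Λ.RowFiniteNoSources)
    (hΩ : Ω.RowFiniteNoSources) :
    List.TFAE [
      MatrixCondition Λ Ω,
      ∃ φ : Λ.DimensionGroup ≃+ Ω.DimensionGroup, IsDimIso φ,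
      TalentedIso Λ Ω,
      ∃ ψ : Λ.GrH0 ≃ₗ[AddMonoidAlgebra ℤ (Fin k → ℤ)] Ω.GrH0, IsOrderedIso ψ] ∧
    ∃ (κΛ : Λ.DimensionGroup ≃+ Λ.GrH0) (κΩ : Ω.DimensionGroup ≃+ Ω.GrH0),
      (∀ v n, Λ.IsGrClass {x | x.vert 0 = v} n (κΛ (Λ.dimClass n (Pi.single v 1)))) ∧
      (∀ w n, Ω.IsGrClass {y | y.vert 0 = w} n (κΩ (Ω.dimClass n (Pi.single w 1)))) ∧
      (∀ φ : Λ.DimensionGroup ≃+ Ω.DimensionGroup, IsDimIso φ →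
        ∃ ψ : Λ.GrH0 ≃ₗ[AddMonoidAlgebra ℤ (Fin k → ℤ)] Ω.GrH0, IsOrderedIso ψ ∧
          ∀ h, ψ (κΛ h) = κΩ (φ h)) ∧
      (∀ ψ : Λ.GrH0 ≃ₗ[AddMonoidAlgebra ℤ (Fin k → ℤ)] Ω.GrH0, IsOrderedIso ψ →
        ∃ φ : Λ.DimensionGroup ≃+ Ω.DimensionGroup, IsDimIso φ ∧
          ∀ h, ψ (κΛ h) = κΩ (φ h)) ∧
      (∀ (φ : Λ.DimensionGroup ≃+ Ω.DimensionGroup)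
        (ψ : Λ.GrH0 ≃ₗ[AddMonoidAlgebra ℤ (Fin k → ℤ)] Ω.GrH0), IsDimIso φ → IsOrderedIso ψ →
        (∀ h, ψ (κΛ h) = κΩ (φ h)) → (φ Λ.dimUnit = Ω.dimUnit ↔ MatchesUnitClass ψ)) := by
  have := KGraph.compactSpace_infPath hΛ
  have := KGraph.compactSpace_infPath hΩ
  refine ⟨?_, KGraph.kappa hΛ, KGraph.kappa hΩ, fun v n => ?_, fun w n => ?_,
    fun φ hφ => KGraph.exists_isOrderedIso_of_isDimIso hΛ hΩ hφ,
    fun ψ hψ => KGraph.exists_isDimIso_of_isOrderedIso hΛ hΩ hψ,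
    fun φ ψ _ _ h => KGraph.map_dimUnit_iff_matchesUnitClass hΛ hΩ h⟩
  · tfae_have 1 → 2 := KGraph.exists_dimIso_of_matrixCondition hΛ hΩ
    tfae_have 2 → 1 := fun ⟨_, hφ⟩ => KGraph.matrixCondition_of_isDimIso hΛ hΩ hφ
    tfae_have 2 → 3 := fun ⟨_, hφ⟩ => KGraph.talentedIso_of_isDimIso hΛ hΩ hφ
    tfae_have 3 → 2 := KGraph.exists_isDimIso_of_talentedIso hΛ hΩ
    tfae_have 2 → 4 := fun ⟨_, hφ⟩ =>
      (KGraph.exists_isOrderedIso_of_isDimIso hΛ hΩ hφ).imp fun _ h => h.1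
    tfae_have 4 → 2 := fun ⟨_, hψ⟩ =>
      (KGraph.exists_isDimIso_of_isOrderedIso hΛ hΩ hψ).imp fun _ h => h.1
    tfae_finish
  · rw [KGraph.kappa_single]
    exact KGraph.isGrClass_vertexClass v n
  · rw [KGraph.kappa_single]
    exact KGraph.isGrClass_vertexClass w n
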